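/- **Notation.** For a commutative ring $B$ let $\mathcal G_B=B^\times/(B^\times)^2$, $\mathcal R_B=\mathbb Z[\mathcal G_B]$, with augmentation ideal $\mathcal I_B$. For $a\in B^\times$ let $\langle a\rangle\in\mathcal R_B$ be the class of $a$ and $\langle\langle a\rangle\rangle=\langle a\rangle-1$. Put $\mathcal W_B=\{a\in B^\times: 1-a\in B^\times\}$. Let $\mathcal{RP}(B)$ be the $\mathcal R_B$-module generated by symbols $[a]$, $a\in\mathcal W_B$, subject to the relations $$[a]-[b]+\langle a\rangle\Big[\frac ba\Big]-\langle a^{-1}-1\rangle\Big[\frac{1-a^{-1}}{1-b^{-1}}\Big]+\langle 1-a\rangle\Big[\frac{1-a}{1-b}\Big]=0\qquad(a,b,a/b\in\mathcal W_B),$$ let $\lambda_1:\mathcal{RP}(B)\to\mathcal I_B^2\subseteq\mathcal R_B$ be the $\mathcal R_B$-homomorphism $[a]\mapsto\langle\langle a\rangle\rangle\langle\langle 1-a\rangle\rangle$, and let $\mathcal{RP}_1(B)=\ker\lambda_1$. For an abelian group $M$ put $M[\tfrac12]=M\otimes_{\mathbb Z}\mathbb Z[\tfrac12]$. A field $k$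 is *sufficiently large* if it is infinite, or if $|k|=p^d$ with $p$ prime and $(p-1)d>6$. For such a $k$ and $a\in\mathcal W_k$ let $\psi_1(a)=[a]+\langle-1\rangle[a^{-1}]\in\mathcal{RP}(k)$, let $\mathcal K_k$ be the $\mathcal R_k$-submodule of $\mathcal{RP}(k)$ generated by all $\psi_1(a)$, let $\widetilde{\mathcal{RP}}(k)=\mathcal{RP}(k)/\mathcal K_k$, and let $\widetilde{\mathcal{RP}}_1(k)$ be the kernel of the homomorphism $\widetilde{\mathcal{RP}}(k)\to\mathcal R_k/(\langle-1\rangle+1)\mathcal I_k$ induced by $\lambda_1$. Let $C_k=[c]+\langle-1\rangle[1-c]+\langle\langle1-c\rangle\rangle\psi_1(c)\in\mathcal{RP}(k)$, $c\in\mathcal W_k$. Its image in $\widetilde{\mathcal{RP}}(k)$, again denoted $C_k$, does not depend on $c$. In $\widetilde{\mathcal{RP}}(k)$ put $[1]=0$. **Theorem.** Let $A$ be a discrete valuation ring with field of fractions $F$, valuation $v$ and sufficiently large residue field $k$, and let $\pi$ be a uniformizer. $\mathcal R_F$- and $\mathcal R_k$-modules are regarded as $\mathcal R_A$-modules through $\mathcal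 R_A\to\mathcal R_F$ and $\mathcal R_A\to\mathcal R_k$. For an $\mathcal R_k$-module $M$ let $\mathrm{Ind}_k^FM=\mathcal R_F\otimes_{\mathcal R_A}M$, and let $\rho_\pi:\mathrm{Ind}_k^FM\to M$ be the $\mathcal R_A$-homomorphism with $\rho_\pi(\langle u\pi^r\rangle\otimes m)=\langle\bar u\rangle m$ if $r$ is odd and $=0$ if $r$ is even ($u\in A^\times$, $r\in\mathbb Z$, $m\in M$). Then: 1. The natural map $\mathcal{RP}_1(k)\to\widetilde{\mathcal{RP}}_1(k)$ becomes an isomorphism after inverting $2$. 2. There is a (unique) $\mathcal R_F$-homomorphism $S_v:\mathcal{RP}(F)\to\mathrm{Ind}_k^F\widetilde{\mathcal{RP}}(k)$ with $S_v([a])=1\otimes[\bar a]$ if $v(a)=0$, $S_v([a])=1\otimes C_k$ if $v(a)>0$, and $S_v([a])=-(1\otimes C_k)$ if $v(a)<0$. The composite $\rho_\pi\circ S_v$ restricts to an $\mathcal R_A$-homomorphism $\delta_\pi:\mathcal{RP}_1(F)\to\widetilde{\mathcal{RP}}_1(k)$. 3. With $\delta_\pi:\mathcal I_F\mathcal{RP}_1(F)[\tfrac12]\to\widetilde{\mathcal{RP}}_1(k)[\tfrac12]\cong\mathcal{RP}_1(k)[\tfrac12]$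 denoting also the map obtained by restricting to $\mathcal I_F\mathcal{RP}_1(F)$, inverting $2$ and using the isomorphism in 1, the sequence of $\mathcal R_A$-modules $$\mathcal I_A\mathcal{RP}_1(A)[\tfrac12]\longrightarrow\mathcal I_F\mathcal{RP}_1(F)[\tfrac12]\xrightarrow{\ \delta_\pi\ }\mathcal{RP}_1(k)[\tfrac12]\longrightarrow0,$$ whose first map is induced by $A\subset F$ (so $[a]\mapsto[a]$), is exact. -/

import Mathlib

open scoped TensorProduct

noncomputable section

namespace RefinedScissors

universe u v w

/-! ### Restriction of scalars, induction, inverting 2 -/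

/-- `Res σ M` is the `S`-module `M`, viewed as an `R`-module along `σ : R →+* S`. -/
def Res {R : Type u} {S : Type v} [CommRing R] [CommRing S] (_ : R →+* S) (M : Type w) : Type w := M

section Res

variable {R : Type u} {S : Type v} [CommRing R] [CommRing S] (σ : R →+* S)
  (M : Type w) [AddCommGroup M] [Module S M]

instance : AddCommGroup (Res σ M) := inferInstanceAs (AddCommGroup M)

/-- The original `S`-module structure. -/
instance : Module S (Res σ M) := inferInstanceAs (Module S M)

/-- The restricted `R`-module structure. -/
instance : Module R (Res σ M) := Module.compHom M σ

instance : SMulCommClass R S (Res σ M) where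
  smul_comm r s m := smul_comm (N := S) (α := M) (σ r) s m

/-- The identity map `M → Res σ M`. -/
def Res.mk : M ≃+ Res σ M := AddEquiv.refl M

variable {M} in
theorem Res.mk_smul (r : R) (m : M) : Res.mk σ M (σ r • m) = r • Res.mk σ M m := rfl

/-- Restriction of scalars for a linear map. -/
def Res.map {N : Type*} [AddCommGroup N] [Module S N] (f : M →ₗ[S] N) :
    Res σ M →ₗ[R] Res σ N where
  toFun m := Res.mk σ N (f ((Res.mk σ M).symm m))
  map_add' x y := map_add f x y
  map_smul' r x := map_smul f (σ r) x

end Res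

/-- The induced `S`-module `S ⊗_R M`, for ring homomorphisms `σ : R → S`, `τ : R → T` and a
`T`-module `M`. -/
abbrev Ind {R S T : Type*} [CommRing R] [CommRing S] [CommRing T] (σ : R →+* S) (τ : R →+* T)
    (M : Type*) [AddCommGroup M] [Module T M] : Type _ :=
  Res σ S ⊗[R] Res τ M

/-- The element `s ⊗ m` of the induced module. -/
def Ind.tmul {R S T : Type*} [CommRing R] [CommRing S] [CommRing T] (σ : R →+* S) (τ : R →+* T)
    {M : Type*} [AddCommGroup M] [Module T M] (s : S) (m : M) : Ind σ τ M :=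
  Res.mk σ S s ⊗ₜ[R] Res.mk τ M m

/-- `M[1/2] = M ⊗_ℤ ℤ[1/2]`, with the `R`-module structure of the left factor. -/
abbrev Half (M : Type*) [AddCommGroup M] : Type _ :=
  M ⊗[ℤ] Localization.Away (2 : ℤ)

/-- The `R`-linear map `f[1/2] : M[1/2] → N[1/2]`. -/
def half {R M N : Type*} [CommRing R] [AddCommGroup M] [AddCommGroup N] [Module R M] [Module R N]
    (f : M →ₗ[R] N) : Half M →ₗ[R] Half N :=
  TensorProduct.AlgebraTensorModule.map f LinearMap.id

/-! ### The group of square classes and its group ring -/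

section SquareClasses

/-- The group `𝒢_A = Aˣ / (Aˣ)²` of square classes. -/
abbrev SqClass (A : Type u) [CommRing A] : Type u := Aˣ ⧸ (powMonoidHom 2 : Aˣ →* Aˣ).range

/-- The group ring `ℛ_A = ℤ[𝒢_A]`. -/
def GR (A : Type u) [CommRing A] : Type u := MonoidAlgebra ℤ (SqClass A)

instance (A : Type u) [CommRing A] : CommRing (GR A) :=
  inferInstanceAs (CommRing (MonoidAlgebra ℤ (SqClass A)))

/-- The identity map, as an isomorphism from `ℛ_A` to Mathlib's group ring. -/
def GR.equiv (A : Type u) [CommRing A] : GR A ≃+* MonoidAlgebra ℤ (SqClass A) :=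
  RingEquiv.refl (MonoidAlgebra ℤ (SqClass A))

variable {A : Type u} [CommRing A]

/-- The inclusion `𝒢_A → ℛ_A`. -/
def GR.of (A : Type u) [CommRing A] : SqClass A →* GR A :=
  ((GR.equiv A).symm : MonoidAlgebra ℤ (SqClass A) →* GR A).comp (MonoidAlgebra.of ℤ (SqClass A))

/-- The homomorphism `Aˣ → ℛ_A`, `a ↦ ⟨a⟩`. -/
def angHom (A : Type u) [CommRing A] : Aˣ →* GR A :=
  (GR.of A).comp (QuotientGroup.mk' _)

/-- The element `⟨a⟩` of `ℛ_A`. -/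
abbrev ang (a : Aˣ) : GR A := angHom A a

/-- The element `⟨⟨a⟩⟩ = ⟨a⟩ - 1` of `ℛ_A`. -/
abbrev dang (a : Aˣ) : GR A := ang a - 1

theorem ang_sq (a : Aˣ) : angHom A a * angHom A a = 1 := by
  have h : (QuotientGroup.mk' (powMonoidHom 2 : Aˣ →* Aˣ).range) (a * a) = 1 :=
    (QuotientGroup.eq_one_iff (N := (powMonoidHom 2 : Aˣ →* Aˣ).range) (a * a)).2
      ⟨a, by simp [pow_two]⟩
  rw [← map_mul, angHom, MonoidHom.comp_apply, h, map_one]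

theorem ang_inv (a : Aˣ) : angHom A a⁻¹ = angHom A a := by
  have h : ang a⁻¹ * ang a = 1 := by rw [← map_mul, inv_mul_cancel, map_one]
  linear_combination ang a * h - ang a⁻¹ * ang_sq a

/-- The augmentation `ℛ_A → ℤ`. -/
def aug (A : Type u) [CommRing A] : GR A →+* ℤ :=
  (MonoidAlgebra.lift ℤ ℤ (SqClass A) (1 : SqClass A →* ℤ)).toRingHom.comp
    (GR.equiv A).toRingHom

theorem aug_of (g : SqClass A) : aug A (GR.of A g) = 1 :=
  MonoidAlgebra.lift_of (R := ℤ) (1 : SqClass A →* ℤ) g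

/-- The augmentation ideal `ℐ_A` of `ℛ_A`. -/
def augIdeal (A : Type u) [CommRing A] : Ideal (GR A) := RingHom.ker (aug A)

variable {B : Type v} [CommRing B]

/-- The homomorphism `𝒢_A → 𝒢_B` induced by `f : A → B`. -/
def mapSq (f : A →+* B) : SqClass A →* SqClass B :=
  QuotientGroup.map _ _ (Units.map f.toMonoidHom) (by
    rintro _ ⟨a, rfl⟩
    exact ⟨Units.map f.toMonoidHom a, by simp⟩)

/-- The ring homomorphism `ℛ_A → ℛ_B` induced by `f : A → B`. -/
def mapGR (f : A →+* B) : GR A →+* GR B :=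
  ((GR.equiv B).symm.toRingHom.comp (MonoidAlgebra.mapDomainRingHom ℤ (mapSq f))).comp
    (GR.equiv A).toRingHom

theorem mapGR_of (f : A →+* B) (g : SqClass A) :
    mapGR f (GR.of A g) = GR.of B (mapSq f g) :=
  congrArg (GR.equiv B).symm (MonoidAlgebra.mapDomain_single (f := mapSq f) (a := g) (r := (1 : ℤ)))

theorem mapGR_ang (f : A →+* B) (a : Aˣ) :
    mapGR f (ang a) = ang (Units.map f.toMonoidHom a) :=
  mapGR_of f _

/-- Ring homomorphisms out of `ℛ_A` agree if they agree on `𝒢_A`. -/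
theorem GR.hom_ext {S : Type*} [CommRing S] {f g : GR A →+* S}
    (h : ∀ x, f (GR.of A x) = g (GR.of A x)) : f = g := by
  have : f.comp (GR.equiv A).symm.toRingHom = g.comp (GR.equiv A).symm.toRingHom :=
    MonoidAlgebra.ringHom_ext' (Subsingleton.elim _ _) (MonoidHom.ext h)
  exact RingHom.ext fun x => congrArg (fun k => k (GR.equiv A x)) this

theorem mapGR_mem (f : A →+* B) {x : GR A} (hx : x ∈ augIdeal A) : mapGR f x ∈ augIdeal B := by
  have h : (aug B).comp (mapGR f) = aug A :=
    GR.hom_ext fun g => by rw [RingHom.comp_apply, mapGR_of, aug_of, aug_of]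
  rw [augIdeal, RingHom.mem_ker, ← RingHom.comp_apply, h]
  exact hx

end SquareClasses

/-! ### The module `ℛ𝒫(A)` -/

section RP

variable {A : Type u} [CommRing A]

/-- The set `𝒲_A` of units `a` such that `1 - a` is a unit. -/
abbrev W (A : Type u) [CommRing A] : Type u := {a : Aˣ // IsUnit (1 - (a : A))}

/-- The unit `1 - a`, for `a ∈ 𝒲_A`. -/
def W.compl (a : W A) : Aˣ := a.2.unit

theorem W.coe_compl (a : W A) : ((W.compl a : Aˣ) : A) = 1 - (a.1 : A) := rfl

/-- The element `a⁻¹` of `𝒲_A`, for `a ∈ 𝒲_A`. -/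
def W.inv (a : W A) : W A := ⟨a.1⁻¹, by
  have h : 1 - ((a.1⁻¹ : Aˣ) : A) = ((-(a.1⁻¹ * W.compl a) : Aˣ) : A) := by
    simp [W.coe_compl, mul_sub]
  rw [h]; exact Units.isUnit _⟩

theorem W.compl_inv (a : W A) : W.compl (W.inv a) = -(a.1⁻¹ * W.compl a) := by
  ext; rw [W.coe_compl]; simp [W.coe_compl, W.inv, mul_sub]

/-- The element `1 - a` of `𝒲_A`, for `a ∈ 𝒲_A`. -/
def W.oneSub (a : W A) : W A := ⟨W.compl a, by simp [W.coe_compl]⟩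

/-- The generator `[x]` of the free `ℛ_A`-module on `𝒲_A`; zero if `x ∉ 𝒲_A`. -/
def freeSym (x : Aˣ) : W A →₀ GR A :=
  open Classical in if h : IsUnit (1 - (x : A)) then Finsupp.single ⟨x, h⟩ 1 else 0

/-- The element
`[a] - [b] + ⟨a⟩[b/a] - ⟨a⁻¹ - 1⟩[(1 - a⁻¹)/(1 - b⁻¹)] + ⟨1 - a⟩[(1 - a)/(1 - b)]`. -/
def fiveTerm (a b : W A) : W A →₀ GR A :=
  freeSym a.1 - freeSym b.1 + ang a.1 • freeSym (b.1 / a.1)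
    - ang (-W.compl (W.inv a)) • freeSym (W.compl (W.inv a) / W.compl (W.inv b))
    + ang (W.compl a) • freeSym (W.compl a / W.compl b)

/-- The relations of `ℛ𝒫(A)`: the five term elements for `a, b, a/b ∈ 𝒲_A`. -/
def relations (A : Type u) [CommRing A] : Submodule (GR A) (W A →₀ GR A) :=
  Submodule.span (GR A)
    {y | ∃ a b : W A, IsUnit (1 - ((a.1 / b.1 : Aˣ) : A)) ∧ y = fiveTerm a b}

/-- The `ℛ_A`-module `ℛ𝒫(A)`. -/
abbrev RP (A : Type u) [CommRing A] : Type u := (W A →₀ GR A) ⧸ relations A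

/-- The element `[x]` of `ℛ𝒫(A)` for `x ∈ 𝒲_A`; by convention `[x] = 0` if `x ∉ 𝒲_A`. -/
def sym (x : Aˣ) : RP A := (relations A).mkQ (freeSym x)

theorem freeSym_of_mem (x : Aˣ) (h : IsUnit (1 - (x : A))) :
    freeSym x = Finsupp.single (⟨x, h⟩ : W A) 1 := by
  rw [freeSym, dif_pos h]

theorem one_sub_div₁ (a b : W A) (c : Aˣ) (hc : (c : A) = 1 - ((a.1 / b.1 : Aˣ) : A)) :
    ((-(b.1 * a.1⁻¹ * c) : Aˣ) : A) = 1 - ((b.1 / a.1 : Aˣ) : A) := by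
  simp only [div_eq_mul_inv, Units.val_mul, Units.val_neg] at hc ⊢
  rw [hc]
  have ha := a.1.mul_inv
  have hb := b.1.mul_inv
  linear_combination ha * b.1 * (b.1⁻¹ : Aˣ) + hb

theorem one_sub_div₂ (a b : W A) (c : Aˣ) (hc : (c : A) = 1 - ((a.1 / b.1 : Aˣ) : A)) :
    ((-(b.1 * a.1⁻¹ * c * (W.compl b)⁻¹) : Aˣ) : A) =
      1 - ((W.compl (W.inv a) / W.compl (W.inv b) : Aˣ) : A) := by
  rw [W.compl_inv, W.compl_inv]
  have h : (-(a.1⁻¹ * W.compl a) / -(b.1⁻¹ * W.compl b) : Aˣ) =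
      b.1 * a.1⁻¹ * W.compl a * (W.compl b)⁻¹ := by
    rw [neg_div_neg_eq, div_eq_mul_inv, mul_inv, inv_inv, mul_mul_mul_comm, mul_comm a.1⁻¹,
      mul_assoc (b.1 * a.1⁻¹)]
  rw [h]
  simp only [div_eq_mul_inv, Units.val_mul, Units.val_neg] at hc ⊢
  rw [hc, W.coe_compl]
  have ha := a.1.mul_inv
  have hb := b.1.mul_inv
  have hq := (W.compl b).mul_inv
  rw [W.coe_compl] at hq
  grind

theorem one_sub_div₃ (a b : W A) (c : Aˣ) (hc : (c : A) = 1 - ((a.1 / b.1 : Aˣ) : A)) :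
    ((-(b.1 * c * (W.compl b)⁻¹) : Aˣ) : A) = 1 - ((W.compl a / W.compl b : Aˣ) : A) := by
  simp only [div_eq_mul_inv, Units.val_mul, Units.val_neg] at hc ⊢
  rw [hc, W.coe_compl]
  have hb := b.1.mul_inv
  have hq := (W.compl b).mul_inv
  rw [W.coe_compl] at hq
  grind

/-- The map `[a] ↦ ⟨⟨a⟩⟩⟨⟨1 - a⟩⟩` on the free module. -/
def freeLambda (A : Type u) [CommRing A] : (W A →₀ GR A) →ₗ[GR A] GR A :=
  Finsupp.linearCombination (GR A) (fun a : W A => dang a.1 * dang (W.compl a))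

theorem freeLambda_freeSym (x y : Aˣ) (h : (y : A) = 1 - (x : A)) :
    freeLambda A (freeSym x) = dang x * dang y := by
  have hx : IsUnit (1 - (x : A)) := h ▸ y.isUnit
  have hy : W.compl (⟨x, hx⟩ : W A) = y := Units.ext (by rw [h]; rfl)
  rw [freeSym_of_mem x hx, freeLambda, Finsupp.linearCombination_single, one_smul, hy]

theorem relations_le_ker (A : Type u) [CommRing A] : relations A ≤ LinearMap.ker (freeLambda A) := by
  refine Submodule.span_le.2 ?_
  rintro _ ⟨a, b, ⟨c, hc⟩, rfl⟩
  rw [SetLike.mem_coe, LinearMap.mem_ker, fiveTerm]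
  simp only [map_add, map_sub, map_smul, smul_eq_mul]
  rw [freeLambda_freeSym a.1 (W.compl a) rfl, freeLambda_freeSym b.1 (W.compl b) rfl,
    freeLambda_freeSym _ _ (one_sub_div₁ a b c hc), freeLambda_freeSym _ _ (one_sub_div₂ a b c hc),
    freeLambda_freeSym _ _ (one_sub_div₃ a b c hc), W.compl_inv, W.compl_inv, neg_neg]
  rw [neg_div_neg_eq]
  have hn : ∀ x : Aˣ, angHom A (-x) = angHom A (-1) * angHom A x := fun x => by rw [← map_mul, neg_one_mul]
  simp only [dang, ang]
  rw [hn (_ * _), hn (_ * _), hn (_ * _)]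
  simp only [div_eq_mul_inv, map_mul, mul_inv, ang_inv]
  have h1 := ang_sq (-1 : Aˣ)
  have ha := ang_sq a.1
  have hb := ang_sq b.1
  have hcc := ang_sq c
  have hp := ang_sq (W.compl a)
  have hq := ang_sq (W.compl b)
  generalize angHom A (-1 : Aˣ) = m at *
  generalize angHom A a.1 = x at *
  generalize angHom A b.1 = y at *
  generalize angHom A c = r at *
  generalize angHom A (W.compl a) = p at *
  generalize angHom A (W.compl b) = q at *
  grind

/-- The homomorphism `λ₁ : ℛ𝒫(A) → ℛ_A`, `[a] ↦ ⟨⟨a⟩⟩⟨⟨1 - a⟩⟩`. -/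
def lambdaOne (A : Type u) [CommRing A] : RP A →ₗ[GR A] GR A :=
  (relations A).liftQ (freeLambda A) (relations_le_ker A)

theorem lambdaOne_sym (x y : Aˣ) (h : (y : A) = 1 - (x : A)) :
    lambdaOne A (sym x) = dang x * dang y :=
  freeLambda_freeSym x y h

/-- The refined scissors congruence group `ℛ𝒫₁(A) = ker λ₁`. -/
def RPOne (A : Type u) [CommRing A] : Submodule (GR A) (RP A) := LinearMap.ker (lambdaOne A)

/-- The submodule `ℐ_A ℛ𝒫₁(A)`. -/
def IRPOne (A : Type u) [CommRing A] : Submodule (GR A) (RP A) := augIdeal A • RPOne A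

/-- The inclusion `ℐ_A ℛ𝒫₁(A) → ℛ𝒫₁(A)`. -/
def IRPOne.incl (A : Type u) [CommRing A] : IRPOne A →ₗ[GR A] RPOne A :=
  Submodule.inclusion Submodule.smul_le_right

end RP

/-! ### Functoriality -/

section Functoriality

variable {A : Type u} [CommRing A] {B : Type v} [CommRing B] (f : A →+* B)

/-- The map `𝒲_A → 𝒲_B` induced by `f : A → B`. -/
def W.map (a : W A) : W B := ⟨Units.map f.toMonoidHom a.1, by
  have h : 1 - ((Units.map f.toMonoidHom a.1 : Bˣ) : B) =
      ((Units.map f.toMonoidHom (W.compl a) : Bˣ) : B) := by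
    simp [W.coe_compl]
  rw [h]; exact Units.isUnit _⟩

theorem W.compl_map (a : W A) : W.compl (W.map f a) = Units.map f.toMonoidHom (W.compl a) := by
  ext; rw [W.coe_compl]; simp [W.coe_compl, W.map]

theorem W.inv_map (a : W A) : W.inv (W.map f a) = W.map f (W.inv a) := by
  apply Subtype.ext; simp [W.inv, W.map]

/-- The map `[a] ↦ [f(a)]` on the free module. -/
def freeMap : (W A →₀ GR A) →ₗ[GR A] Res (mapGR f) (RP B) :=
  Finsupp.linearCombination (GR A)
    (fun a : W A => Res.mk (mapGR f) (RP B) (sym (Units.map f.toMonoidHom a.1)))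

theorem freeMap_freeSym (x y : Aˣ) (h : (y : A) = 1 - (x : A)) :
    freeMap f (freeSym x) = Res.mk (mapGR f) (RP B) (sym (Units.map f.toMonoidHom x)) := by
  have hx : IsUnit (1 - (x : A)) := h ▸ y.isUnit
  rw [freeSym_of_mem x hx, freeMap, Finsupp.linearCombination_single, one_smul]

theorem relations_le_ker_map : relations A ≤ LinearMap.ker (freeMap f) := by
  refine Submodule.span_le.2 ?_
  rintro _ ⟨a, b, ⟨c, hc⟩, rfl⟩
  rw [SetLike.mem_coe, LinearMap.mem_ker]
  have key : freeMap f (fiveTerm a b) =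
      Res.mk (mapGR f) (RP B) ((relations B).mkQ (fiveTerm (W.map f a) (W.map f b))) := by
    rw [fiveTerm, fiveTerm]
    simp only [map_add, map_sub, map_smul]
    rw [freeMap_freeSym f a.1 (W.compl a) rfl, freeMap_freeSym f b.1 (W.compl b) rfl,
      freeMap_freeSym f _ _ (one_sub_div₁ a b c hc), freeMap_freeSym f _ _ (one_sub_div₂ a b c hc),
      freeMap_freeSym f _ _ (one_sub_div₃ a b c hc), ← Res.mk_smul, ← Res.mk_smul, ← Res.mk_smul,
      mapGR_ang, mapGR_ang, mapGR_ang]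
    simp only [W.inv_map, W.compl_map, map_div]
    have hneg : ∀ x : Aˣ, Units.map f.toMonoidHom (-x) = -Units.map f.toMonoidHom x := by
      intro x; ext; simp
    rw [hneg]
    rfl
  have hmem : fiveTerm (W.map f a) (W.map f b) ∈ relations B := by
    refine Submodule.subset_span ⟨_, _, ?_, rfl⟩
    have h : 1 - (((W.map f a).1 / (W.map f b).1 : Bˣ) : B) =
        ((Units.map f.toMonoidHom c : Bˣ) : B) := by
      have : (W.map f a).1 / (W.map f b).1 = Units.map f.toMonoidHom (a.1 / b.1) := by
        simp [W.map]
      rw [this, Units.coe_map, Units.coe_map, hc]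
      simp
    rw [h]; exact Units.isUnit _
  rw [key, Submodule.mkQ_apply, (Submodule.Quotient.mk_eq_zero _).2 hmem, map_zero]

/-- The natural `ℛ_A`-homomorphism `ℛ𝒫(A) → ℛ𝒫(B)`, `[a] ↦ [f(a)]`. -/
def RP.map : RP A →ₗ[GR A] Res (mapGR f) (RP B) :=
  (relations A).liftQ (freeMap f) (relations_le_ker_map f)

theorem lambdaOne_map (x : RP A) :
    lambdaOne B ((Res.mk (mapGR f) (RP B)).symm (RP.map f x)) = mapGR f (lambdaOne A x) := by
  have h : (Res.map (mapGR f) _ (lambdaOne B)).comp ((RP.map f).comp (relations A).mkQ) =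
      (({ toFun := fun r => Res.mk (mapGR f) (GR B) (mapGR f r)
          map_add' := fun a b => map_add (mapGR f) a b
          map_smul' := fun a b => map_mul (mapGR f) a b } :
        GR A →ₗ[GR A] Res (mapGR f) (GR B)).comp (lambdaOne A)).comp (relations A).mkQ := by
    refine Finsupp.lhom_ext' fun a => LinearMap.ext_ring ?_
    have ha : (Finsupp.single a (1 : GR A)) = freeSym a.1 := (freeSym_of_mem a.1 a.2).symm
    simp only [LinearMap.comp_apply, Finsupp.lsingle_apply, ha]
    change lambdaOne B (freeMap f (freeSym a.1)) = mapGR f (lambdaOne A (sym a.1))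
    rw [freeMap_freeSym f a.1 (W.compl a) rfl, lambdaOne_sym a.1 (W.compl a) rfl, map_mul, map_sub,
      map_sub, map_one, mapGR_ang, mapGR_ang]
    exact lambdaOne_sym _ _ (by simp [W.coe_compl])
  obtain ⟨y, rfl⟩ := Submodule.mkQ_surjective _ x
  exact congrArg (fun g => g y) h

theorem RP.map_mem {x : RP A} (hx : x ∈ IRPOne A) :
    (Res.mk (mapGR f) (RP B)).symm (RP.map f x) ∈ IRPOne B := by
  refine Submodule.smul_induction_on hx (fun r hr n hn => ?_) (fun x y hx hy => ?_)
  · have h : (Res.mk (mapGR f) (RP B)).symm (RP.map f (r • n)) =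
        mapGR f r • (Res.mk (mapGR f) (RP B)).symm (RP.map f n) := by
      rw [map_smul]; rfl
    rw [h]
    refine Submodule.smul_mem_smul (mapGR_mem f hr) ?_
    rw [RPOne, LinearMap.mem_ker, lambdaOne_map, show lambdaOne A n = 0 from hn, map_zero]
  · rw [map_add, map_add]; exact add_mem hx hy

/-- The natural `ℛ_A`-homomorphism `ℐ_A ℛ𝒫₁(A) → ℐ_B ℛ𝒫₁(B)`. -/
def IRPOne.map : IRPOne A →ₗ[GR A] Res (mapGR f) (IRPOne B) where
  toFun x := Res.mk (mapGR f) (IRPOne B) ⟨_, RP.map_mem f x.2⟩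
  map_add' x y := congrArg (Res.mk (mapGR f) (IRPOne B)) (Subtype.ext (map_add (RP.map f) x.1 y.1))
  map_smul' r x := congrArg (Res.mk (mapGR f) (IRPOne B)) (Subtype.ext (map_smul (RP.map f) r x.1))

end Functoriality

/-! ### The quotient of `ℛ𝒫(k)` by the elements `ψ₁(a)`, for a field `k` -/

section Tilde

/-- The element `ψ₁(a) = [a] + ⟨-1⟩[a⁻¹]`, for `a ∈ 𝒲_A`. -/
def psiOne {A : Type u} [CommRing A] (a : W A) : RP A :=
  sym a.1 + ang (-1 : Aˣ) • sym (W.inv a).1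

/-- The element `[a] + ⟨-1⟩[1 - a] + ⟨⟨1 - a⟩⟩ψ₁(a)`, for `a ∈ 𝒲_A`. Over a field with sufficiently
many elements it does not depend on `a`, and is the constant `C`. -/
def constC {A : Type u} [CommRing A] (a : W A) : RP A :=
  sym a.1 + ang (-1 : Aˣ) • sym (W.oneSub a).1 + dang (W.compl a) • psiOne a

variable (k : Type u) [Field k]

/-- The submodule `𝒦⁽¹⁾` of `ℛ𝒫(k)` generated by the `ψ₁(a)`. For a field, `kˣ = 𝒲_k ∪ {1}`, and
`ψ₁(1) = 0`. -/
def KOne : Submodule (GR k) (RP k) := Submodule.span (GR k) (Set.range psiOne)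

/-- The quotient `ℛ𝒫(k) / 𝒦⁽¹⁾`. -/
abbrev RPt : Type u := RP k ⧸ KOne k

/-- The ideal `p₋₁⁺ ℐ_k` of `ℛ_k`, where `p₋₁⁺ = ⟨-1⟩ + 1`. -/
def pI : Ideal (GR k) := Ideal.span {ang (-1 : kˣ) + 1} * augIdeal k

theorem dang_mem {A : Type u} [CommRing A] (a : Aˣ) : dang a ∈ augIdeal A := by
  rw [augIdeal, RingHom.mem_ker, map_sub, map_one, sub_eq_zero]
  exact aug_of _

theorem lambdaOne_psiOne {A : Type u} [CommRing A] (a : W A) :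
    lambdaOne A (psiOne a) = -((ang (-1 : Aˣ) + 1) * dang a.1) := by
  rw [psiOne, map_add, map_smul, lambdaOne_sym a.1 (W.compl a) rfl,
    lambdaOne_sym (W.inv a).1 (W.compl (W.inv a)) rfl, W.compl_inv]
  have hn : ∀ x : Aˣ, angHom A (-x) = angHom A (-1) * angHom A x := fun x => by rw [← map_mul, neg_one_mul]
  simp only [dang, ang, W.inv, smul_eq_mul]
  rw [hn (_ * _), map_mul, ang_inv]
  have h1 := ang_sq (-1 : Aˣ)
  have ha := ang_sq a.1
  generalize angHom A (-1 : Aˣ) = m at *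
  generalize angHom A a.1 = x at *
  generalize angHom A (W.compl a) = p at *
  grind

theorem KOne_le : KOne k ≤ Submodule.comap (lambdaOne k) (pI k) := by
  refine Submodule.span_le.2 ?_
  rintro _ ⟨a, rfl⟩
  change lambdaOne k (psiOne a) ∈ pI k
  rw [lambdaOne_psiOne]
  exact neg_mem (Ideal.mul_mem_mul (Ideal.subset_span rfl) (dang_mem _))

/-- The homomorphism induced by `λ₁` on `ℛ𝒫(k) / 𝒦⁽¹⁾`, with values modulo `p₋₁⁺ ℐ_k`. -/
def lambdaOneTilde : RPt k →ₗ[GR k] (GR k ⧸ pI k) :=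
  Submodule.mapQ (KOne k) (pI k) (lambdaOne k) (KOne_le k)

/-- The kernel of `lambdaOneTilde`. -/
def RPtOne : Submodule (GR k) (RPt k) := LinearMap.ker (lambdaOneTilde k)

/-- The natural map from `ℛ𝒫₁(k)` to `RPtOne k`. -/
def toTilde : RPOne k →ₗ[GR k] RPtOne k :=
  ((KOne k).mkQ.comp (RPOne k).subtype).codRestrict (RPtOne k) (by
    rintro ⟨x, hx⟩
    change Submodule.Quotient.mk (lambdaOne k x) = 0
    rw [show lambdaOne k x = 0 from hx]; rfl)

end Tilde

/-! ### Discrete valuation rings: the map `ρ_π` and the specialization map -/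

section DVR

theorem GR.addHom_ext {A : Type*} [CommRing A] {M : Type*} [AddCommGroup M] {f g : GR A →+ M}
    (h : ∀ x, f (GR.of A x) = g (GR.of A x)) : f = g := by
  have key : f.comp (GR.equiv A).symm.toAddEquiv.toAddMonoidHom =
      g.comp (GR.equiv A).symm.toAddEquiv.toAddMonoidHom := by
    refine MonoidAlgebra.addMonoidHom_ext fun x n => ?_
    have hs : MonoidAlgebra.single x n = n • MonoidAlgebra.of ℤ (SqClass A) x := by
      simp [MonoidAlgebra.of_apply]
    rw [hs, map_zsmul, map_zsmul]
    exact congrArg (n • ·) (h x)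
  exact AddMonoidHom.ext fun x => congrArg (fun k => k (GR.equiv A x)) key

open IsLocalRing

variable (A : Type u) [CommRing A] [IsDomain A] [IsDiscreteValuationRing A]
  (F : Type v) [Field F] [Algebra A F] [IsFractionRing A F]

/-- The ring homomorphism `ℛ_A → ℛ_F`. -/
abbrev toFrac : GR A →+* GR F := mapGR (algebraMap A F)

/-- The ring homomorphism `ℛ_A → ℛ_k`, where `k` is the residue field of `A`. -/
abbrev toRes : GR A →+* GR (ResidueField A) := mapGR (residue A)

/-- The induced module `Ind_k^F M = ℛ_F ⊗_{ℛ_A} M` of an `ℛ_k`-module `M`. -/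
abbrev IndRes (M : Type*) [AddCommGroup M] [Module (GR (ResidueField A)) M] : Type _ :=
  Ind (toFrac A F) (toRes A) M

variable {A}

/-- The unit of `F` given by a unit of `A`. -/
abbrev unitF : Aˣ →* Fˣ := Units.map (algebraMap A F).toMonoidHom

/-- The reduction in `kˣ` of a unit of `A`. -/
abbrev red : Aˣ →* (ResidueField A)ˣ := Units.map (residue A).toMonoidHom

/-- A uniformizer of `A`, as a unit of `F`. -/
def unifF {π : A} (hπ : Irreducible π) : Fˣ :=
  Units.mk0 (algebraMap A F π) (by simpa using hπ.ne_zero)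

variable {F}

theorem exists_unit_zpow {π : A} (hπ : Irreducible π) (x : Fˣ) :
    ∃ (n : ℤ) (u : Aˣ), x = unitF F u * unifF F hπ ^ n := by
  obtain ⟨n, u, h⟩ :=
    IsDiscreteValuationRing.exists_units_eq_smul_zpow_of_irreducible hπ x.ne_zero
  refine ⟨n, u, Units.ext ?_⟩
  rw [h]
  simp [unifF, Units.smul_def, Algebra.smul_def]

theorem unit_zpow_inj {π : A} (hπ : Irreducible π) {u w : Aˣ} {m n : ℤ}
    (h : unitF F u * unifF F hπ ^ m = unitF F w * unifF F hπ ^ n) : m = n ∧ u = w := by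
  have hu : ∀ x : Aˣ, ∀ j : ℕ, unitF F x = unifF F hπ ^ j → j = 0 := by
    intro x j hx
    have h1 : algebraMap A F x = algebraMap A F (π ^ j) := by
      have := congrArg (fun y : Fˣ => (y : F)) hx
      simpa [unifF] using this
    have h2 : (x : A) = π ^ j := IsFractionRing.injective A F h1
    by_contra hj
    exact hπ.not_isUnit ((isUnit_pow_iff hj).1 (h2 ▸ x.isUnit))
  have hmn : m = n := by
    have h1 : unitF F (w / u) = unifF F hπ ^ (m - n) := by
      rw [map_div, zpow_sub, ← div_eq_mul_inv, div_eq_div_iff_mul_eq_mul, ← h, mul_comm]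
    have h2 : unitF F (u / w) = unifF F hπ ^ (n - m) := by
      rw [← neg_sub, zpow_neg, ← h1, ← map_inv, inv_div]
    rcases le_total m n with hle | hle
    · obtain ⟨j, hj⟩ := Int.eq_ofNat_of_zero_le (sub_nonneg.2 hle)
      rw [hj] at h2
      have := hu _ j (h2.trans (zpow_natCast _ _))
      omega
    · obtain ⟨j, hj⟩ := Int.eq_ofNat_of_zero_le (sub_nonneg.2 hle)
      rw [hj] at h1
      have := hu _ j (h1.trans (zpow_natCast _ _))
      omega
  refine ⟨hmn, ?_⟩
  rw [hmn] at h
  have h3 := mul_right_cancel h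
  refine Units.ext (IsFractionRing.injective A F ?_)
  simpa using congrArg (fun y : Fˣ => (y : F)) h3

/-- The function on `Fˣ` sending `u π ^ n` to `⟨ū⟩` if `n` is odd and to `0` if `n` is even. -/
def rhoFun {π : A} (hπ : Irreducible π) (x : Fˣ) : GR (ResidueField A) :=
  open Classical in
  if Odd (exists_unit_zpow hπ x).choose then ang (red (exists_unit_zpow hπ x).choose_spec.choose)
  else 0

theorem rhoFun_apply {π : A} (hπ : Irreducible π) (u : Aˣ) (n : ℤ) :
    rhoFun hπ (unitF F u * unifF F hπ ^ n) =
      open Classical in if Odd n then ang (red u) else 0 := by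
  obtain ⟨h1, h2⟩ := unit_zpow_inj hπ
    (exists_unit_zpow hπ (unitF F u * unifF F hπ ^ n)).choose_spec.choose_spec
  exact if_congr (by rw [← h1]) (by rw [← h2]) rfl

theorem rhoFun_mul_sq {π : A} (hπ : Irreducible π) (x y : Fˣ) :
    rhoFun hπ (x * y ^ 2) = rhoFun hπ x := by
  obtain ⟨n, u, rfl⟩ := exists_unit_zpow hπ x
  obtain ⟨m, w, rfl⟩ := exists_unit_zpow hπ y
  have h : unitF F u * unifF F hπ ^ n * (unitF F w * unifF F hπ ^ m) ^ 2 =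
      unitF F (u * w ^ 2) * unifF F hπ ^ (n + 2 * m) := by
    rw [map_mul, map_pow, mul_pow, zpow_add, mul_comm 2 m, zpow_mul, mul_mul_mul_comm]
    rfl
  have ho : Odd (n + 2 * m) ↔ Odd n := by
    rw [Int.odd_add]; simp
  rw [h, rhoFun_apply, rhoFun_apply]
  simp only [ho]
  congr 1
  simp only [ang, map_mul, pow_two, ang_sq, mul_one]

theorem rhoFun_unit_mul {π : A} (hπ : Irreducible π) (w : Aˣ) (x : Fˣ) :
    rhoFun hπ (unitF F w * x) = ang (red w) * rhoFun hπ x := by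
  obtain ⟨n, u, rfl⟩ := exists_unit_zpow hπ x
  rw [← mul_assoc, ← map_mul, rhoFun_apply, rhoFun_apply]
  split_ifs
  · simp only [ang, map_mul]
  · rw [mul_zero]

/-- `rhoFun` on square classes. -/
def rhoSq {π : A} (hπ : Irreducible π) : SqClass F → GR (ResidueField A) :=
  Quotient.lift (rhoFun hπ) (by
    intro x y hxy
    obtain ⟨z, hz⟩ := QuotientGroup.leftRel_apply.1 hxy
    have : y = x * z ^ 2 := by
      rw [show z ^ 2 = x⁻¹ * y from hz, mul_inv_cancel_left]
    rw [this, rhoFun_mul_sq])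

/-- The additive extension of `rhoSq` to `ℛ_F`. -/
def rhoAdd {π : A} (hπ : Irreducible π) : GR F →+ GR (ResidueField A) :=
  ((Finsupp.liftAddHom fun g => (zmultiplesHom (GR (ResidueField A))) (rhoSq hπ g)).comp
    MonoidAlgebra.coeffAddEquiv.toAddMonoidHom).comp (GR.equiv F).toAddEquiv.toAddMonoidHom

theorem rhoAdd_of {π : A} (hπ : Irreducible π) (g : SqClass F) :
    rhoAdd hπ (GR.of F g) = rhoSq hπ g := by
  change (Finsupp.liftAddHom fun g => (zmultiplesHom (GR (ResidueField A))) (rhoSq hπ g))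
    (Finsupp.single g (1 : ℤ)) = _
  rw [Finsupp.liftAddHom_apply_single]
  simp

theorem rhoAdd_smul {π : A} (hπ : Irreducible π) (r : GR A) (s : GR F) :
    rhoAdd hπ (toFrac A F r * s) = toRes A r * rhoAdd hπ s := by
  have h : (AddMonoidHom.mul.compr₂ (rhoAdd (F := F) hπ)).comp (toFrac A F).toAddMonoidHom =
      ((AddMonoidHom.mul.compl₂ (rhoAdd (F := F) hπ)).comp (toRes A).toAddMonoidHom) := by
    refine GR.addHom_ext fun a => GR.addHom_ext fun g => ?_
    induction a using QuotientGroup.induction_on with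
    | H a =>
      induction g using QuotientGroup.induction_on with
      | H g =>
        change rhoAdd hπ (toFrac A F (GR.of A a) * GR.of F g) =
          toRes A (GR.of A a) * rhoAdd hπ (GR.of F g)
        rw [mapGR_of, mapGR_of, ← map_mul, rhoAdd_of, rhoAdd_of]
        exact rhoFun_unit_mul hπ a g
  exact congrArg (fun k => k r s) h

/-- The `ℛ_A`-homomorphism `ρ_π : Ind_k^F M → M`, which sends `⟨u π ^ n⟩ ⊗ m` to `⟨ū⟩ m` if `n` is
odd and to `0` if `n` is even. -/
def rho {π : A} (hπ : Irreducible π) (M : Type*) [AddCommGroup M]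
    [Module (GR (ResidueField A)) M] : IndRes A F M →ₗ[GR A] Res (toRes A) M :=
  TensorProduct.lift <| LinearMap.mk₂ (GR A)
    (fun s m => Res.mk (toRes A) M
      (rhoAdd hπ ((Res.mk (toFrac A F) (GR F)).symm s) • (Res.mk (toRes A) M).symm m))
    (fun s t m => by rw [map_add, map_add, add_smul, map_add])
    (fun r s m => by
      rw [← Res.mk_smul, ← mul_smul, ← rhoAdd_smul]; rfl)
    (fun s m n => by rw [map_add, smul_add, map_add])
    (fun r s m => by
      rw [← Res.mk_smul, ← mul_smul, mul_comm, mul_smul]; rfl)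

theorem rho_apply {π : A} (hπ : Irreducible π) (M : Type*) [AddCommGroup M]
    [Module (GR (ResidueField A)) M] (u : Aˣ) (n : ℤ) (m : M) :
    rho (F := F) hπ M (Ind.tmul (toFrac A F) (toRes A) (ang (unitF F u * unifF F hπ ^ n)) m) =
      Res.mk (toRes A) M (open Classical in if Odd n then ang (red u) • m else 0) := by
  change Res.mk (toRes A) M (rhoAdd hπ (GR.of F _) • m) = _
  rw [rhoAdd_of]
  change Res.mk (toRes A) M (rhoFun hπ (unitF F u * unifF F hπ ^ n) • m) = _
  rw [rhoFun_apply, ite_smul, zero_smul]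

/-- The class of `x` in `ℛ𝒫(k) / 𝒦⁽¹⁾`. -/
abbrev toRPt {k : Type*} [Field k] (x : RP k) : RPt k := (KOne k).mkQ x

/-- `S` is the specialization map `S_v : ℛ𝒫(F) → Ind_k^F (ℛ𝒫(k) / 𝒦⁽¹⁾)`: the `ℛ_F`-homomorphism
sending `[a]` to `1 ⊗ [ā]` if `v(a) = 0` (where `[1] = 0`), to `1 ⊗ C` if `v(a) > 0`, and to
`-(1 ⊗ C)` if `v(a) < 0`, where `C = constC c` for any `c ∈ 𝒲_k`. -/
structure IsSpecialization (S : RP F →ₗ[GR F] IndRes A F (RPt (ResidueField A))) : Prop where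
  of_unit : ∀ (a : W F) (u : Aˣ), (a.1 : F) = algebraMap A F u →
    S (sym a.1) = Ind.tmul (toFrac A F) (toRes A) 1 (toRPt (sym (red u)))
  of_pos : ∀ (a : W F) (x : A), x ∈ maximalIdeal A → (a.1 : F) = algebraMap A F x →
    ∀ c : W (ResidueField A),
      S (sym a.1) = Ind.tmul (toFrac A F) (toRes A) 1 (toRPt (constC c))
  of_neg : ∀ (a : W F) (x : A), x ∈ maximalIdeal A → ((a.1⁻¹ : Fˣ) : F) = algebraMap A F x →
    ∀ c : W (ResidueField A),
      S (sym a.1) = -Ind.tmul (toFrac A F) (toRes A) 1 (toRPt (constC c))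

/-- A field is sufficiently large if it is infinite, or has `p ^ d` elements with
`(p - 1) d > 6`. -/
def SufficientlyLarge (k : Type*) [Field k] : Prop :=
  Infinite k ∨ ∃ p d : ℕ, p.Prime ∧ Nat.card k = p ^ d ∧ 6 < (p - 1) * d

end DVR

end RefinedScissors

end

/-!
Throughout, `ψ₁(a) = [a] + ⟨-1⟩[a⁻¹]`, `𝒦⁽¹⁾ ⊆ ℛ𝒫(K)` is the submodule generated by these
elements, and the class of `[a]` modulo `𝒦⁽¹⁾` is `br a`. The hypothesis on the size of the residue
field is used only to know that it has more than seven elements.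

*The isomorphism after inverting `2`.* The function `ψ₁` is a cocycle for the action of square
classes on `ℛ𝒫(K)` (`psi_mul`), and `2ψ₁` is trivial on squares. So `⟨a⟩ ↦ 2ψ₁(a)` extends to an
additive map on `ℛ_K`, and its composite with `λ₁` is multiplication by `-4` on `𝒦⁽¹⁾`
(`psiHom_lambdaOne`). Hence the intersection of `𝒦⁽¹⁾` and `ℛ𝒫₁(K)` is killed by `4`. Surjectivity
holds without inverting `2` because `λ₁` maps `𝒦⁽¹⁾` onto `(⟨-1⟩ + 1)ℐ_K` (`toTilde_surjective`).

*The specialization map.* Modulo `𝒦⁽¹⁾`, the element `C = [a] + ⟨-1⟩[1 - a]` does not depend on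
`a` (`br_add`), `3C = 0`, and the five term relation has a limit for `b → 0`, in which the symbols
whose argument tends to `0` are replaced by `C` (`br_five_zero`). Therefore the prescribed values
of `S_v` satisfy all five term relations (`fiveTerm_specFun`); the symmetries `x ↦ x⁻¹` and
`x ↦ 1 - x` of the relation leave few cases. The composite `ρ_π ∘ S_v` is compatible with `λ₁` up to
multiples of `⟨-1⟩ + 1` (`exists_lift_rho_spec`), and so it maps `ℛ𝒫₁(F)` to the kernel of the map
induced by `λ₁`.

*Exactness.* Up to powers of `2` it can be checked locally at the prime ideals `p` of `ℛ_A` that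
do not contain `2` (`exists_two_pow_smul_mem`). Since `⟨u⟩² = 1`, such a prime ideal determines a
character `φ : Aˣ → {±1}` through which `ℛ_A` acts on every module localized at `p`. The
localization of `ℛ𝒫(F) / 𝒦⁽¹⁾` is the sum of the eigenspaces of `⟨π⟩` for `σ = ±1`, and `ℛ_F` acts
on each of them through the extension of `φ` by `π ↦ σ`. Symbols with values in a group on which
the group ring acts through a character satisfy strong relations (the lemmas on `IsSignSymbol`),
and these are used as follows.

* If `φ(-1) = -1`, then an element is determined by `λ₁` (`IsSignSymbol.odd_toRPt`), and the
  localization of `ℛ𝒫₁(F)` vanishes.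
* If `φ(-1) = 1` and `φ` is nontrivial on the units congruent to `1`, then `φ(1 - d) = -1` for
  some uniformizer `d`. Five term relations between `d` and units show that each element of
  `ℛ𝒫(F)` agrees in both eigenspaces of `⟨d⟩` with one element of `ℛ𝒫(A)`
  (`exists_toRPF_of_ramified`), and the localizations of all `ℛ_k`-modules vanish.
* If `φ(-1) = 1` and `φ` is trivial on the units congruent to `1`, then symbols depend on their
  specialization only (`symbol_pos`, `symbol_congr`), so the eigenspaces are described by `S_v`
  (`symbol_eq_theta`). An element of the kernel of `ρ_π ∘ S_v` agrees in both eigenspaces with a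
  lift to `ℛ𝒫(A)` of its component at the even powers of `π`. If `φ` is trivial, the latter
  description covers the eigenvalue `-1` only, and it is the factor `ℐ_F` that makes the image of
  an element of the kernel vanish in both eigenspaces.

The element of `ℛ𝒫(A)` so obtained is corrected by a multiple of some `ψ₁(b)`, so that `λ₁`
vanishes on it locally, and multiplied by `⟨b⟩ - 1`, which is invertible in the localization, to
get into `ℐ_A ℛ𝒫₁(A)` (`exists_smul_mem_of_eq`). For the surjectivity of `δ_π`, an element over the residue
field is lifted to an element `y` of `ℛ𝒫(A)`, and `δ_π` is applied to `(⟨π⟩ - 1) y`, up to a factor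
that is invertible in the localization (`exists_rhoOdd_eq_smul`).
-/

open scoped TensorProduct

noncomputable section

namespace RefinedScissors

universe u v w

set_option linter.unusedSectionVars false

/-! ### Symbols over a field -/

section FieldSymbols

variable (K : Type u) [Field K]

/-- The map `K → ℛ_K` extending `a ↦ ⟨a⟩` by `0 ↦ 0`. -/
def fang : MulChar K (GR K) := MulChar.ofUnitHom (angHom K).toHomUnits

variable {K}

theorem fang_coe (a : Kˣ) : fang K a = ang a := by
  rw [fang, MulChar.ofUnitHom_coe]; rfl

theorem fang_mul_self {a : K} (ha : a ≠ 0) : fang K a * fang K a = 1 := by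
  lift a to Kˣ using ha.isUnit
  rw [fang_coe]; exact ang_sq a

theorem fang_inv (a : K) : fang K a⁻¹ = fang K a := by
  by_cases ha : a = 0
  · rw [ha, inv_zero]
  · lift a to Kˣ using Ne.isUnit ha
    rw [← Units.val_inv_eq_inv_val, fang_coe, fang_coe]; exact ang_inv a

theorem fang_div (a b : K) : fang K (a / b) = fang K a * fang K b := by
  rw [div_eq_mul_inv, map_mul, fang_inv]

/-- The symbol `[x]` of `ℛ𝒫(K)` for an element `x` of a field `K`, with `[0] = [1] = 0`. -/
def fsym (x : K) : RP K := open Classical in if h : x = 0 then 0 else sym (Units.mk0 x h)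

theorem fsym_coe (a : Kˣ) : fsym (a : K) = sym a := by
  rw [fsym, dif_neg a.ne_zero, Units.mk0_val]

theorem sym_eq_zero (x : Kˣ) (h : ¬ IsUnit (1 - (x : K))) : sym x = 0 := by
  rw [sym, freeSym, dif_neg h, map_zero]

@[simp] theorem fsym_zero : fsym (0 : K) = 0 := dif_pos rfl

@[simp] theorem fsym_one : fsym (1 : K) = 0 := by
  have := fsym_coe (1 : Kˣ)
  rw [Units.val_one] at this
  rw [this]; exact sym_eq_zero _ (by simp)

/-- An element of `K` different from `0` and `1`, as an element of `𝒲_K`. -/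
def toW (a : K) (h0 : a ≠ 0) (h1 : a ≠ 1) : W K :=
  ⟨Units.mk0 a h0, (sub_ne_zero.2 h1.symm).isUnit⟩

theorem coe_compl_inv_div (a b : W K) :
    ((W.compl (W.inv a) / W.compl (W.inv b) : Kˣ) : K) =
      (b.1 : K) / a.1 * ((1 - (a.1 : K)) / (1 - b.1)) := by
  rw [W.compl_inv, W.compl_inv, neg_div_neg_eq]
  simp only [Units.val_div_eq_div_val, Units.val_mul, Units.val_inv_eq_inv_val, W.coe_compl]
  have := a.1.ne_zero
  have := b.1.ne_zero
  have hb : (1 : K) - b.1 ≠ 0 := (W.compl b).ne_zero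
  field_simp

theorem ang_neg_compl_inv (a : W K) :
    ang (-W.compl (W.inv a)) = fang K a.1 * fang K (1 - (a.1 : K)) := by
  rw [W.compl_inv, neg_neg, ← W.coe_compl, fang_coe, fang_coe]
  simp only [ang, map_mul, ang_inv]

/-- The defining five term relation of `ℛ𝒫(K)`, in terms of elements of the field `K`. -/
theorem fsym_five {a b : K} (ha0 : a ≠ 0) (ha1 : a ≠ 1) (hb0 : b ≠ 0) (hb1 : b ≠ 1) (hab : a ≠ b) :
    fsym a - fsym b + fang K a • fsym (b / a)
      - (fang K a * fang K (1 - a)) • fsym (b / a * ((1 - a) / (1 - b)))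
      + fang K (1 - a) • fsym ((1 - a) / (1 - b)) = 0 := by
  have hmem : fiveTerm (toW a ha0 ha1) (toW b hb0 hb1) ∈ relations K := by
    refine Submodule.subset_span ⟨_, _, ?_, rfl⟩
    refine (sub_ne_zero.2 fun h => hab ?_).isUnit
    simp only [toW, Units.val_div_eq_div_val, Units.val_mk0] at h
    exact (div_eq_one_iff_eq hb0).1 h.symm
  have h := (Submodule.Quotient.mk_eq_zero _).2 hmem
  rw [← Submodule.mkQ_apply, fiveTerm] at h
  simp only [map_add, map_sub, map_smul] at h
  change sym _ - sym _ + _ • sym _ - _ • sym _ + _ • sym _ = 0 at h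
  rw [← fsym_coe, ← fsym_coe, ← fsym_coe, ← fsym_coe, ← fsym_coe, coe_compl_inv_div,
    ang_neg_compl_inv, ← fang_coe, ← fang_coe, Units.val_div_eq_div_val, Units.val_div_eq_div_val,
    W.coe_compl, W.coe_compl] at h
  exact h

/-- The `ℛ_K`-linear map out of `ℛ𝒫(K)` given by a function that satisfies the five term
relations. -/
def RP.lift {M : Type*} [AddCommGroup M] [Module (GR K) M] (g : K → M)
    (h : ∀ a b : K, a ≠ 0 → a ≠ 1 → b ≠ 0 → b ≠ 1 → a ≠ b →
      g a - g b + fang K a • g (b / a)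
        - (fang K a * fang K (1 - a)) • g (b / a * ((1 - a) / (1 - b)))
        + fang K (1 - a) • g ((1 - a) / (1 - b)) = 0) : RP K →ₗ[GR K] M :=
  (relations K).liftQ (Finsupp.linearCombination (GR K) fun a : W K => g a.1) (by
    have key : ∀ x y : Kˣ, (y : K) = 1 - x →
        Finsupp.linearCombination (GR K) (fun a : W K => g a.1) (freeSym x) = g x := by
      intro x y hxy
      rw [freeSym_of_mem x (hxy ▸ y.isUnit), Finsupp.linearCombination_single, one_smul]
    refine Submodule.span_le.2 ?_
    rintro _ ⟨a, b, ⟨c, hc⟩, rfl⟩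
    rw [SetLike.mem_coe, LinearMap.mem_ker, fiveTerm]
    simp only [map_add, map_sub, map_smul]
    rw [key a.1 (W.compl a) rfl, key b.1 (W.compl b) rfl, key _ _ (one_sub_div₁ a b c hc),
      key _ _ (one_sub_div₂ a b c hc), key _ _ (one_sub_div₃ a b c hc), coe_compl_inv_div,
      ang_neg_compl_inv, ← fang_coe, ← fang_coe, Units.val_div_eq_div_val,
      Units.val_div_eq_div_val, W.coe_compl, W.coe_compl]
    refine h _ _ a.1.ne_zero ?_ b.1.ne_zero ?_ ?_
    · exact fun e => (W.compl a).ne_zero (by rw [W.coe_compl, e, sub_self])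
    · exact fun e => (W.compl b).ne_zero (by rw [W.coe_compl, e, sub_self])
    · intro e
      refine c.ne_zero ?_
      rw [hc, Units.val_div_eq_div_val, e, div_self b.1.ne_zero, sub_self])

theorem RP.lift_fsym {M : Type*} [AddCommGroup M] [Module (GR K) M] (g : K → M) (h) {x : K}
    (h0 : x ≠ 0) (h1 : x ≠ 1) : RP.lift g h (fsym x) = g x := by
  have hx : IsUnit (1 - ((Units.mk0 x h0 : Kˣ) : K)) := (sub_ne_zero.2 h1.symm).isUnit
  rw [fsym, dif_neg h0, sym, freeSym_of_mem _ hx]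
  change Finsupp.linearCombination (GR K) (fun a : W K => g a.1) _ = _
  rw [Finsupp.linearCombination_single, one_smul]; rfl

/-- Additive induction on `ℛ_B`. -/
theorem GR.induction {B : Type*} [CommRing B] {P : GR B → Prop} (r : GR B)
    (h0 : P 0) (h1 : ∀ u : Bˣ, P (ang u)) (ha : ∀ x y, P x → P y → P (x + y))
    (hn : ∀ x, P x → P (-x)) : P r := by
  let N : AddSubgroup (GR B) :=
    { carrier := {x | P x}, zero_mem' := h0, add_mem' := ha _ _, neg_mem' := hn _ }
  have h : QuotientAddGroup.mk' N = 0 := by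
    refine GR.addHom_ext fun x => ?_
    induction x using QuotientGroup.induction_on with
    | H u => exact (QuotientAddGroup.eq_zero_iff _).2 (h1 u)
  exact (QuotientAddGroup.eq_zero_iff _).1 (DFunLike.congr_fun h r)

/-- Every element of `ℛ𝒫(B)` is a sum of elements `r [a]`. -/
theorem RP.induction {B : Type*} [CommRing B] {P : RP B → Prop} (x : RP B)
    (h0 : P 0) (h1 : ∀ (r : GR B) (a : W B), P (r • sym a.1)) (ha : ∀ x y, P x → P y → P (x + y)) :
    P x := by
  obtain ⟨y, rfl⟩ := Submodule.mkQ_surjective _ x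
  induction y using Finsupp.induction_linear with
  | zero => rwa [map_zero]
  | add f g hf hg => rw [map_add]; exact ha _ _ hf hg
  | single a r =>
    have : Finsupp.single a r = r • freeSym a.1 := by
      rw [freeSym_of_mem _ a.2, Finsupp.smul_single, smul_eq_mul, mul_one]
    rw [this, map_smul]; exact h1 r a

theorem W.ne_one {K : Type*} [Field K] (a : W K) : (a.1 : K) ≠ 1 := fun e =>
  (W.compl a).ne_zero (by rw [W.coe_compl, e, sub_self])

end FieldSymbols

/-! ### The elements `ψ₁(a)` -/

section Psi

variable {K : Type u} [Field K]

/-- The element `ψ₁(x)` for an element `x` of a field, with `ψ₁(0) = ψ₁(1) = 0`. -/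
def psi (x : K) : RP K := fsym x + fang K (-1) • fsym x⁻¹

theorem fang_neg_one : fang K (-1) = ang (-1 : Kˣ) := by
  rw [← fang_coe]; simp

theorem psiOne_eq (a : W K) : psiOne a = psi (a.1 : K) := by
  rw [psiOne, psi, fsym_coe, fang_neg_one, ← Units.val_inv_eq_inv_val, fsym_coe]; rfl

theorem psi_one : psi (1 : K) = 0 := by simp [psi]

theorem neg_one_smul_psi (x : K) : fang K (-1) • psi x⁻¹ = psi x := by
  have h : fang K (-1) * fang K (-1) = 1 := fang_mul_self (by simp)
  rw [psi, psi, smul_add, smul_smul, h, inv_inv, one_smul, add_comm]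

theorem lambdaOne_psi {x : K} (hx : x ≠ 0) :
    lambdaOne K (psi x) = -((fang K (-1) + 1) * (fang K x - 1)) := by
  by_cases h1 : x = 1
  · simp [h1, psi_one]
  · have := lambdaOne_psiOne (toW x hx h1)
    rw [psiOne_eq, ← fang_neg_one, dang, ← fang_coe] at this
    exact this

/-- The function `ψ₁` is a cocycle. This is the sum of the five term relation for `a, b` and
`⟨-1⟩` times the one for `a⁻¹, b⁻¹`. -/
theorem psi_div {a b : K} (ha0 : a ≠ 0) (ha1 : a ≠ 1) (hb0 : b ≠ 0) (hb1 : b ≠ 1) (hab : a ≠ b) :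
    psi b = psi a + fang K a • psi (b / a) := by
  have ha1' := sub_ne_zero.2 ha1.symm
  have hb1' := sub_ne_zero.2 hb1.symm
  have h1 := fsym_five ha0 ha1 hb0 hb1 hab
  have h2 := fsym_five (inv_ne_zero ha0) (inv_ne_one.2 ha1) (inv_ne_zero hb0) (inv_ne_one.2 hb1)
    (fun h => hab (inv_injective h))
  have e1 : (1 : K) - a⁻¹ = -1 * ((1 - a) / a) := by field_simp; ring
  have e2 : (1 : K) - b⁻¹ = -1 * ((1 - b) / b) := by field_simp; ring
  have e3 : b⁻¹ / a⁻¹ = (b / a)⁻¹ := by field_simp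
  have e4 : (1 - a⁻¹) / (1 - b⁻¹) = b / a * ((1 - a) / (1 - b)) := by
    rw [e1, e2, mul_div_mul_left _ _ (by simp)]; field_simp
  have e5 : (b / a)⁻¹ * (b / a * ((1 - a) / (1 - b))) = (1 - a) / (1 - b) := by field_simp
  rw [e3, e4, e5, e1, map_mul, fang_div, fang_inv] at h2
  have hm : fang K (-1) * fang K (-1) = 1 := fang_mul_self (by simp)
  have ha := fang_mul_self ha0
  rw [psi, psi, psi]
  generalize fang K (-1) = m at *
  generalize fang K a = x at *
  generalize fang K (1 - a) = y at *
  linear_combination (norm := (match_scalars <;> grind)) (-1 : ℤ) • h1 - m • h2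

/-- The hypothesis on the number of elements provides one different from `0`, `1` and `c`. -/
theorem exists_ne_zero_one (hK : ∀ s : Finset K, s.card ≤ 7 → ∃ x, x ∉ s) (c : K) :
    ∃ x : K, x ≠ 0 ∧ x ≠ 1 ∧ x ≠ c := by
  classical
  obtain ⟨x, hx⟩ := hK {0, 1, c} (Finset.card_le_three.trans (by norm_num))
  simp only [Finset.mem_insert, Finset.mem_singleton, not_or] at hx
  exact ⟨x, hx⟩

variable (hK : ∀ s : Finset K, s.card ≤ 7 → ∃ x, x ∉ s)
include hK

/-- The cocycle relation for `b, b⁻¹`, which `psi_div` does not cover: use it for `a, ab` and for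
`ab, a` with an auxiliary element `a`. -/
theorem psi_inv {b : K} (hb0 : b ≠ 0) : psi b + fang K b • psi b⁻¹ = 0 := by
  by_cases hb1 : b = 1
  · simp [hb1, psi_one]
  obtain ⟨a, ha0, ha1, hab⟩ := exists_ne_zero_one hK b⁻¹
  have hab1 : a * b ≠ 1 := fun h => hab (eq_inv_of_mul_eq_one_left h)
  have hab0 := mul_ne_zero ha0 hb0
  have hne : a ≠ a * b := fun h => hb1 (mul_left_cancel₀ ha0 (by rw [← h, mul_one]))
  have h1 := psi_div ha0 ha1 hab0 hab1 hne
  have h2 := psi_div hab0 hab1 ha0 ha1 hne.symm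
  rw [mul_div_cancel_left₀ _ ha0] at h1
  rw [div_mul_cancel_left₀ ha0, map_mul] at h2
  have ha := fang_mul_self ha0
  generalize fang K a = x at *
  generalize fang K b = y at *
  linear_combination (norm := (match_scalars <;> grind)) (-x) • h1 - x • h2

/-- The cocycle relation for `ψ₁` without restrictions on `a, b`. -/
theorem psi_mul {a b : K} (ha : a ≠ 0) (hb : b ≠ 0) : psi (a * b) = psi a + fang K a • psi b := by
  by_cases ha1 : a = 1
  · simp [ha1, psi_one]
  by_cases hb1 : b = 1
  · simp [hb1, psi_one]
  by_cases hab : a * b = 1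
  · rw [hab, psi_one, eq_inv_of_mul_eq_one_right hab, psi_inv hK ha]
  · have := psi_div ha ha1 (mul_ne_zero ha hb) hab
      (fun h => hb1 (mul_left_cancel₀ ha (by rw [← h, mul_one])))
    rwa [mul_div_cancel_left₀ _ ha] at this

theorem two_smul_psi_neg_one : (2 : GR K) • psi (-1 : K) = 0 := by
  have h := psi_mul hK (a := (-1 : K)) (b := -1) (by simp) (by simp)
  have h2 := neg_one_smul_psi (-1 : K)
  rw [inv_neg, inv_one] at h2
  rw [neg_mul_neg, one_mul, psi_one, h2] at h
  rw [two_smul]; exact h.symm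

theorem two_smul_neg_one_smul_psi {a : K} (ha : a ≠ 0) :
    (2 : GR K) • fang K (-1) • psi a = (2 : GR K) • psi a := by
  have h1 := psi_mul hK ha (b := -1) (by simp)
  have h2 := psi_mul hK (a := (-1 : K)) (by simp) ha
  have h3 := two_smul_psi_neg_one hK
  rw [mul_comm, h2] at h1
  linear_combination (norm := module) (2 : GR K) • h1 + (fang K a - 1) • h3

theorem two_smul_psi_sq {a : K} (ha : a ≠ 0) : (2 : GR K) • psi (a * a) = 0 := by
  have h1 := psi_mul hK ha ha
  have h2 := neg_one_smul_psi a
  have h3 := psi_inv hK ha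
  have h4 := two_smul_neg_one_smul_psi hK ha
  have hm : fang K (-1) * fang K (-1) = 1 := fang_mul_self (by simp)
  have hx := fang_mul_self ha
  generalize fang K (-1) = m at *
  generalize fang K a = x at *
  linear_combination (norm := (match_scalars <;> grind))
    (2 : GR K) • h1 - (2 * x * m) • h2 + (2 : GR K) • h3 - x • h4

omit hK in
/-- The additive map on `ℛ_B` with given values on the square classes. -/
def GR.liftAdd {B : Type*} [CommRing B] {M : Type*} [AddCommGroup M] (f : SqClass B → M) :
    GR B →+ M :=
  ((Finsupp.liftAddHom fun g => zmultiplesHom M (f g)).comp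
    MonoidAlgebra.coeffAddEquiv.toAddMonoidHom).comp (GR.equiv B).toAddEquiv.toAddMonoidHom

omit hK in
theorem GR.liftAdd_of {B : Type*} [CommRing B] {M : Type*} [AddCommGroup M] (f : SqClass B → M)
    (g : SqClass B) : GR.liftAdd f (GR.of B g) = f g := by
  change (Finsupp.liftAddHom fun g => zmultiplesHom M (f g)) (Finsupp.single g (1 : ℤ)) = _
  rw [Finsupp.liftAddHom_apply_single]
  simp

/-- The additive map `ℛ_K → ℛ𝒫(K)`, `⟨a⟩ ↦ 2 ψ₁(a)`. -/
def psiHom : GR K →+ RP K :=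
  GR.liftAdd (Quotient.lift (fun a : Kˣ => (2 : GR K) • psi (a : K)) (by
    intro x y hxy
    obtain ⟨z, hz⟩ := QuotientGroup.leftRel_apply.1 hxy
    have : y = x * (z * z) := by
      rw [← pow_two, show z ^ 2 = x⁻¹ * y from hz, mul_inv_cancel_left]
    simp only [this, Units.val_mul]
    rw [psi_mul hK x.ne_zero (mul_ne_zero z.ne_zero z.ne_zero), smul_add, smul_comm,
      two_smul_psi_sq hK z.ne_zero, smul_zero, add_zero]))

theorem psiHom_ang (a : Kˣ) : psiHom hK (ang a) = (2 : GR K) • psi (a : K) :=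
  GR.liftAdd_of _ _

/-- The map `⟨a⟩ ↦ 2 ψ₁(a)` is a derivation, where `ℛ_K` acts on one side through the augmentation.
-/
theorem psiHom_mul (r s : GR K) : psiHom hK (r * s) = r • psiHom hK s + aug K s • psiHom hK r := by
  induction r using GR.induction with
  | h0 => simp
  | ha x y hx hy => rw [add_mul, map_add, hx, hy, map_add, smul_add, add_smul]; abel
  | hn x hx => rw [neg_mul, map_neg, hx, map_neg, neg_smul, smul_neg]; abel
  | h1 u =>
    induction s using GR.induction with
    | h0 => simp
    | ha x y hx hy => rw [mul_add, map_add, hx, hy, map_add, map_add, smul_add, add_smul]; abel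
    | hn x hx => rw [mul_neg, map_neg, hx, map_neg, map_neg, neg_smul, smul_neg]; abel
    | h1 w =>
      have h : aug K (ang w) = 1 := aug_of _
      rw [h, one_smul, ← map_mul, psiHom_ang, psiHom_ang, psiHom_ang, Units.val_mul,
        psi_mul hK u.ne_zero w.ne_zero, smul_add, ← fang_coe u]
      module

/-- On `𝒦⁽¹⁾`, the map `λ₁` has a left inverse up to multiplication by `-4`. -/
theorem psiHom_lambdaOne {z : RP K} (hz : z ∈ KOne K) :
    psiHom hK (lambdaOne K z) = (-4 : GR K) • z := by
  induction hz using Submodule.span_induction with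
  | zero => simp
  | add x y _ _ hx hy => rw [map_add, map_add, hx, hy, smul_add]
  | mem x hx =>
    obtain ⟨a, rfl⟩ := hx
    have h0 : aug K (fang K a.1 - 1) = 0 := by rw [fang_coe]; exact dang_mem a.1
    have h2 := two_smul_neg_one_smul_psi hK a.1.ne_zero
    have h1 : psiHom hK 1 = 0 := by
      have := psiHom_ang hK 1
      rwa [ang, map_one, Units.val_one, psi_one, smul_zero] at this
    rw [psiOne_eq, lambdaOne_psi a.1.ne_zero, map_neg, psiHom_mul, h0, zero_smul, map_sub, h1,
      fang_coe a.1, psiHom_ang]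
    linear_combination (norm := module) -h2
  | smul r x hx h =>
    have h0 : aug K (lambdaOne K x) = 0 := by
      have h1 := KOne_le K hx
      have h2 : pI K ≤ augIdeal K := Ideal.mul_le.2 fun r _ s hs => Ideal.mul_mem_left _ r hs
      exact h2 h1
    rw [map_smul, smul_eq_mul, psiHom_mul, h0, h, zero_smul, add_zero, smul_comm]

/-- The intersection of `𝒦⁽¹⁾` and `ℛ𝒫₁(K)` is killed by `4`. -/
theorem four_smul_eq_zero {z : RP K} (hz : z ∈ KOne K) (h : lambdaOne K z = 0) :
    (4 : ℤ) • z = 0 := by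
  have := psiHom_lambdaOne hK hz
  rw [h, map_zero] at this
  linear_combination (norm := module) this

omit hK in
/-- The reason is that `λ₁` maps `𝒦⁽¹⁾` onto `(⟨-1⟩ + 1) ℐ_K`. -/
theorem toTilde_surjective : Function.Surjective (toTilde K) := by
  rintro ⟨x, hx⟩
  obtain ⟨y, rfl⟩ := Submodule.mkQ_surjective _ x
  have h1 : lambdaOne K y ∈ pI K := (Submodule.Quotient.mk_eq_zero _).1 hx
  have h2 : pI K ≤ Submodule.map (lambdaOne K) (KOne K) := by
    rw [pI, Ideal.span_singleton_mul_le_iff]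
    intro r hr
    -- the augmentation of `r` is subtracted to make the claim additive in `r`
    have hr' : ∀ r : GR K, (ang (-1 : Kˣ) + 1) * (r - aug K r) ∈
        Submodule.map (lambdaOne K) (KOne K) := by
      intro r
      induction r using GR.induction with
      | h0 => simp
      | ha x y hx hy =>
        convert add_mem hx hy using 1
        push_cast [map_add]; ring
      | hn x hx =>
        convert neg_mem hx using 1
        push_cast [map_neg]; ring
      | h1 u =>
        have h : aug K (ang u) = 1 := aug_of _
        rw [h, Int.cast_one]
        by_cases hu : (u : K) = 1
        · rw [Units.val_eq_one.1 hu, show ang (1 : Kˣ) = 1 from map_one _, sub_self,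
            mul_zero]
          exact zero_mem _
        · refine ⟨-psi (u : K), neg_mem ?_, ?_⟩
          · exact Submodule.subset_span ⟨toW u u.ne_zero hu, psiOne_eq _⟩
          · rw [map_neg, lambdaOne_psi u.ne_zero, neg_neg, fang_coe, fang_neg_one]
    have h := hr' r
    rwa [show aug K r = 0 from hr, Int.cast_zero, sub_zero] at h
  obtain ⟨z, hz, hzy⟩ := h2 h1
  refine ⟨⟨y - z, ?_⟩, Subtype.ext ?_⟩
  · change lambdaOne K (y - z) = 0
    rw [map_sub, hzy, sub_self]
  · change (KOne K).mkQ (y - z) = (KOne K).mkQ y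
    rw [map_sub, sub_eq_self]
    exact (Submodule.Quotient.mk_eq_zero _).2 hz

theorem toTilde_eq_zero {x : RPOne K} (hx : toTilde K x = 0) : (4 : ℤ) • x = 0 := by
  refine Subtype.ext (four_smul_eq_zero hK ?_ x.2)
  exact (Submodule.Quotient.mk_eq_zero _).1 (congrArg Subtype.val hx)

end Psi

/-! ### Identities in the quotient of `ℛ𝒫(K)` by the elements `ψ₁(a)` -/

section TildeIdentities

variable {K : Type u} [Field K]

/-- The class of `[x]` modulo the elements `ψ₁(a)`, with `[0] = [1] = 0`. -/
def br (x : K) : RPt K := toRPt (fsym x)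

@[simp] theorem br_one : br (1 : K) = 0 := by simp [br, toRPt]

theorem toRPt_psi (x : K) : toRPt (psi x) = 0 := by
  by_cases h0 : x = 0
  · simp [h0, psi, toRPt]
  by_cases h1 : x = 1
  · simp [h1, psi_one, toRPt]
  · exact (Submodule.Quotient.mk_eq_zero _).2
      (Submodule.subset_span ⟨toW x h0 h1, psiOne_eq _⟩)

theorem br_inv (x : K) : br x⁻¹ = -(fang K (-1) • br x) := by
  have h := toRPt_psi x⁻¹
  rw [psi, toRPt, map_add, map_smul, inv_inv] at h
  exact eq_neg_of_add_eq_zero_left h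

theorem br_five {a b : K} (ha0 : a ≠ 0) (ha1 : a ≠ 1) (hb0 : b ≠ 0) (hb1 : b ≠ 1) (hab : a ≠ b) :
    br a - br b + fang K a • br (b / a)
      - (fang K a * fang K (1 - a)) • br (b / a * ((1 - a) / (1 - b)))
      + fang K (1 - a) • br ((1 - a) / (1 - b)) = 0 := by
  have h := congrArg toRPt (fsym_five ha0 ha1 hb0 hb1 hab)
  simp only [toRPt, map_add, map_sub, map_smul, map_zero] at h
  exact h

variable (K) in
/-- The class of the constant `C_K`, formed with a chosen element different from `0` and `1`. The
term that involves `ψ₁` is omitted, because it vanishes in the quotient. -/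
def tC : RPt K :=
  br (Classical.epsilon fun c : K => c ≠ 0 ∧ c ≠ 1) +
    fang K (-1) • br (1 - Classical.epsilon fun c : K => c ≠ 0 ∧ c ≠ 1)

/-- The element `[a] + ⟨-1⟩[1 - a]` is constant: combine the five term relations for `a, b` and for
`1 - a, 1 - b`. -/
theorem br_add {a : K} (ha0 : a ≠ 0) (ha1 : a ≠ 1) : br a + fang K (-1) • br (1 - a) = tC K := by
  rw [tC]
  obtain ⟨hb0, hb1⟩ : (Classical.epsilon fun c : K => c ≠ 0 ∧ c ≠ 1) ≠ 0 ∧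
      (Classical.epsilon fun c : K => c ≠ 0 ∧ c ≠ 1) ≠ 1 :=
    Classical.epsilon_spec (p := fun c : K => c ≠ 0 ∧ c ≠ 1) ⟨a, ha0, ha1⟩
  generalize (Classical.epsilon fun c : K => c ≠ 0 ∧ c ≠ 1) = b at *
  by_cases hab : a = b
  · rw [hab]
  have ha1' := sub_ne_zero.2 ha1.symm
  have hb1' := sub_ne_zero.2 hb1.symm
  have h1 := br_five ha0 ha1 hb0 hb1 hab
  have h2 := br_five ha1' (by simpa using ha0) hb1' (by simpa using hb0)
    (fun h => hab (sub_right_injective h))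
  rw [sub_sub_cancel, sub_sub_cancel, ← inv_div (1 - a), ← inv_div b a, ← mul_inv, br_inv, br_inv,
    br_inv, mul_comm ((1 - a) / (1 - b))] at h2
  have hm : fang K (-1) * fang K (-1) = 1 := fang_mul_self (by simp)
  generalize fang K (-1) = m at *
  generalize fang K a = x at *
  generalize fang K (1 - a) = y at *
  linear_combination (norm := (match_scalars <;> grind)) h1 + m • h2

theorem toRPt_constC (c : W K) : toRPt (constC c) = tC K := by
  have h := br_add c.1.ne_zero c.ne_one
  rw [constC, toRPt, map_add, map_add, map_smul, map_smul, psiOne_eq,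
    show (KOne K).mkQ (psi (c.1 : K)) = 0 from toRPt_psi _, smul_zero, add_zero, ← h, fang_neg_one,
    ← fsym_coe, ← fsym_coe]
  rfl

/-- In a field with two elements the choice in `tC` is void, and all symbols vanish. -/
theorem tC_eq_zero (h : ¬ ∃ c : K, c ≠ 0 ∧ c ≠ 1) : tC K = 0 := by
  have h2 : ∀ c : K, br c = 0 := fun c => by
    by_cases h0 : c = 0
    · simp [h0, br, toRPt]
    · by_cases h1 : c = 1
      · simp [h1]
      · exact absurd ⟨c, h0, h1⟩ h
  simp [tC, h2]

theorem neg_one_smul_tC : fang K (-1) • tC K = tC K := by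
  by_cases h : ∃ c : K, c ≠ 0 ∧ c ≠ 1
  · obtain ⟨c, h0, h1⟩ := h
    have e1 := br_add h0 h1
    have e2 := br_add (sub_ne_zero.2 h1.symm) (a := 1 - c) (by simpa using h0)
    rw [sub_sub_cancel] at e2
    have hm : fang K (-1) * fang K (-1) = 1 := fang_mul_self (by simp)
    generalize fang K (-1) = m at *
    linear_combination (norm := (match_scalars <;> grind)) e2 - m • e1
  · rw [tC_eq_zero h, smul_zero]

theorem br_one_sub {a : K} (ha0 : a ≠ 0) (ha1 : a ≠ 1) :
    br (1 - a) = tC K - fang K (-1) • br a := by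
  have e2 := br_add (sub_ne_zero.2 ha1.symm) (a := 1 - a) (by simpa using ha0)
  rw [sub_sub_cancel] at e2
  exact eq_sub_of_add_eq e2

theorem br_inv_one_sub {a : K} (ha0 : a ≠ 0) (ha1 : a ≠ 1) : br (1 - a)⁻¹ = br a - tC K := by
  rw [br_inv, br_one_sub ha0 ha1, smul_sub, neg_one_smul_tC, smul_smul,
    fang_mul_self (by simp), one_smul, neg_sub]

theorem br_one_sub_inv {a : K} (ha0 : a ≠ 0) (ha1 : a ≠ 1) : br (1 - a⁻¹) = br a + tC K := by
  rw [br_one_sub (inv_ne_zero ha0) (inv_ne_one.2 ha1), br_inv, smul_neg, smul_smul,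
    fang_mul_self (by simp), one_smul, sub_neg_eq_add, add_comm]

/-- The transformation `a ↦ 1 - a⁻¹` has order three and adds `C_K` to `[a]`. -/
theorem three_smul_tC : (3 : GR K) • tC K = 0 := by
  by_cases h : ∃ c : K, c ≠ 0 ∧ c ≠ 1
  · obtain ⟨c, h0, h1⟩ := h
    have h1' := sub_ne_zero.2 h1.symm
    have h1'' := sub_ne_zero.2 h1
    have hc : 1 - c⁻¹ = (c - 1) / c := by field_simp
    have e1 := br_inv_one_sub h0 h1
    have e2 := br_one_sub_inv h0 h1
    have e3 := br_one_sub_inv (a := 1 - c⁻¹) (by rw [hc]; positivity) (by simpa using h0)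
    have e4 : 1 - (1 - c⁻¹)⁻¹ = (1 - c)⁻¹ := by
      rw [hc, inv_div]; field_simp; ring
    rw [e4, e1, e2] at e3
    linear_combination (norm := module) -e3
  · rw [tC_eq_zero h, smul_zero]

variable (hK : ∀ s : Finset K, s.card ≤ 7 → ∃ x, x ∉ s)
include hK

/-- The limit of the five term relation as `b → 0`: the terms that contain an auxiliary element `b`
in the relations for `a, b` and for `1 - a, (1 - a) / (1 - b)` cancel. -/
theorem br_five_zero {a : K} (ha0 : a ≠ 0) (ha1 : a ≠ 1) :
    br a - tC K + fang K a • tC K - (fang K a * fang K (1 - a)) • tC K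
      + fang K (1 - a) • br (1 - a) = 0 := by
  obtain ⟨b, hb0, hb1, hba⟩ := exists_ne_zero_one hK a
  have hab : a ≠ b := hba.symm
  have ha1' := sub_ne_zero.2 ha1.symm
  have hb1' := sub_ne_zero.2 hb1.symm
  have hab' := sub_ne_zero.2 hab
  have hw : (1 - a) / (1 - b) ≠ 1 := by
    rw [Ne, div_eq_one_iff_eq hb1']; exact fun h => hab (sub_right_injective h)
  have h1 := br_five ha0 ha1 hb0 hb1 hab
  have h2 := br_five ha1' (by simpa using ha0) (div_ne_zero ha1' hb1') hw (by
    rw [Ne, eq_comm, div_eq_iff hb1']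
    intro h
    have : (1 - a) * b = 0 := by linear_combination h
    exact mul_ne_zero ha1' hb0 this)
  have e1 : (1 - a) / (1 - b) / (1 - a) = (1 - b)⁻¹ := by field_simp
  have e2 : 1 - (1 - a) / (1 - b) = (a - b) / (1 - b) := by field_simp; ring
  have e3 : 1 - b / a * ((1 - a) / (1 - b)) = (a - b) / (a * (1 - b)) := by field_simp; ring
  have e4 : (a / ((a - b) / (1 - b))) = (1 - b / a * ((1 - a) / (1 - b)))⁻¹ := by
    rw [e3]; field_simp
  have e5 : (1 - b)⁻¹ * (a / ((a - b) / (1 - b))) = (1 - b / a)⁻¹ := by field_simp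
  have hr : b / a ≠ 1 := by rw [Ne, div_eq_one_iff_eq ha0]; exact hba
  have hz : b / a * ((1 - a) / (1 - b)) ≠ 1 := by
    intro h
    rw [h, sub_self, eq_comm, div_eq_zero_iff] at e3
    exact e3.elim hab' (mul_ne_zero ha0 hb1')
  rw [sub_sub_cancel, e1, e2, e5, e4, br_inv_one_sub hb0 hb1,
    br_inv_one_sub (div_ne_zero hb0 ha0) hr, br_inv_one_sub
      (mul_ne_zero (div_ne_zero hb0 ha0) (div_ne_zero ha1' hb1')) hz] at h2
  have hx := fang_mul_self ha0
  have hy := fang_mul_self ha1'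
  generalize fang K a = x at *
  generalize fang K (1 - a) = y at *
  linear_combination (norm := (match_scalars <;> grind)) h1 + y • h2

/-- An identity that determines `[a]`, up to `2`-torsion, in a module on which `⟨-1⟩` and `⟨1 - a⟩`
act with opposite signs. -/
theorem br_smul_one_sub {a : K} (ha0 : a ≠ 0) (ha1 : a ≠ 1) :
    (1 - fang K (-1) * fang K (1 - a)) • br a =
      ((1 - fang K a) * (1 - fang K (1 - a))) • tC K := by
  have h1 := br_five_zero hK ha0 ha1
  have h2 := neg_one_smul_tC (K := K)
  rw [br_one_sub ha0 ha1] at h1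
  linear_combination (norm := module) h1

/-- An identity that determines `[a]`, up to `2`-torsion, in a module on which `⟨-1⟩` and `⟨a⟩` act
with opposite signs. -/
theorem br_smul {a : K} (ha0 : a ≠ 0) (ha1 : a ≠ 1) :
    (1 - fang K (-1) * fang K a) • br a = (fang K (1 - a) * (1 - fang K a)) • tC K := by
  have h1 := br_smul_one_sub hK (sub_ne_zero.2 ha1.symm) (a := 1 - a) (by simpa using ha0)
  have h2 := neg_one_smul_tC (K := K)
  rw [sub_sub_cancel, br_one_sub ha0 ha1] at h1
  have hm : fang K (-1) * fang K (-1) = 1 := fang_mul_self (by simp)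
  generalize fang K (-1) = m at *
  generalize fang K a = x at *
  generalize fang K (1 - a) = y at *
  linear_combination (norm := (match_scalars <;> grind)) -m • h1 + (x + y - x * y) • h2

end TildeIdentities

/-! ### The specialization map -/

section FiveTerm

variable {K : Type*} [Field K] {M : Type*} [AddCommGroup M] [Module (GR K) M]

/-- The five term relation for `a, b` and a function `g` on `K`. -/
def FiveTerm (g : K → M) (a b : K) : Prop :=
  g a - g b + fang K a • g (b / a)
    - (fang K a * fang K (1 - a)) • g (b / a * ((1 - a) / (1 - b)))
    + fang K (1 - a) • g ((1 - a) / (1 - b)) = 0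

variable {g : K → M} {C : M} {a b : K}

/-- The five term relations for `a, b` and for `a⁻¹, b⁻¹` are equivalent if `[x⁻¹] = -⟨-1⟩[x]`. -/
theorem FiveTerm.of_inv (hi : ∀ x : K, x ≠ 0 → g x⁻¹ = -(fang K (-1) • g x))
    (ha0 : a ≠ 0) (ha1 : a ≠ 1) (hb0 : b ≠ 0) (hb1 : b ≠ 1) (h : FiveTerm g a⁻¹ b⁻¹) :
    FiveTerm g a b := by
  have ha1' := sub_ne_zero.2 ha1.symm
  have hb1' := sub_ne_zero.2 hb1.symm
  have e1 : (1 : K) - a⁻¹ = -1 * ((1 - a) / a) := by field_simp; ring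
  have e2 : (1 : K) - b⁻¹ = -1 * ((1 - b) / b) := by field_simp; ring
  have e3 : b⁻¹ / a⁻¹ = (b / a)⁻¹ := by field_simp
  have e4 : (1 - a⁻¹) / (1 - b⁻¹) = b / a * ((1 - a) / (1 - b)) := by
    rw [e1, e2, mul_div_mul_left _ _ (by simp)]; field_simp
  have e5 : (b / a)⁻¹ * (b / a * ((1 - a) / (1 - b))) = (1 - a) / (1 - b) := by field_simp
  rw [FiveTerm, e3, e4, e5, e1, map_mul, fang_div, fang_inv, hi a ha0, hi b hb0,
    hi _ (div_ne_zero hb0 ha0)] at h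
  rw [FiveTerm]
  have hm : fang K (-1) * fang K (-1) = 1 := fang_mul_self (by simp)
  have ha := fang_mul_self ha0
  generalize fang K (-1) = m at *
  generalize fang K a = x at *
  generalize fang K (1 - a) = y at *
  clear e1 e2 e3 e4 e5 ha0 hb0 ha1 hb1 ha1' hb1'
  linear_combination (norm := (match_scalars <;> grind)) -m • h

/-- The five term relations for `a, b` and for `1 - a, 1 - b` are equivalent if `[x⁻¹] = -⟨-1⟩[x]`
and `[x] + ⟨-1⟩[1 - x]` is constant. -/
theorem FiveTerm.of_one_sub (hi : ∀ x : K, x ≠ 0 → g x⁻¹ = -(fang K (-1) • g x))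
    (hc : ∀ x : K, x ≠ 0 → x ≠ 1 → g x + fang K (-1) • g (1 - x) = C)
    (ha0 : a ≠ 0) (ha1 : a ≠ 1) (hb0 : b ≠ 0) (hb1 : b ≠ 1) (h : FiveTerm g (1 - a) (1 - b)) :
    FiveTerm g a b := by
  have ha1' := sub_ne_zero.2 ha1.symm
  have hb1' := sub_ne_zero.2 hb1.symm
  have h1 := hc a ha0 ha1
  have h2 := hc b hb0 hb1
  rw [FiveTerm, sub_sub_cancel, sub_sub_cancel, ← inv_div (1 - a), ← inv_div b a, ← mul_inv,
    hi _ (div_ne_zero hb0 ha0), hi _ (div_ne_zero ha1' hb1'),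
    hi _ (mul_ne_zero (div_ne_zero ha1' hb1') (div_ne_zero hb0 ha0)),
    mul_comm ((1 - a) / (1 - b))] at h
  rw [FiveTerm]
  have hm : fang K (-1) * fang K (-1) = 1 := fang_mul_self (by simp)
  generalize fang K (-1) = m at *
  generalize fang K a = x at *
  generalize fang K (1 - a) = y at *
  clear ha0 hb0 ha1 hb1 ha1' hb1'
  linear_combination (norm := (match_scalars <;> grind)) h1 - h2 - m • h

end FiveTerm

section Specialization

open IsLocalRing

variable {A : Type u} [CommRing A] [IsDomain A] [IsDiscreteValuationRing A]
  {F : Type v} [Field F] [Algebra A F] [IsFractionRing A F]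

variable (A F) in
/-- The map `m ↦ 1 ⊗ m` into the induced module. -/
def iota (M : Type*) [AddCommGroup M] [Module (GR (ResidueField A)) M] : M →+ IndRes A F M where
  toFun m := Ind.tmul (toFrac A F) (toRes A) 1 m
  map_zero' := TensorProduct.tmul_zero _ _
  map_add' _ _ := TensorProduct.tmul_add _ _ _

theorem toFrac_smul {M : Type*} [AddCommGroup M] [Module (GR (ResidueField A)) M] (r : GR A)
    (t : IndRes A F M) : toFrac A F r • t = r • t := by
  induction t using TensorProduct.induction_on with
  | zero => rw [smul_zero, smul_zero]
  | add x y hx hy => rw [smul_add, smul_add, hx, hy]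
  | tmul x y => rw [TensorProduct.smul_tmul', TensorProduct.smul_tmul']; rfl

theorem toFrac_smul_iota {M : Type*} [AddCommGroup M] [Module (GR (ResidueField A)) M] (r : GR A)
    (m : M) : toFrac A F r • iota A F M m = iota A F M (toRes A r • m) := by
  rw [toFrac_smul]
  change r • (Res.mk (toFrac A F) (GR F) 1 ⊗ₜ[GR A] Res.mk (toRes A) M m) = _
  rw [← TensorProduct.tmul_smul, ← Res.mk_smul]; rfl

theorem fang_smul_iota {M : Type*} [AddCommGroup M] [Module (GR (ResidueField A)) M] {y : A}
    (hy : IsUnit y) (m : M) : fang F (algebraMap A F y) • iota A F M m =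
      iota A F M (fang _ (residue A y) • m) := by
  obtain ⟨w, rfl⟩ := hy
  have h1 : algebraMap A F w = (unitF F w : Fˣ) := rfl
  have h2 : residue A w = (red w : (ResidueField A)ˣ) := rfl
  rw [h1, h2, fang_coe, fang_coe, ← mapGR_ang (algebraMap A F), ← mapGR_ang (residue A)]
  exact toFrac_smul_iota _ _

variable (A) in
/-- The elements of `F` of positive valuation (including `0`). -/
def Pos (x : F) : Prop := ∃ y ∈ maximalIdeal A, x = algebraMap A F y

theorem Pos.mul {x : F} (h : Pos A x) (y : A) : Pos A (x * algebraMap A F y) := by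
  obtain ⟨z, hz, rfl⟩ := h
  exact ⟨z * y, Ideal.mul_mem_right _ _ hz, (map_mul _ _ _).symm⟩

theorem not_pos_unit {y : A} (hy : IsUnit y) : ¬ Pos A (algebraMap A F y) := by
  rintro ⟨z, hz, h⟩
  rw [IsFractionRing.injective A F h] at hy
  exact hz hy

theorem algebraMap_inv {y : A} (hy : IsUnit y) : ∃ z, IsUnit z ∧ z * y = 1 ∧
    (algebraMap A F y)⁻¹ = algebraMap A F z ∧ (residue A y)⁻¹ = residue A z := by
  obtain ⟨w, rfl⟩ := hy
  refine ⟨_, w⁻¹.isUnit, w.inv_mul, inv_eq_of_mul_eq_one_left ?_, inv_eq_of_mul_eq_one_left ?_⟩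
  · rw [← map_mul, w.inv_mul, map_one]
  · rw [← map_mul, w.inv_mul, map_one]

theorem Pos.div {x : F} (h : Pos A x) {y : A} (hy : IsUnit y) : Pos A (x / algebraMap A F y) := by
  obtain ⟨z, -, -, hz, -⟩ := algebraMap_inv (F := F) hy
  rw [div_eq_mul_inv, hz]; exact h.mul z

theorem Pos.one_sub_ne_zero {x : F} (h : Pos A x) : 1 - x ≠ 0 := by
  obtain ⟨z, hz, rfl⟩ := h
  intro h
  have : (1 : A) = z := IsFractionRing.injective A F (by rw [map_one]; exact sub_eq_zero.1 h)
  exact hz (this ▸ isUnit_one)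

theorem Pos.not_inv {x : F} (h0 : x ≠ 0) (h : Pos A x) : ¬ Pos A x⁻¹ := by
  rintro ⟨z, hz, hx⟩
  obtain ⟨t, ht, h2⟩ := h.mul z
  rw [← hx, mul_inv_cancel₀ h0] at h2
  have : (1 : A) = t := IsFractionRing.injective A F (by rw [map_one]; exact h2)
  exact ht (this ▸ isUnit_one)

theorem isUnit_one_sub {y : A} (hy : y ∈ maximalIdeal A) : IsUnit (1 - y) := by
  by_contra h
  have : (1 - y) + y ∈ maximalIdeal A := add_mem h hy
  rw [sub_add_cancel] at this
  exact this isUnit_one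

/-- An element of `F` has positive valuation, negative valuation, or is a unit. -/
theorem pos_or_pos_inv_or_unit (x : F) :
    Pos A x ∨ Pos A x⁻¹ ∨ ∃ y : A, IsUnit y ∧ x = algebraMap A F y := by
  have key : ∀ y : A, Pos A (algebraMap A F y) ∨ IsUnit y := fun y => by
    by_cases hy : IsUnit y
    · exact Or.inr hy
    · exact Or.inl ⟨y, hy, rfl⟩
  rcases ValuationRing.isInteger_or_isInteger A x with ⟨y, hy⟩ | ⟨y, hy⟩
  · rcases key y with h | h
    · exact Or.inl (hy ▸ h)
    · exact Or.inr (Or.inr ⟨y, h, hy.symm⟩)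
  · rcases key y with h | h
    · exact Or.inr (Or.inl (hy ▸ h))
    · obtain ⟨z, hz, -, hz', -⟩ := algebraMap_inv (F := F) h
      exact Or.inr (Or.inr ⟨z, hz, by rw [← hz', hy, inv_inv]⟩)

/-- An element of `F` specializes to `0`, `∞`, `1` or to some other element of the residue
field. -/
theorem pos_cases (x : F) :
    Pos A x ∨ Pos A x⁻¹ ∨ Pos A (1 - x) ∨
      ∃ y : A, IsUnit y ∧ IsUnit (1 - y) ∧ x = algebraMap A F y := by
  rcases pos_or_pos_inv_or_unit (A := A) x with h | h | ⟨y, hy, rfl⟩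
  · exact Or.inl h
  · exact Or.inr (Or.inl h)
  · by_cases h1 : IsUnit (1 - y)
    · exact Or.inr (Or.inr (Or.inr ⟨y, hy, h1, rfl⟩))
    · exact Or.inr (Or.inr (Or.inl ⟨1 - y, h1, by rw [map_sub, map_one]⟩))

open Classical in
/-- The residue class of a unit of `A`, as a function on `F` with value `0` off the units. -/
def resF (x : F) : ResidueField A :=
  if h : ∃ y : A, IsUnit y ∧ x = algebraMap A F y then residue A h.choose else 0

theorem resF_unit {y : A} (hy : IsUnit y) : resF (algebraMap A F y) = residue A y := by
  have h : ∃ z : A, IsUnit z ∧ algebraMap A F y = algebraMap A F z := ⟨y, hy, rfl⟩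
  rw [resF, dif_pos h, ← IsFractionRing.injective A F h.choose_spec.2]

variable (A) in
open Classical in
/-- The values of the specialization map on symbols. -/
def specFun (x : F) : IndRes A F (RPt (ResidueField A)) :=
  if Pos A x then iota A F _ (tC _) else if Pos A x⁻¹ then -iota A F _ (tC _)
  else iota A F _ (br (resF x))

theorem specFun_pos {x : F} (h : Pos A x) : specFun A x = iota A F _ (tC _) := if_pos h

theorem specFun_neg {x : F} (h0 : x ≠ 0) (h : Pos A x⁻¹) :
    specFun A x = -iota A F _ (tC _) := by
  rw [specFun, if_neg, if_pos h]
  rw [← inv_inv x]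
  exact h.not_inv (inv_ne_zero h0)

theorem specFun_unit {y : A} (hy : IsUnit y) :
    specFun A (algebraMap A F y) = iota A F _ (br (residue A y)) := by
  obtain ⟨z, hz, -, hz', -⟩ := algebraMap_inv (F := F) hy
  rw [specFun, if_neg (not_pos_unit hy), if_neg (hz' ▸ not_pos_unit hz), resF_unit hy]

theorem fang_neg_one_smul_iota {M : Type*} [AddCommGroup M] [Module (GR (ResidueField A)) M]
    (m : M) : fang F (-1) • iota A F M m = iota A F M (fang (ResidueField A) (-1) • m) := by
  have h := fang_smul_iota (F := F) (y := (-1 : A)) (by simp) m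
  rwa [map_neg (algebraMap A F), map_one (algebraMap A F), map_neg (residue A),
    map_one (residue A)] at h

theorem residue_eq_zero' {y : A} (hy : y ∈ maximalIdeal A) : residue A y = 0 :=
  (residue_eq_zero_iff y).2 hy

/-- The function `specFun` satisfies the relation `[x⁻¹] = -⟨-1⟩[x]` of `ℛ𝒫(F) / 𝒦⁽¹⁾`. -/
theorem specFun_inv {x : F} (h0 : x ≠ 0) : specFun A x⁻¹ = -(fang F (-1) • specFun A x) := by
  rcases pos_or_pos_inv_or_unit (A := A) x with h | h | ⟨y, hy, rfl⟩
  · rw [specFun_pos h, specFun_neg (inv_ne_zero h0) (by rwa [inv_inv]), fang_neg_one_smul_iota,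
      neg_one_smul_tC]
  · rw [specFun_pos h, specFun_neg h0 h, smul_neg, fang_neg_one_smul_iota, neg_one_smul_tC,
      neg_neg]
  · obtain ⟨z, hz, -, hz', hz''⟩ := algebraMap_inv (F := F) hy
    rw [hz', specFun_unit hz, specFun_unit hy, fang_neg_one_smul_iota, ← hz'', br_inv, map_neg]

theorem residue_ne_zero {y : A} (hy : IsUnit y) : residue A y ≠ 0 :=
  (residue_ne_zero_iff_isUnit y).2 hy

theorem residue_ne_one {y : A} (hy : IsUnit (1 - y)) : residue A y ≠ 1 := fun h =>
  residue_ne_zero hy (by rw [map_sub, map_one, h, sub_self])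

theorem specFun_one_sub_pos {x : F} (h : Pos A (1 - x)) : specFun A x = 0 := by
  obtain ⟨y, hy, hxy⟩ := h
  have : x = algebraMap A F (1 - y) := by rw [map_sub, map_one, ← hxy, sub_sub_cancel]
  rw [this, specFun_unit (isUnit_one_sub hy), map_sub, residue_eq_zero' hy, map_one, sub_zero,
    br_one, map_zero]

/-- The function `specFun` satisfies the relation `[x] + ⟨-1⟩[1 - x] = C`. For `x` of negative
valuation this uses `3C = 0`. -/
theorem specFun_add {x : F} (h0 : x ≠ 0) (h1 : x ≠ 1) :
    specFun A x + fang F (-1) • specFun A (1 - x) = iota A F _ (tC _) := by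
  have h1' := sub_ne_zero.2 h1.symm
  rcases pos_cases (A := A) x with h | h | h | ⟨y, hy, hy1, rfl⟩
  · rw [specFun_pos h, specFun_one_sub_pos (x := 1 - x) (by rwa [sub_sub_cancel]), smul_zero,
      add_zero]
  · have : Pos A (1 - x)⁻¹ := by
      obtain ⟨z, hz, hxz⟩ := h
      have := Pos.div (F := F) (x := -x⁻¹) ⟨-z, neg_mem hz, by rw [map_neg, hxz]⟩
        (isUnit_one_sub hz)
      rw [map_sub, map_one, ← hxz] at this
      convert this using 1
      have h2 : x - 1 ≠ 0 := sub_ne_zero.2 h1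
      have e : 1 - x⁻¹ = (x - 1) / x := by field_simp
      rw [e]; field_simp; ring
    rw [specFun_neg h0 h, specFun_neg h1' this, smul_neg, fang_neg_one_smul_iota, neg_one_smul_tC]
    have h3 := congrArg (iota A F _) (three_smul_tC (K := ResidueField A))
    rw [ofNat_smul_eq_nsmul, map_nsmul, map_zero] at h3
    linear_combination (norm := module) -h3
  · rw [specFun_pos h, specFun_one_sub_pos h, zero_add, fang_neg_one_smul_iota, neg_one_smul_tC]
  · have : (1 : F) - algebraMap A F y = algebraMap A F (1 - y) := by rw [map_sub, map_one]
    rw [this, specFun_unit hy, specFun_unit hy1, fang_neg_one_smul_iota, ← map_add, map_sub,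
      map_one, br_add (residue_ne_zero hy) (residue_ne_one hy1)]

theorem iota_fang_smul {y : A} (hy : IsUnit y) (t : RPt (ResidueField A)) :
    iota A F _ (fang _ (residue A y) • t) = fang F (algebraMap A F y) • iota A F _ t :=
  (fang_smul_iota hy t).symm

theorem fang_one_sub_smul_iota {x : F} (h : Pos A x) (t : RPt (ResidueField A)) :
    fang F (1 - x) • iota A F _ t = iota A F _ t := by
  obtain ⟨y, hy, rfl⟩ := h
  have := fang_smul_iota (F := F) (isUnit_one_sub hy) t
  rwa [map_sub (algebraMap A F), map_one (algebraMap A F), map_sub (residue A),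
    map_one (residue A), residue_eq_zero' hy, sub_zero, map_one, one_smul] at this

theorem Pos.mul_of_one_sub {x y : F} (h : Pos A x) (hy : Pos A y) : Pos A (x * (1 - y)) := by
  obtain ⟨z, hz, rfl⟩ := hy
  have := h.mul (1 - z)
  rwa [map_sub, map_one] at this

theorem Pos.div_of_one_sub {x y : F} (h : Pos A x) (hy : Pos A y) : Pos A (x / (1 - y)) := by
  obtain ⟨z, hz, rfl⟩ := hy
  have := h.div (isUnit_one_sub hz)
  rwa [map_sub, map_one] at this

theorem Pos.sub {x y : F} (h : Pos A x) (hy : Pos A y) : Pos A (x - y) := by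
  obtain ⟨z, hz, rfl⟩ := hy
  obtain ⟨w, hw, rfl⟩ := h
  exact ⟨w - z, sub_mem hw hz, (map_sub _ _ _).symm⟩

/-- The function `specFun` depends on an element only up to a factor that is a principal unit. -/
theorem specFun_mul_one_sub {x y : F} (hx : x ≠ 0) (h : Pos A y) :
    specFun A (x * (1 - y)) = specFun A x := by
  have h1 := h.one_sub_ne_zero
  rcases pos_or_pos_inv_or_unit (A := A) x with hx' | hx' | ⟨u, hu, rfl⟩
  · rw [specFun_pos hx', specFun_pos (hx'.mul_of_one_sub h)]
  · rw [specFun_neg hx hx', specFun_neg (mul_ne_zero hx h1)]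
    rw [mul_inv, ← div_eq_mul_inv]
    exact hx'.div_of_one_sub h
  · obtain ⟨z, hz, rfl⟩ := h
    have e : algebraMap A F u * (1 - algebraMap A F z) = algebraMap A F (u * (1 - z)) := by
      rw [map_mul, map_sub, map_one]
    rw [e, specFun_unit (hu.mul (isUnit_one_sub hz)), specFun_unit hu, map_mul, map_sub, map_one,
      residue_eq_zero' hz, sub_zero, mul_one]

theorem specFun_div_one_sub {x y : F} (hx : x ≠ 0) (h : Pos A y) :
    specFun A (x / (1 - y)) = specFun A x := by
  have h1 := h.one_sub_ne_zero
  rw [← specFun_mul_one_sub (div_ne_zero hx h1) h, div_mul_cancel₀ _ h1]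

/-- The five term relation for `a` of positive valuation. -/
theorem fiveTerm_pos {a b : F} (ha0 : a ≠ 0) (ha1 : a ≠ 1) (hb0 : b ≠ 0) (hb1 : b ≠ 1)
    (hab : a ≠ b) (ha : Pos A a) : FiveTerm (specFun A) a b := by
  have ha1' := sub_ne_zero.2 ha1.symm
  have hb1' := sub_ne_zero.2 hb1.symm
  have hr := div_ne_zero hb0 ha0
  -- the case that `b` specializes to `1`
  have key : ∀ {a b : F}, a ≠ 0 → a ≠ 1 → b ≠ 0 → b ≠ 1 → a ≠ b → Pos A a → Pos A (1 - b) →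
      FiveTerm (specFun A) a b := by
    intro a b ha0 ha1 hb0 hb1 hab ha hb
    have ha1' := sub_ne_zero.2 ha1.symm
    have hb1' := sub_ne_zero.2 hb1.symm
    have e1 : Pos A (b / a)⁻¹ := by
      have := ha.div_of_one_sub hb
      rwa [sub_sub_cancel, ← inv_div] at this
    have e2 : Pos A ((1 - a) / (1 - b))⁻¹ := by
      rw [inv_div]; exact hb.div_of_one_sub ha
    have e3 : Pos A (b / a * ((1 - a) / (1 - b)))⁻¹ := by
      rw [mul_inv]
      obtain ⟨t, -, ht⟩ := e2
      rw [ht]; exact e1.mul t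
    have e4 := fang_one_sub_smul_iota ha (tC (ResidueField A))
    rw [FiveTerm, specFun_pos ha, specFun_one_sub_pos hb, specFun_neg (div_ne_zero hb0 ha0) e1,
      specFun_neg (div_ne_zero ha1' hb1') e2,
      specFun_neg (mul_ne_zero (div_ne_zero hb0 ha0) (div_ne_zero ha1' hb1')) e3, smul_neg,
      smul_neg, smul_neg, mul_smul, e4]
    module
  rcases pos_cases (A := A) b with hb | hb | hb | ⟨y, hy, hy1, rfl⟩
  · have e1 : Pos A (1 - (1 - a) / (1 - b)) := by
      have : 1 - (1 - a) / (1 - b) = (a - b) / (1 - b) := by field_simp; ring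
      rw [this]
      exact (ha.sub hb).div_of_one_sub hb
    have e2 : specFun A (b / a * ((1 - a) / (1 - b))) = specFun A (b / a) := by
      rw [← sub_sub_cancel 1 ((1 - a) / (1 - b))]
      exact specFun_mul_one_sub hr e1
    rw [FiveTerm, specFun_pos ha, specFun_pos hb, e2, specFun_one_sub_pos e1, sub_self, zero_add,
      smul_zero, add_zero, mul_smul]
    rcases pos_or_pos_inv_or_unit (A := A) (b / a) with h | h | ⟨u, hu, h⟩
    · rw [specFun_pos h, fang_one_sub_smul_iota ha, sub_self]
    · rw [specFun_neg hr h, smul_neg (fang F (1 - a)), fang_one_sub_smul_iota ha, sub_self]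
    · rw [h, specFun_unit hu, fang_one_sub_smul_iota ha, sub_self]
  · -- the transformation `x ↦ x / (x - 1)` interchanges `1` and `∞`
    have h1 : 1 - (1 - a)⁻¹ = -(a / (1 - a)) := by field_simp; ring
    have h2 : 1 - (1 - (1 - b)⁻¹) = (b⁻¹) / (b⁻¹ - 1) := by
      have : b⁻¹ - 1 = (1 - b) / b := by field_simp
      rw [this]; field_simp; ring
    refine FiveTerm.of_one_sub (fun x => specFun_inv) (fun x => specFun_add) ha0 ha1 hb0 hb1 ?_
    refine FiveTerm.of_inv (fun x => specFun_inv) ha1' (by simpa using ha0) hb1'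
      (by simpa using hb0) ?_
    refine FiveTerm.of_one_sub (fun x => specFun_inv) (fun x => specFun_add) (inv_ne_zero ha1')
      (inv_ne_one.2 (by simpa using ha0)) (inv_ne_zero hb1') (inv_ne_one.2 (by simpa using hb0)) ?_
    have h3 : ∀ x : F, x ≠ 0 → 1 - (1 - x)⁻¹ ≠ 0 := fun x hx h => by
      rw [sub_eq_zero, eq_comm, inv_eq_one] at h
      exact hx (by simpa using h)
    refine key (h3 a ha0) (by simpa using ha1') (h3 b hb0) (by simpa using hb1')
      (fun h => hab ?_) ?_ ?_
    · exact sub_right_injective (inv_injective (sub_right_injective h))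
    · rw [h1]
      have := (ha.div_of_one_sub ha).mul (-1)
      rwa [map_neg, map_one, mul_neg_one] at this
    · rw [h2]
      have := (hb.div_of_one_sub hb).mul (-1)
      rwa [map_neg, map_one, mul_neg_one, ← div_neg, neg_sub] at this
  · exact key ha0 ha1 hb0 hb1 hab ha hb
  · obtain ⟨z, hz, -, hz', hz''⟩ := algebraMap_inv (F := F) hy1
    have ey : algebraMap A F (1 - y) = 1 - algebraMap A F y := by rw [map_sub, map_one]
    have e1 : Pos A (algebraMap A F y / a)⁻¹ := by rw [inv_div]; exact ha.div hy
    have e3 : Pos A (algebraMap A F y / a * ((1 - a) / (1 - algebraMap A F y)))⁻¹ := by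
      have := (e1.mul (1 - y)).div_of_one_sub ha
      rw [map_sub, map_one] at this
      convert this using 1
      rw [mul_inv, inv_div (1 - a), mul_div_assoc]
    have e4 := fang_one_sub_smul_iota ha (tC (ResidueField A))
    have e5 : specFun A ((1 - a) / (1 - algebraMap A F y)) =
        iota A F _ (br (residue A y)) - iota A F _ (tC _) := by
      rw [div_eq_mul_inv, mul_comm, ← ey, hz', specFun_mul_one_sub _ ha, specFun_unit hz, ← hz'',
        map_sub, map_one, br_inv_one_sub (residue_ne_zero hy) (residue_ne_one hy1), map_sub]
      rw [← hz', ey]; exact inv_ne_zero hb1'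
    rw [FiveTerm, specFun_pos ha, specFun_unit hy, specFun_neg hr e1,
      specFun_neg (mul_ne_zero hr (div_ne_zero ha1' hb1')) e3, e5, smul_sub, e4,
      fang_one_sub_smul_iota ha, smul_neg, smul_neg, mul_smul, e4]
    module

variable (hK : ∀ s : Finset (ResidueField A), s.card ≤ 7 → ∃ x, x ∉ s)
include hK

/-- The five term relation for a unit `a` of `A` with `1 - a` a unit. -/
theorem fiveTerm_unit {y : A} {b : F} (hy : IsUnit y) (hy1 : IsUnit (1 - y)) (hb0 : b ≠ 0)
    (hb1 : b ≠ 1) (hab : algebraMap A F y ≠ b) :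
    FiveTerm (specFun A) (algebraMap A F y) b := by
  have hinj := IsFractionRing.injective A F
  -- the case that `b` has positive valuation
  have key : ∀ {y : A} {b : F}, IsUnit y → IsUnit (1 - y) → b ≠ 0 → Pos A b →
      FiveTerm (specFun A) (algebraMap A F y) b := by
    intro y b hy hy1 hb0 hb
    have ey : algebraMap A F (1 - y) = 1 - algebraMap A F y := by rw [map_sub, map_one]
    have e0 : 1 - algebraMap A F y ≠ 0 := ey ▸ (hy1.map (algebraMap A F)).ne_zero
    have e1 := hb.div hy
    have e2 : specFun A ((1 - algebraMap A F y) / (1 - b)) =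
        iota A F _ (br (residue A (1 - y))) := by
      rw [specFun_div_one_sub e0 hb, ← ey, specFun_unit hy1]
    have e3 : Pos A (b / algebraMap A F y * ((1 - algebraMap A F y) / (1 - b))) := by
      have := (e1.mul (1 - y)).div_of_one_sub hb
      rwa [ey, mul_div_assoc] at this
    have e4 := congrArg (iota A F _) (br_five_zero hK (residue_ne_zero hy) (residue_ne_one hy1))
    rw [← map_one (residue A), ← map_sub, map_add, map_sub, map_add, map_sub, mul_smul,
      iota_fang_smul hy, iota_fang_smul hy, iota_fang_smul hy1, iota_fang_smul hy1, map_zero,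
      ← mul_smul, ey] at e4
    rw [FiveTerm, specFun_unit hy, specFun_pos hb, specFun_pos e1, e2, specFun_pos e3, e4]
  have ey : algebraMap A F (1 - y) = 1 - algebraMap A F y := by rw [map_sub, map_one]
  have hy0' : algebraMap A F y ≠ 0 := (hy.map (algebraMap A F)).ne_zero
  have e0 : 1 - algebraMap A F y ≠ 0 := ey ▸ (hy1.map (algebraMap A F)).ne_zero
  have hy1' : algebraMap A F y ≠ 1 := (sub_ne_zero.1 e0).symm
  rcases pos_cases (A := A) b with hb | hb | hb | ⟨w, hw, hw1, rfl⟩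
  · exact key hy hy1 hb0 hb
  · obtain ⟨z, hz, hzy, hz', hz''⟩ := algebraMap_inv (F := F) hy
    refine FiveTerm.of_inv (fun x => specFun_inv) hy0' hy1' hb0 hb1 ?_
    rw [hz']
    refine key hz ?_ (inv_ne_zero hb0) hb
    have : 1 - z = -1 * z * (1 - y) := by linear_combination -hzy
    rw [this]; exact (isUnit_one.neg.mul hz).mul hy1
  · refine FiveTerm.of_one_sub (fun x => specFun_inv) (fun x => specFun_add) hy0' hy1' hb0 hb1 ?_
    rw [← ey]
    exact key hy1 (by rwa [sub_sub_cancel]) (sub_ne_zero.2 hb1.symm) hb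
  · have ew : algebraMap A F (1 - w) = 1 - algebraMap A F w := by rw [map_sub, map_one]
    obtain ⟨z, hz, hzy, hz', hz''⟩ := algebraMap_inv (F := F) hy
    obtain ⟨t, ht, htw, ht', ht''⟩ := algebraMap_inv (F := F) hw1
    have e1 : algebraMap A F w / algebraMap A F y = algebraMap A F (w * z) := by
      rw [div_eq_mul_inv, hz', map_mul]
    have e2 : (1 - algebraMap A F y) / (1 - algebraMap A F w) = algebraMap A F ((1 - y) * t) := by
      rw [← ey, ← ew, div_eq_mul_inv, ht', map_mul]
    rw [FiveTerm, e1, e2, ← map_mul (algebraMap A F), specFun_unit hy, specFun_unit hw,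
      specFun_unit (hw.mul hz), specFun_unit (hy1.mul ht),
      specFun_unit ((hw.mul hz).mul (hy1.mul ht)), ← ey, mul_smul,
      fang_smul_iota hy, fang_smul_iota hy1, fang_smul_iota hy1, fang_smul_iota hy, ← map_sub,
      ← map_add, ← map_sub, ← map_add]
    by_cases hres : residue A y = residue A w
    · have e3 : residue A w * residue A z = 1 := by rw [← hres, mul_comm, ← map_mul, hzy, map_one]
      have e4 : residue A (1 - y) * residue A t = 1 := by
        rw [map_sub, hres, ← map_sub, mul_comm, ← map_mul, htw, map_one]
      simp only [map_mul (residue A), e3, e4, hres, mul_one, br_one, smul_zero, sub_self, add_zero,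
        map_zero]
    · have h := br_five (residue_ne_zero hy) (residue_ne_one hy1) (residue_ne_zero hw)
        (residue_ne_one hw1) hres
      rw [← map_one (residue A), ← map_sub, ← map_sub, div_eq_mul_inv (residue A w), hz'',
        div_eq_mul_inv _ (residue A (1 - w)), ht'', ← map_mul (residue A),
        ← map_mul (residue A), ← map_mul (residue A), mul_smul] at h
      rw [h, map_zero]

theorem fiveTerm_specFun {a b : F} (ha0 : a ≠ 0) (ha1 : a ≠ 1) (hb0 : b ≠ 0) (hb1 : b ≠ 1)
    (hab : a ≠ b) : FiveTerm (specFun A) a b := by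
  have ha1' := sub_ne_zero.2 ha1.symm
  have hb1' := sub_ne_zero.2 hb1.symm
  rcases pos_cases (A := A) a with ha | ha | ha | ⟨y, hy, hy1, rfl⟩
  · exact fiveTerm_pos ha0 ha1 hb0 hb1 hab ha
  · exact FiveTerm.of_inv (fun x => specFun_inv) ha0 ha1 hb0 hb1
      (fiveTerm_pos (inv_ne_zero ha0) (inv_ne_one.2 ha1) (inv_ne_zero hb0) (inv_ne_one.2 hb1)
        (fun h => hab (inv_injective h)) ha)
  · exact FiveTerm.of_one_sub (fun x => specFun_inv) (fun x => specFun_add) ha0 ha1 hb0 hb1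
      (fiveTerm_pos ha1' (by simpa using ha0) hb1' (by simpa using hb0)
        (fun h => hab (sub_right_injective h)) ha)
  · exact fiveTerm_unit hK hy hy1 hb0 hb1 hab

variable (F) in
/-- The specialization map `S_v`. -/
def spec : RP F →ₗ[GR F] IndRes A F (RPt (ResidueField A)) :=
  RP.lift (specFun A) fun _ _ ha0 ha1 hb0 hb1 hab => fiveTerm_specFun hK ha0 ha1 hb0 hb1 hab

theorem spec_fsym {x : F} (h0 : x ≠ 0) (h1 : x ≠ 1) : spec F hK (fsym x) = specFun A x :=
  RP.lift_fsym _ _ h0 h1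

theorem isSpecialization_spec : IsSpecialization (A := A) (F := F) (spec F hK) where
  of_unit a u h := by
    rw [← fsym_coe, spec_fsym hK a.1.ne_zero a.ne_one, h, specFun_unit u.isUnit]
    change _ = iota A F _ (toRPt (sym (red u)))
    rw [← fsym_coe]; rfl
  of_pos a x hx h c := by
    rw [← fsym_coe, spec_fsym hK a.1.ne_zero a.ne_one, specFun_pos ⟨x, hx, h⟩, toRPt_constC]
    rfl
  of_neg a x hx h c := by
    rw [← fsym_coe, spec_fsym hK a.1.ne_zero a.ne_one, specFun_neg a.1.ne_zero ⟨x, hx, ?_⟩,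
      toRPt_constC]
    · rfl
    · rw [← h, Units.val_inv_eq_inv_val]

end Specialization

/-! ### Inverting two -/

section Half

variable {R M N P Q : Type*} [CommRing R] [AddCommGroup M] [AddCommGroup N] [AddCommGroup P]
  [AddCommGroup Q] [Module R M] [Module R N] [Module R P] [Module R Q]

theorem half_tmul (f : M →ₗ[R] N) (m : M) (q : Localization.Away (2 : ℤ)) :
    half f (m ⊗ₜ q) = f m ⊗ₜ q := rfl

theorem Half.zsmul_tmul (n : ℤ) (m : M) (q : Localization.Away (2 : ℤ)) :
    n • (m ⊗ₜ q : Half M) = m ⊗ₜ ((n : Localization.Away (2 : ℤ)) * q) := by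
  rw [← zsmul_eq_mul]
  exact (map_zsmul (TensorProduct.mk ℤ M (Localization.Away (2 : ℤ)) m) n q).symm

theorem Half.zsmul_tmul' (n : ℤ) (m : M) (q : Localization.Away (2 : ℤ)) :
    n • (m ⊗ₜ q : Half M) = (n • m) ⊗ₜ q :=
  (map_zsmul ((TensorProduct.mk ℤ M (Localization.Away (2 : ℤ))).flip q) n m).symm

theorem Half.exists_inv (n : ℕ) :
    ∃ q : Localization.Away (2 : ℤ), ((2 ^ n : ℤ) : Localization.Away (2 : ℤ)) * q = 1 := by
  obtain ⟨q, hq⟩ := IsUnit.exists_right_inv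
    (IsLocalization.map_units (Localization.Away (2 : ℤ))
      (⟨2 ^ n, n, rfl⟩ : Submonoid.powers (2 : ℤ)))
  exact ⟨q, by rw [← hq]; simp⟩

theorem Half.exists_eq (t : Half M) : ∃ (n : ℕ) (m : M), (2 ^ n : ℤ) • t = m ⊗ₜ 1 := by
  induction t using TensorProduct.induction_on with
  | zero => exact ⟨0, 0, by simp⟩
  | tmul m q =>
    obtain ⟨⟨a, ⟨_, n, rfl⟩⟩, h⟩ := IsLocalization.surj (Submonoid.powers (2 : ℤ)) q
    refine ⟨n, a • m, ?_⟩
    rw [Half.zsmul_tmul, ← Half.zsmul_tmul', Half.zsmul_tmul, mul_one]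
    congr 1
    rw [mul_comm]
    simpa using h
  | add x y hx hy =>
    obtain ⟨n, m, h⟩ := hx
    obtain ⟨n', m', h'⟩ := hy
    refine ⟨n + n', (2 ^ n' : ℤ) • m + (2 ^ n : ℤ) • m', ?_⟩
    rw [TensorProduct.add_tmul, ← Half.zsmul_tmul', ← Half.zsmul_tmul', ← h, ← h',
      smul_add, smul_smul, smul_smul]
    congr 2
    · ring
    · ring

theorem Half.two_pow_smul_inj {n : ℕ} {s t : Half M} (h : (2 ^ n : ℤ) • s = (2 ^ n : ℤ) • t) :
    s = t := by
  obtain ⟨q, hq⟩ := Half.exists_inv n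
  let L : Half M →ₗ[ℤ] Half M := LinearMap.lTensor M (LinearMap.mulLeft ℤ q)
  have hL : ∀ t : Half M, L ((2 ^ n : ℤ) • t) = t := by
    intro t
    induction t using TensorProduct.induction_on with
    | zero => simp
    | add x y hx hy => rw [smul_add, map_add, hx, hy]
    | tmul m r =>
      rw [Half.zsmul_tmul]
      change m ⊗ₜ (q * _) = _
      congr 1
      rw [← mul_assoc, mul_comm q, hq, one_mul]
  rw [← hL s, h, hL]

theorem Half.tmul_one_eq_zero {m : M} (h : (m ⊗ₜ 1 : Half M) = 0) :
    ∃ n : ℕ, (2 ^ n : ℤ) • m = 0 := by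
  let S := Submonoid.powers (2 : ℤ)
  let φ : Half M →+ LocalizedModule S M := TensorProduct.liftAddHom
    (AddMonoidHom.mk' (fun m => AddMonoidHom.mk'
      (fun q : Localization S => q • (LocalizedModule.mk m 1 : LocalizedModule S M))
      fun a b => add_smul a b _)
      fun a b => AddMonoidHom.ext fun q => by
        change q • (LocalizedModule.mk (a + b) 1 : LocalizedModule S M) =
          q • (LocalizedModule.mk a 1 : LocalizedModule S M) + q • (LocalizedModule.mk b 1)
        rw [← smul_add, LocalizedModule.mk_add_mk]
        simp)
    (fun r m q => by
      have h1 : (LocalizedModule.mk (r • m) 1 : LocalizedModule S M) =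
          r • LocalizedModule.mk m 1 := map_zsmul (LocalizedModule.mkLinearMap S M) r m
      change q • (LocalizedModule.mk (r • m) 1 : LocalizedModule S M) =
        (r • q) • LocalizedModule.mk m 1
      rw [h1, smul_assoc, smul_comm])
  have h1 : φ (m ⊗ₜ 1) = LocalizedModule.mk m 1 := one_smul (Localization S) _
  rw [h, map_zero, eq_comm, ← LocalizedModule.zero_mk 1, LocalizedModule.mk_eq] at h1
  obtain ⟨⟨_, n, rfl⟩, hn⟩ := h1
  refine ⟨n, ?_⟩
  simpa [S, Submonoid.smul_def] using hn

/-- A surjective map becomes bijective after inverting `2` if its kernel is `2`-primary torsion. -/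
theorem half_bijective (f : M →ₗ[R] N) (hf : ∀ x, f x = 0 → ∃ n : ℕ, (2 ^ n : ℤ) • x = 0)
    (hs : Function.Surjective f) : Function.Bijective (half f) := by
  constructor
  · refine (injective_iff_map_eq_zero (half f)).2 fun t ht => ?_
    obtain ⟨n, m, h⟩ := Half.exists_eq t
    have h1 : (f m ⊗ₜ 1 : Half N) = 0 := by
      rw [← half_tmul, ← h, map_zsmul, ht, smul_zero]
    obtain ⟨k, hk⟩ := Half.tmul_one_eq_zero h1
    rw [← map_zsmul] at hk
    obtain ⟨l, hl⟩ := hf _ hk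
    refine Half.two_pow_smul_inj (n := l + k + n) ?_
    rw [smul_zero, pow_add, mul_smul, h, Half.zsmul_tmul', pow_add, mul_smul, hl,
      TensorProduct.zero_tmul]
  · intro t
    induction t using TensorProduct.induction_on with
    | zero => exact ⟨0, map_zero _⟩
    | tmul m q =>
      obtain ⟨m, rfl⟩ := hs m
      exact ⟨m ⊗ₜ q, half_tmul _ _ _⟩
    | add x y hx hy =>
      obtain ⟨a, rfl⟩ := hx
      obtain ⟨b, rfl⟩ := hy
      exact ⟨a + b, map_add _ _ _⟩

/-- Exactness after inverting `2`, in terms of the modules before inverting `2`. -/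
theorem half_exact (f : M →ₗ[R] N) (g : N →ₗ[R] Q) (t : P →ₗ[R] Q)
    (ht : Function.Bijective (half t)) (hgf : ∀ x, g (f x) = 0)
    (hker : ∀ y, g y = 0 → ∃ (n : ℕ) (x : M), (2 ^ n : ℤ) • y = f x)
    (hsurj : ∀ z, ∃ (n : ℕ) (y : N), (2 ^ n : ℤ) • z = g y) :
    ∃ δ : Half N →ₗ[R] Half P, half t ∘ₗ δ = half g ∧ Function.Exact (half f) δ ∧
      Function.Surjective δ := by
  let e := LinearEquiv.ofBijective (half t) ht
  have he : ∀ z, half t (e.symm z) = z := fun z => e.apply_symm_apply z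
  refine ⟨e.symm.toLinearMap ∘ₗ half g, LinearMap.ext fun z => he _, fun y => ?_, fun z => ?_⟩
  · change e.symm (half g y) = 0 ↔ _
    rw [LinearEquiv.map_eq_zero_iff]
    constructor
    · intro hy
      obtain ⟨n, m, h⟩ := Half.exists_eq y
      have h1 : (g m ⊗ₜ 1 : Half Q) = 0 := by
        rw [← half_tmul, ← h, map_zsmul, hy, smul_zero]
      obtain ⟨k, hk⟩ := Half.tmul_one_eq_zero h1
      rw [← map_zsmul] at hk
      obtain ⟨l, x, hl⟩ := hker _ hk
      obtain ⟨q, hq⟩ := Half.exists_inv (l + k + n)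
      refine ⟨x ⊗ₜ q, Half.two_pow_smul_inj (n := l + k + n) ?_⟩
      rw [half_tmul, Half.zsmul_tmul, hq, ← hl, pow_add, mul_smul, h,
        Half.zsmul_tmul', pow_add, mul_smul]
    · rintro ⟨x, rfl⟩
      induction x using TensorProduct.induction_on with
      | zero => rw [map_zero, map_zero]
      | tmul m q => rw [half_tmul, half_tmul, hgf, TensorProduct.zero_tmul]
      | add x y hx hy => rw [map_add, map_add, hx, hy, add_zero]
  · have key : ∀ w, ∃ y, half g y = w := by
      intro w
      obtain ⟨n, m, h⟩ := Half.exists_eq w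
      obtain ⟨k, y, hk⟩ := hsurj m
      obtain ⟨q, hq⟩ := Half.exists_inv (k + n)
      refine ⟨y ⊗ₜ q, Half.two_pow_smul_inj (n := k + n) ?_⟩
      rw [half_tmul, Half.zsmul_tmul, hq, ← hk, pow_add, mul_smul, h,
        Half.zsmul_tmul']
    obtain ⟨y, hy⟩ := key (e z)
    exact ⟨y, by change e.symm (half g y) = z; rw [hy, e.symm_apply_apply]⟩

end Half

/-! ### The map `δ_π` -/

section Delta

open IsLocalRing

variable {A : Type u} [CommRing A] [IsDomain A] [IsDiscreteValuationRing A]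
  {F : Type v} [Field F] [Algebra A F] [IsFractionRing A F]

theorem toFrac_ang (w : Aˣ) : toFrac A F (ang w) = fang F (algebraMap A F w) :=
  (mapGR_ang _ _).trans (fang_coe _).symm

theorem toRes_ang (w : Aˣ) : toRes A (ang w) = fang _ (residue A w) :=
  (mapGR_ang _ _).trans (fang_coe _).symm

theorem rho_smul_iota {π : A} (hπ : Irreducible π) {M : Type*} [AddCommGroup M]
    [Module (GR (ResidueField A)) M] (r : GR F) (m : M) :
    rho hπ M (r • iota A F M m) = Res.mk (toRes A) M (rhoAdd hπ r • m) := by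
  have h : r • iota A F M m = Res.mk (toFrac A F) (GR F) r ⊗ₜ[GR A] Res.mk (toRes A) M m := by
    change r • (Res.mk (toFrac A F) (GR F) 1 ⊗ₜ[GR A] Res.mk (toRes A) M m) = _
    rw [TensorProduct.smul_tmul']
    exact congrArg (· ⊗ₜ[GR A] Res.mk (toRes A) M m) (mul_one r)
  rw [h, rho, TensorProduct.lift.tmul]
  rfl

theorem rhoAdd_ang {π : A} (hπ : Irreducible π) (w : Aˣ) (n : ℤ) :
    rhoAdd hπ (ang (unitF F w * unifF F hπ ^ n)) =
      open Classical in if Odd n then ang (red w) else 0 := by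
  rw [← rhoFun_apply (F := F)]
  exact rhoAdd_of hπ _

theorem rhoAdd_one {π : A} (hπ : Irreducible π) : rhoAdd hπ (1 : GR F) = 0 := by
  have := rhoAdd_ang (F := F) hπ 1 0
  rwa [map_one, zpow_zero, mul_one, if_neg (by decide), show ang (1 : Fˣ) = 1 from map_one _]
    at this

theorem lambdaOne_mem_augIdeal {K : Type*} [Field K] (x : RP K) : lambdaOne K x ∈ augIdeal K := by
  induction x using RP.induction with
  | h0 => rw [map_zero]; exact zero_mem _
  | ha x y hx hy => rw [map_add]; exact add_mem hx hy
  | h1 r a =>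
    rw [map_smul, smul_eq_mul, lambdaOne_sym a.1 (W.compl a) rfl]
    exact Ideal.mul_mem_left _ _ (Ideal.mul_mem_left _ _ (dang_mem _))

theorem lambdaOne_constC {K : Type*} [Field K] (c : W K) : lambdaOne K (constC c) = 0 := by
  rw [constC, map_add, map_add, map_smul, map_smul, lambdaOne_psiOne,
    lambdaOne_sym c.1 (W.compl c) rfl, lambdaOne_sym (W.oneSub c).1 c.1]
  · simp only [W.oneSub, smul_eq_mul]; ring
  · simp [W.oneSub, W.coe_compl]

theorem lambdaOne_fsym {K : Type*} [Field K] {x : K} (h0 : x ≠ 0) (h1 : x ≠ 1) :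
    lambdaOne K (fsym x) = (fang K x - 1) * (fang K (1 - x) - 1) := by
  have h1' := sub_ne_zero.2 h1.symm
  have := lambdaOne_sym (Units.mk0 x h0) (Units.mk0 (1 - x) h1') rfl
  rw [dang, dang, ← fang_coe, ← fang_coe, ← fsym_coe] at this
  exact this

/-- The square class of `1 - x` for `x` of positive valuation comes from `A` and is trivial in the
residue field. -/
theorem fang_one_sub_eq {x : F} (h : Pos A x) :
    ∃ r : GR A, fang F (1 - x) = toFrac A F r ∧ toRes A r = 1 := by
  obtain ⟨y, hy, rfl⟩ := h
  obtain ⟨w, hw⟩ := isUnit_one_sub hy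
  refine ⟨ang w, ?_, ?_⟩
  · rw [toFrac_ang, hw, map_sub (algebraMap A F), map_one (algebraMap A F)]
  · rw [toRes_ang, hw, map_sub (residue A), map_one (residue A), residue_eq_zero' hy,
      sub_zero, map_one]

variable (hK : ∀ s : Finset (ResidueField A), s.card ≤ 7 → ∃ x, x ∉ s)

/-- The homomorphisms `λ₁` for `F` and for the residue field are compatible with specialization,
up to multiples of `⟨-1⟩ + 1`. -/
theorem exists_lift_rho_spec {π : A} (hπ : Irreducible π) (x : RP F) :
    ∃ z : RP (ResidueField A), Res.mk (toRes A) _ (toRPt z) = rho hπ _ (spec F hK x) ∧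
      ∃ r, lambdaOne _ z = rhoAdd hπ (lambdaOne F x) + (fang _ (-1) + 1) * r := by
  induction x using RP.induction with
  | h0 => exact ⟨0, by simp [toRPt], 0, by simp⟩
  | ha x y hx hy =>
    obtain ⟨z, hz, r, hr⟩ := hx
    obtain ⟨z', hz', r', hr'⟩ := hy
    refine ⟨z + z', ?_, r + r', ?_⟩
    · rw [map_add, map_add, ← hz, ← hz', ← map_add, toRPt, toRPt, toRPt, map_add]
    · rw [map_add, map_add, map_add, hr, hr']; ring
  | h1 r a =>
    have h0 := a.1.ne_zero
    have h1 := a.ne_one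
    rw [map_smul (spec F hK), map_smul (lambdaOne F), ← fsym_coe, spec_fsym hK h0 h1,
      lambdaOne_fsym h0 h1, smul_eq_mul]
    generalize (a.1 : F) = x at *
    obtain ⟨c, hc0, hc1, -⟩ := exists_ne_zero_one hK 0
    rcases pos_cases (A := A) x with h | h | h | ⟨y, ⟨w, hw⟩, ⟨w1, hw1⟩, rfl⟩
    · refine ⟨rhoAdd hπ r • constC (toW c hc0 hc1), ?_, 0, ?_⟩
      · rw [specFun_pos h, rho_smul_iota, ← toRPt_constC (toW c hc0 hc1), toRPt, toRPt, map_smul]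
      · obtain ⟨s, hs, hs1⟩ := fang_one_sub_eq h
        have e : r * ((fang F x - 1) * (fang F (1 - x) - 1)) =
            toFrac A F (s - 1) * (r * (fang F x - 1)) := by
          rw [hs, map_sub (toFrac A F), map_one (toFrac A F)]; ring
        rw [map_smul, lambdaOne_constC, e, rhoAdd_smul, map_sub (toRes A), hs1, map_one (toRes A)]
        simp
    · refine ⟨-(rhoAdd hπ r • constC (toW c hc0 hc1)), ?_, -rhoAdd hπ (r * (1 - fang F x)), ?_⟩
      · rw [specFun_neg h0 h, smul_neg, map_neg, rho_smul_iota, ← toRPt_constC (toW c hc0 hc1),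
          toRPt, toRPt, map_neg, map_neg, map_smul]
      · obtain ⟨s, hs, hs1⟩ := fang_one_sub_eq h
        have e0 : 1 - x = -1 * x * (1 - x⁻¹) := by field_simp; ring
        have hx := fang_mul_self h0
        have em : fang F (-1) = toFrac A F (ang (-1)) := by rw [toFrac_ang]; simp
        have em' : fang (ResidueField A) (-1) = toRes A (ang (-1)) := by rw [toRes_ang]; simp
        have e : r * ((fang F x - 1) * (fang F (1 - x) - 1)) =
            toFrac A F (s - 1) * (toFrac A F (ang (-1)) * (r * (1 - fang F x))) +
              toFrac A F (ang (-1) + 1) * (r * (1 - fang F x)) := by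
          rw [e0, map_mul, map_mul, hs, map_sub (toFrac A F), map_add (toFrac A F),
            map_one (toFrac A F), em]
          generalize fang F x = x at *
          linear_combination (r * toFrac A F (ang (-1)) * toFrac A F s) * hx
        rw [map_neg, map_smul, lambdaOne_constC, e, map_add (rhoAdd hπ), rhoAdd_smul,
          rhoAdd_smul, rhoAdd_smul, map_sub (toRes A), hs1, map_one (toRes A),
          map_add (toRes A), em', map_one (toRes A)]
        simp
    · refine ⟨0, ?_, 0, ?_⟩
      · rw [specFun_one_sub_pos h]; simp [toRPt]
      · obtain ⟨s, hs, hs1⟩ := fang_one_sub_eq h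
        rw [sub_sub_cancel] at hs
        have e : r * ((fang F x - 1) * (fang F (1 - x) - 1)) =
            toFrac A F (s - 1) * (r * (fang F (1 - x) - 1)) := by
          rw [hs, map_sub (toFrac A F), map_one (toFrac A F)]; ring
        rw [e, rhoAdd_smul, map_sub (toRes A), hs1, map_one (toRes A)]
        simp
    · have hu : IsUnit y := ⟨w, hw⟩
      have hu1 : IsUnit (1 - y) := ⟨w1, hw1⟩
      refine ⟨rhoAdd hπ r • fsym (residue A y), ?_, 0, ?_⟩
      · rw [specFun_unit hu, rho_smul_iota, br, toRPt, map_smul]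
      · have e : r * ((fang F (algebraMap A F y) - 1) * (fang F (1 - algebraMap A F y) - 1)) =
            toFrac A F ((ang w - 1) * (ang w1 - 1)) * r := by
          rw [map_mul (toFrac A F), map_sub (toFrac A F), map_sub (toFrac A F), toFrac_ang,
            toFrac_ang, hw, hw1, map_one (toFrac A F), map_sub (algebraMap A F),
            map_one (algebraMap A F)]
          ring
        rw [e, rhoAdd_smul, map_smul, lambdaOne_fsym (residue_ne_zero hu) (residue_ne_one hu1),
          map_mul (toRes A), map_sub (toRes A), map_sub (toRes A), toRes_ang, toRes_ang, hw, hw1,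
          map_one (toRes A), map_sub (residue A), map_one (residue A), smul_eq_mul]
        ring

/-- The composite `ρ_π ∘ S_v` maps the kernel of `λ₁` to the kernel of the map induced by `λ₁`. -/
theorem rho_spec_mem {π : A} (hπ : Irreducible π) {x : RP F} (hx : lambdaOne F x = 0) :
    (Res.mk (toRes A) _).symm (rho hπ _ (spec F hK x)) ∈ RPtOne (ResidueField A) := by
  obtain ⟨z, hz, r, hr⟩ := exists_lift_rho_spec hK hπ x
  rw [← hz, AddEquiv.symm_apply_apply]
  rw [hx, map_zero, zero_add] at hr
  refine (Submodule.Quotient.mk_eq_zero _).2 ?_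
  have h1 := lambdaOne_mem_augIdeal z
  rw [hr] at h1 ⊢
  rw [fang_neg_one] at h1 ⊢
  refine Ideal.mul_mem_mul (Ideal.subset_span rfl) ?_
  -- the augmentation of `λ₁(z) = (⟨-1⟩ + 1) r` is zero and twice the augmentation of `r`
  have h2 : aug (ResidueField A) (ang (-1)) = 1 := aug_of _
  have h3 : aug (ResidueField A) ((ang (-1) + 1) * r) = 0 := h1
  rw [map_mul, map_add, h2, map_one] at h3
  change aug _ r = 0
  omega

variable (F) in
/-- The map `δ_π`, the restriction of `ρ_π ∘ S_v` to `ℛ𝒫₁(F)`. -/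
def delta {π : A} (hπ : Irreducible π) :
    Res (toFrac A F) (RPOne F) →ₗ[GR A] Res (toRes A) (RPtOne (ResidueField A)) where
  toFun x := Res.mk _ _ ⟨_, rho_spec_mem hK hπ ((Res.mk (toFrac A F) (RPOne F)).symm x).2⟩
  map_add' x y := congrArg (Res.mk (toRes A) (RPtOne _)) (Subtype.ext (by
    change (Res.mk (toRes A) _).symm (rho hπ _ (spec F hK (_ + _))) = _
    rw [map_add, map_add, map_add]; rfl))
  map_smul' r x := congrArg (Res.mk (toRes A) (RPtOne _)) (Subtype.ext (by
    change (Res.mk (toRes A) _).symm (rho hπ _ (spec F hK (toFrac A F r • _))) = _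
    rw [map_smul, toFrac_smul, map_smul]; rfl))

theorem delta_apply {π : A} (hπ : Irreducible π) (x : RPOne F) :
    Res.map (toRes A) _ (RPtOne (ResidueField A)).subtype
        (delta F hK hπ (Res.mk (toFrac A F) _ x)) = rho hπ _ (spec F hK x) := rfl

/-- The specialization map on the image of `ℛ𝒫(A)` is reduction to the residue field. -/
theorem spec_map (x : RP A) :
    spec F hK ((Res.mk _ _).symm (RP.map (algebraMap A F) x)) =
      iota A F _ (toRPt ((Res.mk _ _).symm (RP.map (residue A) x))) := by
  induction x using RP.induction with
  | h0 => simp [toRPt]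
  | ha x y hx hy =>
    rw [map_add, map_add, map_add, hx, hy, map_add (RP.map (residue A)), map_add, toRPt, toRPt,
      toRPt, map_add, map_add]
  | h1 r a =>
    rw [map_smul (RP.map (algebraMap A F)), map_smul (RP.map (residue A))]
    change spec F hK (toFrac A F r • (freeMap (algebraMap A F) (freeSym a.1) : RP F)) =
      iota A F _ (toRPt (toRes A r • (freeMap (residue A) (freeSym a.1) : RP _)))
    rw [freeMap_freeSym _ a.1 (W.compl a) rfl, freeMap_freeSym _ a.1 (W.compl a) rfl]
    refine ((LinearMap.map_smul (spec F hK) (toFrac A F r) (sym (unitF F a.1))).trans ?_).trans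
      (congrArg (iota A F _) (LinearMap.map_smul (KOne _).mkQ (toRes A r) (sym (red a.1))).symm)
    rw [← toFrac_smul_iota]
    congr 1
    have h0 : algebraMap A F a.1 ≠ 0 := (a.1.isUnit.map (algebraMap A F)).ne_zero
    have h1 : algebraMap A F a.1 ≠ 1 := by
      have h := ((W.compl a).isUnit.map (algebraMap A F)).ne_zero
      rw [W.coe_compl, map_sub, map_one] at h
      exact (sub_ne_zero.1 h).symm
    rw [← fsym_coe, show ((unitF F a.1 : Fˣ) : F) = algebraMap A F a.1 from rfl,
      spec_fsym hK h0 h1, specFun_unit a.1.isUnit]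
    change _ = iota A F _ (toRPt (sym (red a.1)))
    rw [← fsym_coe]; rfl

end Delta

/-! ### Symbols twisted by a sign character -/

section Sign

variable {K : Type u} [Field K] {Q : Type w} [AddCommGroup Q]

/-- A homomorphism `g` from `ℛ𝒫(K) / 𝒦⁽¹⁾` to a group without `2`-torsion on which `ℛ_K` acts
through a character `X : ℛ_K → ℤ`. -/
structure IsSignSymbol (X : GR K →+* ℤ) (g : RPt K →+ Q) : Prop where
  smul : ∀ r x, g (r • x) = X r • g x
  eq_zero : ∀ q : Q, (2 : ℤ) • q = 0 → q = 0

/-- A character takes the values `±1` at square classes. -/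
theorem sign_cases (X : GR K →+* ℤ) {x : K} (hx : x ≠ 0) :
    X (fang K x) = 1 ∨ X (fang K x) = -1 := by
  have h := congrArg X (fang_mul_self hx)
  rw [map_mul X, map_one X] at h
  exact mul_self_eq_one_iff.1 h

namespace IsSignSymbol

variable {X : GR K →+* ℤ} {g : RPt K →+ Q} (H : IsSignSymbol X g)
include H

theorem five {a b : K} (ha0 : a ≠ 0) (ha1 : a ≠ 1) (hb0 : b ≠ 0) (hb1 : b ≠ 1) (hab : a ≠ b) :
    g (br a) - g (br b) + X (fang K a) • g (br (b / a))
      - (X (fang K a) * X (fang K (1 - a))) • g (br (b / a * ((1 - a) / (1 - b))))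
      + X (fang K (1 - a)) • g (br ((1 - a) / (1 - b))) = 0 := by
  have h := congrArg g (br_five ha0 ha1 hb0 hb1 hab)
  rwa [map_add g, map_sub g, map_add g, map_sub g, H.smul, H.smul, H.smul, map_mul X,
    map_zero g] at h

theorem inv (x : K) : g (br x⁻¹) = -(X (fang K (-1)) • g (br x)) := by
  rw [br_inv, map_neg g, H.smul]

theorem add {a : K} (ha0 : a ≠ 0) (ha1 : a ≠ 1) :
    g (br a) + X (fang K (-1)) • g (br (1 - a)) = g (tC K) := by
  rw [← br_add ha0 ha1, map_add g, H.smul]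

section Odd

variable (hK : ∀ s : Finset K, s.card ≤ 7 → ∃ x, x ∉ s) (he : X (fang K (-1)) = -1)
include hK he

/-- If the character is `-1` at `-1`, then a symbol `[a]` vanishes unless the character is `-1` at
`a` and at `1 - a`. -/
theorem odd_eq_zero {a : K} (ha0 : a ≠ 0) (ha1 : a ≠ 1)
    (h : X (fang K a) = 1 ∨ X (fang K (1 - a)) = 1) : g (br a) = 0 := by
  have hC : g (tC K) = 0 := by
    have h := congrArg g (neg_one_smul_tC (K := K))
    rw [H.smul, he, neg_one_zsmul] at h
    refine H.eq_zero _ ?_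
    rw [two_zsmul]
    nth_rw 1 [← h]
    exact neg_add_cancel _
  rcases h with h | h
  · have := congrArg g (br_smul hK ha0 ha1)
    rw [H.smul, H.smul, hC, smul_zero, map_sub X, map_mul X, map_one X, he, h] at this
    exact H.eq_zero _ (by simpa using this)
  · have := congrArg g (br_smul_one_sub hK ha0 ha1)
    rw [H.smul, H.smul, hC, smul_zero, map_sub X, map_mul X, map_one X, he, h] at this
    exact H.eq_zero _ (by simpa using this)

/-- If the character is `-1` at `-1`, then the five term relation shows that the symbols `[a]` that
are not forced to vanish are all equal, to `t` say. For all `a` then `4[a]` is `t` times the value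
of the character at `λ₁([a])`. -/
theorem odd_exists : ∃ t : Q, ∀ a : K, a ≠ 0 → a ≠ 1 →
    (4 : ℤ) • g (br a) = ((X (fang K a) - 1) * (X (fang K (1 - a)) - 1)) • t := by
  by_cases hex : ∃ b : K, b ≠ 0 ∧ b ≠ 1 ∧ X (fang K b) = -1 ∧ X (fang K (1 - b)) = -1
  · obtain ⟨b, hb0, hb1, hb, hb'⟩ := hex
    refine ⟨g (br b), fun a ha0 ha1 => ?_⟩
    have ha1' := sub_ne_zero.2 ha1.symm
    have hb1' := sub_ne_zero.2 hb1.symm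
    rcases sign_cases X ha0 with h | h
    · rw [H.odd_eq_zero hK he ha0 ha1 (Or.inl h), h]; simp
    rcases sign_cases X ha1' with h' | h'
    · rw [H.odd_eq_zero hK he ha0 ha1 (Or.inr h'), h']; simp
    by_cases hab : a = b
    · rw [hab, hb, hb']; norm_num
    -- in the relation for `a, b`, all symbols but `[a]` and `[b]` vanish
    have h5 := H.five ha0 ha1 hb0 hb1 hab
    have key : ∀ c d : K, c ≠ 0 → d ≠ 0 → X (fang K c) = X (fang K d) → g (br (c / d)) = 0 := by
      intro c d hc hd hcd
      by_cases h1 : c / d = 1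
      · rw [h1, br_one, map_zero]
      refine H.odd_eq_zero hK he (div_ne_zero hc hd) h1 (Or.inl ?_)
      rw [fang_div, map_mul X, hcd, ← map_mul X, fang_mul_self hd, map_one X]
    rw [div_mul_div_comm, key b a hb0 ha0 (hb.trans h.symm), key _ _ ha1' hb1' (h'.trans hb'.symm),
      key _ _ (mul_ne_zero hb0 ha1') (mul_ne_zero ha0 hb1')
        (by rw [map_mul (fang K), map_mul (fang K), map_mul X, map_mul X, hb, hb', h, h'])] at h5
    simp only [smul_zero, add_zero, sub_zero] at h5
    rw [sub_eq_zero.1 h5, h, h']; norm_num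
  · refine ⟨0, fun a ha0 ha1 => ?_⟩
    rw [smul_zero, H.odd_eq_zero hK he ha0 ha1, smul_zero]
    by_contra hcon
    push Not at hcon
    exact hex ⟨a, ha0, ha1, (sign_cases X ha0).resolve_left hcon.1,
      (sign_cases X (sub_ne_zero.2 ha1.symm)).resolve_left hcon.2⟩

/-- If the character is `-1` at `-1`, then the image of an element of `ℛ𝒫(K)` is determined by
`λ₁`. -/
theorem odd_toRPt {x : RP K} (hx : lambdaOne K x = 0) : g (toRPt x) = 0 := by
  obtain ⟨t, ht⟩ := H.odd_exists hK he
  have key : ∀ x, (4 : ℤ) • g (toRPt x) = X (lambdaOne K x) • t := by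
    intro x
    induction x using RP.induction with
    | h0 => simp [toRPt]
    | ha x y hx hy =>
      rw [toRPt, map_add, map_add g, smul_add, hx, hy, map_add, map_add X, add_smul]
    | h1 r a =>
      rw [toRPt, map_smul, H.smul, map_smul, smul_eq_mul, map_mul X, mul_smul, ← fsym_coe,
        lambdaOne_fsym a.1.ne_zero a.ne_one, map_mul X, map_sub X, map_sub X, map_one X,
        ← ht _ a.1.ne_zero a.ne_one, smul_comm]
      rfl
  have h := key x
  rw [hx, map_zero, zero_smul, show (4 : ℤ) = 2 * 2 from rfl, mul_smul] at h
  exact H.eq_zero _ (H.eq_zero _ h)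

end Odd

section Even

variable (hK : ∀ s : Finset K, s.card ≤ 7 → ∃ x, x ∉ s) (he : X (fang K (-1)) = 1)

section
include he

theorem even_inv (x : K) : g (br x⁻¹) = -g (br x) := by rw [H.inv, he, one_smul]

theorem even_one_sub {a : K} (ha0 : a ≠ 0) (ha1 : a ≠ 1) :
    g (br (1 - a)) = g (tC K) - g (br a) := by
  rw [← H.add ha0 ha1, he, one_smul, add_sub_cancel_left]

omit H in
theorem sign_sub_comm (a b : K) : X (fang K (a - b)) = X (fang K (b - a)) := by
  rw [← neg_sub, ← neg_one_mul, map_mul, map_mul X, he, one_mul]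

omit H in
/-- If the character is `-1` at `b`, then it takes different values at `1 - b` and `1 - b⁻¹`. -/
theorem sign_one_sub_inv {b : K} (hb0 : b ≠ 0) :
    X (fang K (1 - b⁻¹)) = X (fang K (1 - b)) * X (fang K b) := by
  have : 1 - b⁻¹ = (b - 1) / b := by field_simp
  rw [this, fang_div, map_mul X, sign_sub_comm he]

end

include hK he

/-- If the character is `1` at `-1` and `-1` at `a`, then `[a]` is `C` or `-C`, by `br_smul`. -/
theorem even_neg {a : K} (ha0 : a ≠ 0) (ha1 : a ≠ 1) (h : X (fang K a) = -1) :
    g (br a) = X (fang K (1 - a)) • g (tC K) := by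
  have := congrArg g (br_smul hK ha0 ha1)
  rw [H.smul, H.smul, map_sub X, map_mul X, map_mul X, map_sub X, map_one X, he, h, one_mul,
    sub_neg_eq_add, mul_comm, mul_smul, one_add_one_eq_two] at this
  refine sub_eq_zero.1 (H.eq_zero _ ?_)
  rw [smul_sub, this, sub_self]

theorem even_neg_pos {a : K} (ha0 : a ≠ 0) (ha1 : a ≠ 1) (h : X (fang K a) = -1)
    (h' : X (fang K (1 - a)) = 1) : g (br a) = g (tC K) := by
  rw [H.even_neg hK he ha0 ha1 h, h', one_smul]

theorem even_neg_neg {a : K} (ha0 : a ≠ 0) (ha1 : a ≠ 1) (h : X (fang K a) = -1)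
    (h' : X (fang K (1 - a)) = -1) : g (br a) = -g (tC K) := by
  rw [H.even_neg hK he ha0 ha1 h, h', neg_one_smul]

theorem even_pos_neg {a : K} (ha0 : a ≠ 0) (ha1 : a ≠ 1) (h : X (fang K a) = 1)
    (h' : X (fang K (1 - a)) = -1) : g (br a) = 0 := by
  have := H.even_neg_pos hK he (a := 1 - a) (sub_ne_zero.2 ha1.symm) (by simpa using ha0) h'
    (by rwa [sub_sub_cancel])
  rw [H.even_one_sub he ha0 ha1] at this
  simpa using this

section Relations

variable {a b : K} (ha0 : a ≠ 0) (ha1 : a ≠ 1) (hb0 : b ≠ 0) (hb1 : b ≠ 1) (hab : a ≠ b)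
  (ha : X (fang K a) = 1) (ha' : X (fang K (1 - a)) = 1)

omit H hK he in
include ha0 ha1 hb0 hb1 hab in
/-- The arguments of the five term relation are different from `0` and `1`, and the complements to
`1` factor. -/
theorem fiveTerm_args : b / a ≠ 0 ∧ b / a ≠ 1 ∧
    b / a * ((1 - a) / (1 - b)) ≠ 0 ∧ b / a * ((1 - a) / (1 - b)) ≠ 1 ∧
    (1 - a) / (1 - b) ≠ 0 ∧ (1 - a) / (1 - b) ≠ 1 ∧
    1 - b / a = (a - b) / a ∧ 1 - b / a * ((1 - a) / (1 - b)) = (a - b) / (a * (1 - b)) ∧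
    1 - (1 - a) / (1 - b) = (a - b) / (1 - b) := by
  have ha1' := sub_ne_zero.2 ha1.symm
  have hb1' := sub_ne_zero.2 hb1.symm
  have hab' := sub_ne_zero.2 hab
  have e1 : 1 - b / a = (a - b) / a := by field_simp
  have e2 : 1 - b / a * ((1 - a) / (1 - b)) = (a - b) / (a * (1 - b)) := by field_simp; ring
  have e3 : 1 - (1 - a) / (1 - b) = (a - b) / (1 - b) := by field_simp; ring
  refine ⟨div_ne_zero hb0 ha0, ?_, mul_ne_zero (div_ne_zero hb0 ha0) (div_ne_zero ha1' hb1'), ?_,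
    div_ne_zero ha1' hb1', ?_, e1, e2, e3⟩
  · exact (sub_ne_zero.1 (e1 ▸ div_ne_zero hab' ha0)).symm
  · exact (sub_ne_zero.1 (e2 ▸ div_ne_zero hab' (mul_ne_zero ha0 hb1'))).symm
  · exact (sub_ne_zero.1 (e3 ▸ div_ne_zero hab' hb1')).symm

include ha0 ha1 hb0 hb1 hab ha ha'

omit hK he in
/-- The five term relation if the character is `1` at `a` and at `1 - a`. In the lemmas that follow,
the values of the character at `b`, `1 - b` and `a - b` are such that the symbols other than `[a]`
are determined by `even_neg` and `even_pos_neg`. -/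
theorem even_five : g (br a) - g (br b) + g (br (b / a)) - g (br (b / a * ((1 - a) / (1 - b))))
    + g (br ((1 - a) / (1 - b))) = 0 := by
  have h := H.five ha0 ha1 hb0 hb1 hab
  rwa [ha, ha', mul_one, one_smul, one_smul, one_smul] at h

theorem even_eq_zero (hb : X (fang K b) = 1) (hb' : X (fang K (1 - b)) = -1)
    (h : X (fang K (a - b)) = -1) : g (br a) = 0 := by
  obtain ⟨h1, h2, h3, h4, h5, h6, e1, e2, e3⟩ := fiveTerm_args ha0 ha1 hb0 hb1 hab
  have h7 := H.even_five ha0 ha1 hb0 hb1 hab ha ha'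
  rw [H.even_pos_neg hK he hb0 hb1 hb hb', H.even_pos_neg hK he h1 h2, H.even_neg_pos hK he h3 h4,
    H.even_neg_pos hK he h5 h6] at h7
  · simpa using h7
  all_goals (try rw [e1]); (try rw [e2]); (try rw [e3])
  all_goals simp only [fang_div, map_mul, ha, ha', hb, hb', h]; norm_num

theorem even_eq_C (hb : X (fang K b) = -1) (hb' : X (fang K (1 - b)) = 1)
    (h : X (fang K (a - b)) = -1) : g (br a) = g (tC K) := by
  obtain ⟨h1, h2, h3, h4, h5, h6, e1, e2, e3⟩ := fiveTerm_args ha0 ha1 hb0 hb1 hab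
  have h7 := H.even_five ha0 ha1 hb0 hb1 hab ha ha'
  rw [H.even_neg_pos hK he hb0 hb1 hb hb', H.even_neg_neg hK he h1 h2, H.even_neg_neg hK he h3 h4,
    H.even_pos_neg hK he h5 h6] at h7
  · refine sub_eq_zero.1 (Eq.trans ?_ h7); abel
  all_goals (try rw [e1]); (try rw [e2]); (try rw [e3])
  all_goals simp only [fang_div, map_mul, ha, ha', hb, hb', h]; norm_num

theorem even_eq_neg_C (hb : X (fang K b) = -1) (hb' : X (fang K (1 - b)) = -1)
    (h : X (fang K (a - b)) = 1) : g (br a) = -g (tC K) := by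
  obtain ⟨h1, h2, h3, h4, h5, h6, e1, e2, e3⟩ := fiveTerm_args ha0 ha1 hb0 hb1 hab
  have h7 := H.even_five ha0 ha1 hb0 hb1 hab ha ha'
  rw [H.even_neg_neg hK he hb0 hb1 hb hb', H.even_neg_pos hK he h1 h2, H.even_pos_neg hK he h3 h4,
    H.even_neg_neg hK he h5 h6] at h7
  · refine sub_eq_zero.1 (Eq.trans ?_ h7); abel
  all_goals (try rw [e1]); (try rw [e2]); (try rw [e3])
  all_goals simp only [fang_div, map_mul, ha, ha', hb, hb', h]; norm_num

/-- Here the symbol at `(1 - a) / (1 - b)` is not determined, and `[a]` is equal to the symbol at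
the complement `(a - b) / (1 - b)`. -/
theorem even_eq_div (hb : X (fang K b) = -1) (hb' : X (fang K (1 - b)) = 1)
    (h : X (fang K (a - b)) = 1) : g (br a) = g (br ((a - b) / (1 - b))) := by
  obtain ⟨h1, h2, h3, h4, h5, h6, e1, e2, e3⟩ := fiveTerm_args ha0 ha1 hb0 hb1 hab
  have h7 := H.even_five ha0 ha1 hb0 hb1 hab ha ha'
  rw [H.even_neg_pos hK he hb0 hb1 hb hb', H.even_neg_pos hK he h1 h2, H.even_neg_pos hK he h3 h4]
    at h7
  · rw [← e3, H.even_one_sub he h5 h6]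
    refine sub_eq_zero.1 (Eq.trans ?_ h7); abel
  all_goals (try rw [e1]); (try rw [e2])
  all_goals simp only [fang_div, map_mul, ha, ha', hb, hb', h]; norm_num

end Relations

end Even

end IsSignSymbol

end Sign

/-! ### Characters of the group ring and prime ideals -/

section Characters

variable {B : Type u} [CommRing B]

/-- The ring homomorphism `ℛ_B → ℤ` given by a sign character of `Bˣ`. -/
def charHom (φ : Bˣ →* ℤˣ) : GR B →+* ℤ :=
  (MonoidAlgebra.lift ℤ ℤ (SqClass B) (QuotientGroup.lift _ ((Units.coeHom ℤ).comp φ) (by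
    rintro _ ⟨y, rfl⟩
    simp [Int.units_sq]))).toRingHom.comp (GR.equiv B).toRingHom

theorem charHom_ang (φ : Bˣ →* ℤˣ) (u : Bˣ) : charHom φ (ang u) = φ u :=
  (MonoidAlgebra.lift_of (R := ℤ) _ _).trans rfl

/-- A prime ideal of `ℛ_B` that does not contain `2` determines a sign character through which `ℛ_B`
acts on all modules localized at the prime ideal. -/
theorem exists_charHom (p : Ideal (GR B)) [hp : p.IsPrime] (h2 : (2 : GR B) ∉ p) :
    ∃ φ : Bˣ →* ℤˣ, ∀ r : GR B, ∃ s ∉ p, s * (r - (charHom φ r : GR B)) = 0 := by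
  classical
  have hsq : ∀ u : Bˣ, (ang u - 1) * (ang u + 1) = 0 := fun u => by
    linear_combination ang_sq u
  have hor : ∀ u : Bˣ, ang u - 1 ∈ p ∨ ang u + 1 ∈ p := fun u =>
    hp.mem_or_mem (by rw [hsq]; exact zero_mem _)
  have hnot : ∀ u : Bˣ, ang u - 1 ∈ p → ang u + 1 ∉ p := fun u h h' => h2 (by
    have := sub_mem h' h
    rwa [show ang u + 1 - (ang u - 1) = 2 by ring] at this)
  let f : Bˣ → ℤˣ := fun u => if ang u - 1 ∈ p then 1 else -1
  have hf : ∀ u, ang u - ((f u : ℤ) : GR B) ∈ p := fun u => by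
    by_cases h : ang u - 1 ∈ p
    · simp [f, h]
    · simpa [f, h] using (hor u).resolve_left h
  have huniq : ∀ (u : Bˣ) (e : ℤˣ), ang u - ((e : ℤ) : GR B) ∈ p → f u = e := fun u e he => by
    have h := sub_mem he (hf u)
    rcases Int.units_eq_one_or e with rfl | rfl <;>
      rcases Int.units_eq_one_or (f u) with h' | h' <;> rw [h'] at h ⊢
    · exact absurd (by
        have := neg_mem h
        rwa [show -(ang u - (((1 : ℤˣ) : ℤ) : GR B) - (ang u - (((-1 : ℤˣ) : ℤ) : GR B))) = 2 by
          push_cast; ring] at this) h2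
    · exact absurd (by
        rwa [show (ang u - (((-1 : ℤˣ) : ℤ) : GR B) - (ang u - (((1 : ℤˣ) : ℤ) : GR B))) = 2 by
          push_cast; ring] at h) h2
  let φ : Bˣ →* ℤˣ :=
    { toFun := f
      map_one' := huniq _ _ (by rw [show ang (1 : Bˣ) = 1 from map_one _]; simp)
      map_mul' := fun u v => huniq _ _ (by
        have h := add_mem (p.mul_mem_left (ang u) (hf v))
          (p.mul_mem_right (((f v : ℤ) : GR B)) (hf u))
        rw [show ang (u * v) = ang u * ang v from map_mul _ _ _]
        rwa [show ang u * (ang v - ((f v : ℤ) : GR B)) + (ang u - ((f u : ℤ) : GR B)) *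
          ((f v : ℤ) : GR B) = ang u * ang v - (((f u * f v : ℤˣ) : ℤ) : GR B) by
            push_cast; ring] at h) }
  refine ⟨φ, fun r => ?_⟩
  induction r using GR.induction with
  | h0 => exact ⟨1, fun h => hp.ne_top ((Ideal.eq_top_iff_one _).2 h), by simp⟩
  | h1 u =>
    refine ⟨ang u + ((f u : ℤ) : GR B), fun h => ?_, ?_⟩
    · have h' := sub_mem h (hf u)
      rw [show ang u + ((f u : ℤ) : GR B) - (ang u - ((f u : ℤ) : GR B)) =
        ((f u : ℤ) : GR B) * 2 by ring] at h'
      rcases Int.units_eq_one_or (f u) with e | e <;> rw [e] at h'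
      · exact h2 (by simpa using h')
      · exact h2 (by simpa using h')
    · rw [charHom_ang]
      change (ang u + ((f u : ℤ) : GR B)) * (ang u - ((f u : ℤ) : GR B)) = 0
      have e : ((f u : ℤ) : GR B) * ((f u : ℤ) : GR B) = 1 := by
        rw [← Int.cast_mul, ← Units.val_mul, Int.units_mul_self]; simp
      linear_combination ang_sq u - e
  | ha x y hx hy =>
    obtain ⟨s, hs, h⟩ := hx
    obtain ⟨s', hs', h'⟩ := hy
    refine ⟨s * s', fun hm => (hp.mem_or_mem hm).elim hs hs', ?_⟩
    rw [map_add, Int.cast_add]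
    linear_combination s' * h + s * h'
  | hn x hx =>
    obtain ⟨s, hs, h⟩ := hx
    refine ⟨s, hs, ?_⟩
    rw [map_neg, Int.cast_neg]
    linear_combination -h

/-- A membership in a submodule can be checked locally at the prime ideals that do not contain `2`,
up to multiplication by a power of `2`. -/
theorem exists_two_pow_smul_mem {R M : Type*} [CommRing R] [AddCommGroup M] [Module R M]
    (N : Submodule R M) (x : M)
    (h : ∀ p : Ideal R, p.IsPrime → (2 : R) ∉ p → ∃ s ∉ p, s • x ∈ N) :
    ∃ n : ℕ, (2 ^ n : ℤ) • x ∈ N := by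
  by_contra hcon
  push Not at hcon
  let I : Ideal R := N.comap (LinearMap.toSpanSingleton R M x)
  have hI : ∀ s, s ∈ I ↔ s • x ∈ N := fun s => by
    rw [Submodule.mem_comap, LinearMap.toSpanSingleton_apply]
  have hd : Disjoint (I : Set R) (Submonoid.powers (2 : R) : Set R) := by
    rw [Set.disjoint_left]
    rintro _ hs ⟨n, rfl⟩
    refine hcon n ?_
    have := (hI _).1 hs
    rwa [← Int.cast_smul_eq_zsmul R, Int.cast_pow, Int.cast_ofNat]
  obtain ⟨p, hp, hIp, hpd⟩ := Ideal.exists_le_prime_disjoint I _ hd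
  obtain ⟨s, hs, hsx⟩ := h p hp fun h2 => Set.disjoint_left.1 hpd h2 ⟨1, pow_one 2⟩
  exact hs (hIp ((hI s).2 hsx))

end Characters

/-! ### Extension of characters to the field of fractions -/

section Extension

open IsLocalRing

variable {A : Type u} [CommRing A] [IsDomain A] [IsDiscreteValuationRing A]
  {F : Type v} [Field F] [Algebra A F] [IsFractionRing A F]
  {π : A} (hπ : Irreducible π) (φ : Aˣ →* ℤˣ) (σ : ℤˣ)

/-- The function `u π ^ n ↦ φ(u) σ ^ n` on `Fˣ`. -/
def extFun (x : Fˣ) : ℤˣ :=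
  φ (exists_unit_zpow hπ x).choose_spec.choose * σ ^ (exists_unit_zpow hπ x).choose

theorem extFun_apply (u : Aˣ) (n : ℤ) :
    extFun hπ φ σ (unitF F u * unifF F hπ ^ n) = φ u * σ ^ n := by
  obtain ⟨h1, h2⟩ := unit_zpow_inj hπ
    (exists_unit_zpow hπ (unitF F u * unifF F hπ ^ n)).choose_spec.choose_spec
  exact congrArg₂ (fun (a : Aˣ) (b : ℤ) => φ a * σ ^ b) h2.symm h1.symm

variable (F) in
/-- The character `u π ^ n ↦ φ(u) σ ^ n` of `Fˣ`. -/
def extChar : Fˣ →* ℤˣ where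
  toFun := extFun hπ φ σ
  map_one' := by
    have := extFun_apply (F := F) hπ φ σ 1 0
    rwa [map_one, map_one, zpow_zero, zpow_zero, mul_one, mul_one] at this
  map_mul' x y := by
    obtain ⟨n, u, rfl⟩ := exists_unit_zpow hπ x
    obtain ⟨m, w, rfl⟩ := exists_unit_zpow hπ y
    rw [mul_mul_mul_comm, ← map_mul, ← zpow_add, extFun_apply, extFun_apply, extFun_apply, map_mul,
      zpow_add, mul_mul_mul_comm]

variable (F) in
/-- The ring homomorphism `ℛ_F → ℤ` given by the character `u π ^ n ↦ φ(u) σ ^ n`. -/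
def extHom : GR F →+* ℤ := charHom (extChar F hπ φ σ)

theorem extHom_ang (u : Aˣ) (n : ℤ) :
    extHom F hπ φ σ (ang (unitF F u * unifF F hπ ^ n)) = (φ u * σ ^ n : ℤˣ) := by
  rw [extHom, charHom_ang]
  exact congrArg _ (extFun_apply hπ φ σ u n)

theorem extHom_unit (u : Aˣ) : extHom F hπ φ σ (fang F (algebraMap A F u)) = φ u := by
  have := extHom_ang (F := F) hπ φ σ u 0
  rw [zpow_zero, mul_one, zpow_zero, mul_one] at this
  rw [← this, ← fang_coe]; rfl

theorem extHom_unif : extHom F hπ φ σ (fang F (algebraMap A F π)) = σ := by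
  have := extHom_ang (F := F) hπ φ σ 1 1
  rw [zpow_one, map_one, one_mul, zpow_one, map_one, one_mul] at this
  rw [← this, ← fang_coe]; rfl

theorem extHom_toFrac (r : GR A) : extHom F hπ φ σ (toFrac A F r) = charHom φ r := by
  induction r using GR.induction with
  | h0 => simp
  | h1 u => rw [toFrac_ang, extHom_unit, charHom_ang]
  | ha x y hx hy => rw [map_add, map_add, map_add, hx, hy]
  | hn x hx => rw [map_neg, map_neg, map_neg, hx]

variable (F) in
/-- The elements of `ℛ𝒫(F) / 𝒦⁽¹⁾` that vanish, after localization at a prime ideal `p` of `ℛ_A`, in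
the eigenspace of `⟨π⟩` for the eigenvalue `σ`. -/
def eigenKer (p : Ideal (GR A)) [hp : p.IsPrime] (π : A) (σ : ℤˣ) : Submodule (GR F) (RPt F) where
  carrier := {x | ∃ s ∉ p, (toFrac A F s * (1 + (σ : ℤ) * fang F (algebraMap A F π))) • x = 0}
  zero_mem' := ⟨1, fun h => hp.ne_top ((Ideal.eq_top_iff_one _).2 h), smul_zero _⟩
  add_mem' := by
    rintro x y ⟨s, hs, h⟩ ⟨s', hs', h'⟩
    refine ⟨s * s', fun hm => (hp.mem_or_mem hm).elim hs hs', ?_⟩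
    rw [map_mul, smul_add]
    nth_rw 1 [mul_comm (toFrac A F s)]
    rw [mul_assoc, mul_smul, h, smul_zero, mul_assoc, mul_smul, h', smul_zero, add_zero]
  smul_mem' := by
    rintro r x ⟨s, hs, h⟩
    exact ⟨s, hs, by rw [smul_comm, h, smul_zero]⟩

variable {φ} {p : Ideal (GR A)} [hp : p.IsPrime] (h2 : (2 : GR A) ∉ p)
  (hφ : ∀ r : GR A, ∃ s ∉ p, s * (r - (charHom φ r : GR A)) = 0)

include h2 hφ in
/-- An element at which the character is `-2` is invertible in the localization. -/
theorem notMem_of_charHom {r : GR A} (h : charHom φ r = -2) : r ∉ p := by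
  intro hr
  obtain ⟨s, hs, h'⟩ := hφ r
  have : s * (r - (charHom φ r : GR A)) ∈ p := h' ▸ zero_mem _
  have := sub_mem ((hp.mem_or_mem this).resolve_left hs) hr
  rw [h] at this
  exact h2 (by simpa using this)

include h2 hφ in
/-- On the image of `ℛ𝒫(F) / 𝒦⁽¹⁾` in the eigenspace for `σ` of the localization, `ℛ_F` acts through
the extension of `φ` by `π ↦ σ`. -/
theorem isSignSymbol_eigenKer :
    IsSignSymbol (extHom F hπ φ σ)
      ((eigenKer F p π σ).mkQ : RPt F →+ RPt F ⧸ eigenKer F p π σ) where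
  eq_zero q hq := by
    obtain ⟨x, rfl⟩ := Submodule.mkQ_surjective _ q
    rw [← map_zsmul, Submodule.mkQ_apply, Submodule.Quotient.mk_eq_zero] at hq
    obtain ⟨s, hs, h⟩ := hq
    refine (Submodule.Quotient.mk_eq_zero _).2 ⟨2 * s, fun hm => (hp.mem_or_mem hm).elim h2 hs, ?_⟩
    rw [map_mul, mul_assoc, mul_smul, smul_comm, map_ofNat]
    rw [← Int.cast_smul_eq_zsmul (GR F)] at h
    exact_mod_cast h
  smul r x := by
    have hσ : ((σ : ℤ) : GR F) * ((σ : ℤ) : GR F) = 1 := by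
      rw [← Int.cast_mul, ← Units.val_mul, Int.units_mul_self]; simp
    have hP : fang F (algebraMap A F π) * fang F (algebraMap A F π) = 1 :=
      fang_mul_self (by simpa using hπ.ne_zero)
    -- the square classes that act as claimed; `Fˣ` is generated by the units of `A` and `π`
    let T : Subgroup Fˣ :=
      { carrier := {a | ∀ x : RPt F,
          (ang a - ((extHom F hπ φ σ (ang a) : ℤ) : GR F)) • x ∈ eigenKer F p π σ}
        one_mem' := fun x => by
          rw [show ang (1 : Fˣ) = 1 from map_one _, map_one]
          simp
        mul_mem' := fun {a b} ha hb x => by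
          have h := add_mem (ha (ang b • x)) (hb ((extHom F hπ φ σ (ang a) : GR F) • x))
          rw [smul_smul, smul_smul, ← add_smul] at h
          rw [show ang (a * b) = ang a * ang b from map_mul _ _ _, map_mul]
          convert h using 2
          push_cast
          ring
        inv_mem' := fun {a} ha x => by
          rw [show ang a⁻¹ = ang a from ang_inv a]; exact ha x }
    have hT : ∀ a : Fˣ, a ∈ T := by
      intro a
      obtain ⟨n, u, rfl⟩ := exists_unit_zpow hπ a
      refine mul_mem (fun x => ?_) (zpow_mem (fun x => ?_) n)
      · obtain ⟨s, hs, h⟩ := hφ (ang u)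
        refine ⟨s, hs, ?_⟩
        have e : ang (unitF F u) = toFrac A F (ang u) := (mapGR_ang _ _).symm
        have h' := congrArg (toFrac A F) h
        rw [map_mul, map_sub, map_intCast, map_zero] at h'
        rw [smul_smul, e, extHom_toFrac, mul_right_comm, h', zero_mul, zero_smul]
      · refine ⟨1, fun h => hp.ne_top ((Ideal.eq_top_iff_one _).2 h), ?_⟩
        have e : ang (unifF F hπ) = fang F (algebraMap A F π) := (fang_coe _).symm
        rw [smul_smul, e, extHom_unif, map_one, one_mul]
        have : (1 + ((σ : ℤ) : GR F) * fang F (algebraMap A F π)) *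
            (fang F (algebraMap A F π) - ((σ : ℤ) : GR F)) = 0 := by
          linear_combination ((σ : ℤ) : GR F) * hP - fang F (algebraMap A F π) * hσ
        rw [this, zero_smul]
    have key : ∀ r : GR F, ((r - ((extHom F hπ φ σ r : ℤ) : GR F)) • x) ∈ eigenKer F p π σ := by
      intro r
      induction r using GR.induction with
      | h0 => simp
      | h1 a => exact hT a x
      | ha r s hr hs =>
        have := add_mem hr hs
        rw [← add_smul] at this
        convert this using 2
        rw [map_add]; push_cast; ring
      | hn r hr =>
        have := neg_mem hr
        rw [← neg_smul] at this
        convert this using 2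
        rw [map_neg]; push_cast; ring
    have := (Submodule.Quotient.mk_eq_zero _).2 (key r)
    rw [sub_smul, Int.cast_smul_eq_zsmul, Submodule.Quotient.mk_sub, sub_eq_zero] at this
    exact this

include h2 in
/-- An element that vanishes in both eigenspaces vanishes in the localization. -/
theorem exists_toFrac_smul_eq_zero {x : RPt F} (h1 : (eigenKer F p π 1).mkQ x = 0)
    (h1' : (eigenKer F p π (-1)).mkQ x = 0) : ∃ s ∉ p, toFrac A F s • x = 0 := by
  obtain ⟨s, hs, h⟩ := (Submodule.Quotient.mk_eq_zero _).1 h1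
  obtain ⟨s', hs', h'⟩ := (Submodule.Quotient.mk_eq_zero _).1 h1'
  refine ⟨2 * (s * s'), fun hm => (hp.mem_or_mem hm).elim h2
    fun hm => (hp.mem_or_mem hm).elim hs hs', ?_⟩
  have e : toFrac A F (2 * (s * s')) =
      toFrac A F s' * (toFrac A F s * (1 + (((1 : ℤˣ) : ℤ) : GR F) * fang F (algebraMap A F π))) +
      toFrac A F s *
        (toFrac A F s' * (1 + (((-1 : ℤˣ) : ℤ) : GR F) * fang F (algebraMap A F π))) := by
    rw [map_mul, map_mul, map_ofNat]; push_cast; ring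
  rw [e, add_smul, mul_smul, h, mul_smul (toFrac A F s), h', smul_zero, smul_zero, add_zero]

end Extension

/-! ### Sign characters on a discretely valued field -/

section Valued

open IsLocalRing

variable {A : Type u} [CommRing A] [IsDomain A] [IsDiscreteValuationRing A]
  {F : Type v} [Field F] [Algebra A F] [IsFractionRing A F]

theorem exists_residue_eq {c : ResidueField A} (hc : c ≠ 0) : ∃ u : Aˣ, residue A u = c := by
  obtain ⟨y, rfl⟩ := residue_surjective c
  exact ⟨((residue_ne_zero_iff_isUnit y).1 hc).unit, rfl⟩

theorem isUnit_one_sub_of_residue {y : A} (hy : residue A y ≠ 1) : IsUnit (1 - y) := by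
  refine (residue_ne_zero_iff_isUnit _).1 ?_
  rw [map_sub, map_one]
  exact sub_ne_zero.2 hy.symm

theorem coe_unit_ne_zero (u : Aˣ) : algebraMap A F u ≠ 0 := (u.isUnit.map (algebraMap A F)).ne_zero

theorem coe_W_ne_one (u : W A) : algebraMap A F u.1 ≠ 1 := by
  have h := ((W.compl u).isUnit.map (algebraMap A F)).ne_zero
  rw [W.coe_compl, map_sub, map_one] at h
  exact (sub_ne_zero.1 h).symm

theorem algebraMap_unit_inv (u : Aˣ) : algebraMap A F (u⁻¹ : Aˣ) = (algebraMap A F u)⁻¹ :=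
  (congrArg Units.val (map_inv (unitF F) u)).trans (Units.val_inv_eq_inv_val _)

variable (A F) in
include A in
theorem infinite_fractionRing : Infinite F := by
  obtain ⟨π, hπ⟩ := IsDiscreteValuationRing.exists_irreducible A
  refine Infinite.of_injective (fun n : ℕ => ((unifF F hπ ^ n : Fˣ) : F)) fun m n h => ?_
  have h' := unit_zpow_inj (F := F) hπ (u := 1) (w := 1) (m := m) (n := n) (by
    rw [zpow_natCast, zpow_natCast, Units.ext h])
  exact_mod_cast h'.1

variable (A F) in
include A in
/-- The field `F` is infinite, so it satisfies the condition on the size of the residue field. -/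
theorem exists_notMem_fractionRing (s : Finset F) (_ : s.card ≤ 7) : ∃ x, x ∉ s :=
  have := infinite_fractionRing A F
  Infinite.exists_notMem_finset s

variable {π : A} {hπ : Irreducible π} {φ : Aˣ →* ℤˣ} {σ : ℤˣ}

theorem extHom_neg_one : extHom F hπ φ σ (fang F (-1)) = φ (-1) := by
  rw [← extHom_unit (F := F) hπ φ σ (-1), Units.val_neg, Units.val_one, map_neg (algebraMap A F),
    map_one (algebraMap A F)]

theorem extHom_one_sub (u : W A) :
    extHom F hπ φ σ (fang F (1 - algebraMap A F u.1)) = φ (W.compl u) := by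
  rw [← extHom_unit (F := F) hπ φ σ (W.compl u), W.coe_compl, map_sub (algebraMap A F),
    map_one (algebraMap A F)]

/-- A unit `b` with `φ(b) = -1` can be chosen with `φ(1 - b)` prescribed. -/
theorem exists_W_sign (he : φ (-1) = 1) {b : W A} (hb : φ b.1 = -1) (e : ℤˣ) :
    ∃ b : W A, φ b.1 = -1 ∧ φ (W.compl b) = e := by
  by_cases h : φ (W.compl b) = e
  · exact ⟨b, hb, h⟩
  · refine ⟨W.inv b, by rw [W.inv, map_inv, hb, inv_neg, inv_one], ?_⟩
    rw [W.compl_inv, ← neg_one_mul, map_mul, map_mul, map_inv, he, hb, one_mul, inv_neg, inv_one]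
    rcases Int.units_eq_one_or e with rfl | rfl <;>
      rcases Int.units_eq_one_or (φ (W.compl b)) with h' | h' <;> rw [h'] at h ⊢ <;>
      first | rfl | exact absurd rfl h

/-- A character that is nontrivial on the units congruent to `1` takes the value `-1` on `𝒲_A`:
among `u` and `uw`, where `u` is not congruent to `1`, one does. -/
theorem exists_W_neg_of_residue (hK : ∀ s : Finset (ResidueField A), s.card ≤ 7 → ∃ x, x ∉ s)
    {w : Aˣ} (hw : residue A w = 1) (hw' : φ w = -1) : ∃ b : W A, φ b.1 = -1 := by
  obtain ⟨c, hc0, hc1, -⟩ := exists_ne_zero_one hK 0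
  obtain ⟨u, rfl⟩ := exists_residue_eq hc0
  rcases Int.units_eq_one_or (φ u) with h | h
  · refine ⟨⟨u * w, isUnit_one_sub_of_residue ?_⟩, ?_⟩
    · rwa [Units.val_mul, map_mul, hw, mul_one]
    · change φ (u * w) = -1
      rw [map_mul, h, hw', one_mul]
  · exact ⟨⟨u, isUnit_one_sub_of_residue hc1⟩, h⟩

variable {Q : Type w} [AddCommGroup Q] {g : RPt F →+ Q}
  (H : IsSignSymbol (extHom F hπ φ σ) g) (he : φ (-1) = 1)
  (hK : ∀ s : Finset (ResidueField A), s.card ≤ 7 → ∃ x, x ∉ s)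

variable (A) in
/-- The subgroup generated by the values on the symbols `[u]`, `u ∈ 𝒲_A`. -/
def unitSpan (g : RPt F →+ Q) : AddSubgroup Q :=
  AddSubgroup.closure (Set.range fun u : W A => g (br (algebraMap A F u.1)))

theorem mem_unitSpan_unit (u : W A) : g (br (algebraMap A F u.1)) ∈ unitSpan A g :=
  AddSubgroup.subset_closure ⟨u, rfl⟩

theorem extHom_even (he : φ (-1) = 1) : extHom F hπ φ σ (fang F (-1)) = 1 := by
  rw [extHom_neg_one, he]; rfl

include H he in
theorem tC_mem_unitSpan {b : W A} (hb : φ b.1 = -1) : g (tC F) ∈ unitSpan A g := by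
  obtain ⟨b, hb, hb'⟩ := exists_W_sign he hb 1
  rw [← H.even_neg_pos (exists_notMem_fractionRing A F) (extHom_even he)
    (coe_unit_ne_zero b.1) (coe_W_ne_one b) (by rw [extHom_unit, hb]; rfl)
    (by rw [extHom_one_sub, hb']; rfl)]
  exact mem_unitSpan_unit b

include H he in
/-- The case of positive valuation in `mem_unitSpan`. If no relation determines `[a]`, then `[a]` is
equal to the symbol of the unit `(a - b) / (1 - b)`. -/
theorem mem_unitSpan_pos {b : W A} (hb : φ b.1 = -1) {a : F} (ha0 : a ≠ 0) (ha : Pos A a) :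
    g (br a) ∈ unitSpan A g := by
  have hKF := exists_notMem_fractionRing A F
  have he' := extHom_even (F := F) (hπ := hπ) (σ := σ) he
  have hC := tC_mem_unitSpan H he hb
  have ha1' := ha.one_sub_ne_zero
  have ha1 := (sub_ne_zero.1 ha1').symm
  rcases sign_cases (extHom F hπ φ σ) ha0 with h | h
  swap
  · rw [H.even_neg hKF he' ha0 ha1 h]
    exact zsmul_mem hC _
  rcases sign_cases (extHom F hπ φ σ) ha1' with h' | h'
  swap
  · rw [H.even_pos_neg hKF he' ha0 ha1 h h']
    exact zero_mem _
  obtain ⟨b, hb, hb'⟩ := exists_W_sign he hb 1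
  have hb1 : extHom F hπ φ σ (fang F (algebraMap A F b.1)) = -1 := by rw [extHom_unit, hb]; rfl
  have hb2 : extHom F hπ φ σ (fang F (1 - algebraMap A F b.1)) = 1 := by
    rw [extHom_one_sub, hb']; rfl
  have hab : a ≠ algebraMap A F b.1 := fun e => not_pos_unit b.1.isUnit (e ▸ ha)
  rcases sign_cases (extHom F hπ φ σ) (sub_ne_zero.2 hab) with h'' | h''
  swap
  · rw [H.even_eq_C hKF he' ha0 ha1 (coe_unit_ne_zero b.1) (coe_W_ne_one b) hab h h' hb1 hb2 h'']
    exact hC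
  rw [H.even_eq_div hKF he' ha0 ha1 (coe_unit_ne_zero b.1) (coe_W_ne_one b) hab h h' hb1 hb2 h'']
  obtain ⟨y, hy, rfl⟩ := ha
  have hyb : IsUnit (y - b.1) := by
    refine (residue_ne_zero_iff_isUnit _).1 ?_
    rw [map_sub, residue_eq_zero' hy, zero_sub]
    exact neg_ne_zero.2 (residue_ne_zero b.1.isUnit)
  have hv : IsUnit (1 - ((hyb.unit * (W.compl b)⁻¹ : Aˣ) : A)) := by
    have e : 1 - ((hyb.unit * (W.compl b)⁻¹ : Aˣ) : A) = (1 - y) * ((W.compl b)⁻¹ : Aˣ) := by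
      have h1 := (W.compl b).mul_inv
      rw [W.coe_compl] at h1
      rw [Units.val_mul, IsUnit.unit_spec]
      linear_combination -h1
    rw [e]
    exact (isUnit_one_sub hy).mul (Units.isUnit _)
  have e : (algebraMap A F y - algebraMap A F b.1) / (1 - algebraMap A F b.1) =
      algebraMap A F (hyb.unit * (W.compl b)⁻¹ : Aˣ) := by
    rw [Units.val_mul, map_mul, algebraMap_unit_inv, IsUnit.unit_spec, W.coe_compl, map_sub,
      map_sub, map_one, div_eq_mul_inv]
  rw [e]
  exact mem_unitSpan_unit (⟨_, hv⟩ : W A)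

include H he in
/-- If the character takes the value `-1` on `𝒲_A`, then all symbols are combinations of symbols
of units. -/
theorem mem_unitSpan {b : W A} (hb : φ b.1 = -1) {a : F} (ha0 : a ≠ 0) (ha1 : a ≠ 1) :
    g (br a) ∈ unitSpan A g := by
  have ha1' := sub_ne_zero.2 ha1.symm
  have he' := extHom_even (F := F) (hπ := hπ) (σ := σ) he
  rcases pos_cases (A := A) a with h | h | h | ⟨y, hy, hy1, rfl⟩
  · exact mem_unitSpan_pos H he hb ha0 h
  · have := neg_mem (mem_unitSpan_pos H he hb (inv_ne_zero ha0) h)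
    rwa [H.even_inv he', neg_neg] at this
  · have := sub_mem (tC_mem_unitSpan H he hb) (mem_unitSpan_pos H he hb ha1' h)
    rwa [H.even_one_sub he' ha0 ha1, sub_sub_cancel] at this
  · exact mem_unitSpan_unit (⟨hy.unit, hy1⟩ : W A)

/-! ### Characters that are trivial on the units congruent to `1` -/

section Unramified

variable (hU : ∀ u : Aˣ, residue A u = 1 → φ u = 1)

include hU in
theorem extHom_one_sub_pos {x : F} (hx : Pos A x) : extHom F hπ φ σ (fang F (1 - x)) = 1 := by
  obtain ⟨y, hy, rfl⟩ := hx
  have := extHom_unit (F := F) hπ φ σ (isUnit_one_sub hy).unit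
  rw [IsUnit.unit_spec, map_sub (algebraMap A F), map_one (algebraMap A F)] at this
  rw [this, hU]
  · rfl
  · rw [IsUnit.unit_spec, map_sub, map_one, residue_eq_zero' hy, sub_zero]

variable (hne : (∃ u, φ u = -1) ∨ σ = -1)
include H he hU hne

/-- A symbol `[a]` with `v(a) > 0` is equal to the constant `C`. -/
theorem symbol_pos {a : F} (ha0 : a ≠ 0) (ha : Pos A a) : g (br a) = g (tC F) := by
  have hKF := exists_notMem_fractionRing A F
  have he' := extHom_even (F := F) (hπ := hπ) (σ := σ) he
  have ha1 := (sub_ne_zero.1 ha.one_sub_ne_zero).symm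
  have h' := extHom_one_sub_pos (hπ := hπ) (σ := σ) hU ha
  rcases sign_cases (extHom F hπ φ σ) ha0 with h | h
  swap
  · exact H.even_neg_pos hKF he' ha0 ha1 h h'
  -- an element `b` of positive valuation at which the character is `-1`
  obtain ⟨b, hb0, hb, hbs, hab⟩ : ∃ b : F, b ≠ 0 ∧ Pos A b ∧ extHom F hπ φ σ (fang F b) = -1 ∧
      extHom F hπ φ σ (fang F (a - b)) = -1 := by
    by_cases hex : ∃ u, φ u = -1
    · obtain ⟨u, hu⟩ := hex
      have hu1 : residue A u ≠ 1 := fun h1 => by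
        rw [hU u h1] at hu; exact absurd hu (by decide)
      obtain ⟨w, hw, hw'⟩ := exists_W_sign he (b := ⟨u, isUnit_one_sub_of_residue hu1⟩) hu (-1)
      -- then `a - aw = a (1 - w)`
      refine ⟨a * algebraMap A F w.1, mul_ne_zero ha0 (coe_unit_ne_zero w.1), ha.mul _, ?_, ?_⟩
      · rw [map_mul, map_mul, extHom_unit, h, hw]; rfl
      · rw [show a - a * algebraMap A F w.1 = a * (1 - algebraMap A F w.1) by ring, map_mul,
          map_mul, extHom_one_sub, h, hw']; rfl
    · obtain rfl := hne.resolve_left hex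
      have hφ : ∀ u, φ u = 1 := fun u => (Int.units_eq_one_or _).resolve_right fun h => hex ⟨u, h⟩
      have hπ0 : algebraMap A F π ≠ 0 := by simpa using hπ.ne_zero
      have hπs : extHom F hπ φ (-1) (fang F (algebraMap A F π)) = -1 := by rw [extHom_unif]; rfl
      have hπm : π ∈ maximalIdeal A := hπ.not_isUnit
      refine ⟨algebraMap A F π, hπ0, ⟨π, hπm, rfl⟩, hπs, ?_⟩
      obtain ⟨y, hy, rfl⟩ := ha
      obtain ⟨z, rfl⟩ : π ∣ y := by
        rwa [hπ.maximalIdeal_eq, Ideal.mem_span_singleton] at hy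
      -- the valuation of `y` is even, since the character is `1` at it
      have hz : ¬ IsUnit z := by
        rintro ⟨z, rfl⟩
        rw [map_mul, map_mul, map_mul, hπs, extHom_unit, hφ] at h
        exact absurd h (by decide)
      have e : algebraMap A F (π * z) - algebraMap A F π =
          -1 * algebraMap A F π * (1 - algebraMap A F z) := by rw [map_mul]; ring
      rw [e, map_mul, map_mul, map_mul, map_mul, he', hπs, extHom_one_sub_pos hU ⟨z, hz, rfl⟩]
      rfl
  refine H.even_eq_C hKF he' ha0 ha1 hb0 (sub_ne_zero.1 hb.one_sub_ne_zero).symm ?_ h h' hbs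
    (extHom_one_sub_pos hU hb) hab
  rintro rfl
  rw [h] at hbs
  exact absurd hbs (by decide)

/-- A symbol `[a]` with `v(1 - a) > 0` vanishes. -/
theorem symbol_one {a : F} (ha : Pos A (1 - a)) : g (br a) = 0 := by
  by_cases ha1 : a = 1
  · rw [ha1, br_one, map_zero]
  have ha1' := sub_ne_zero.2 (Ne.symm ha1)
  have h := symbol_pos H he hU hne ha1' ha
  have ha0 : a ≠ 0 := by simpa using ha.one_sub_ne_zero
  rw [H.even_one_sub (extHom_even he) ha0 ha1] at h
  simpa using h

/-- The symbol of a unit depends on its residue class only. -/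
theorem symbol_congr {u w : Aˣ} (huw : residue A u = residue A w) :
    g (br (algebraMap A F u)) = g (br (algebraMap A F w)) := by
  have hpos : ∀ u w : Aˣ, residue A u = residue A w →
      Pos A (1 - algebraMap A F u / algebraMap A F w) := fun u w h => by
    refine ⟨1 - u * (w⁻¹ : Aˣ), ?_, ?_⟩
    · rw [← residue_eq_zero_iff, map_sub, map_one, map_mul, h, ← map_mul, Units.mul_inv, map_one,
        sub_self]
    · rw [map_sub, map_one, map_mul, algebraMap_unit_inv, div_eq_mul_inv]
  by_cases h1 : residue A u = 1
  · have h1' : ∀ u : Aˣ, residue A u = 1 → Pos A (1 - algebraMap A F u) := fun u hu => by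
      have := hpos u 1 (by rw [hu, Units.val_one, map_one])
      rwa [Units.val_one, map_one, div_one] at this
    rw [symbol_one H he hU hne (h1' u h1), symbol_one H he hU hne (h1' w (huw ▸ h1))]
  by_cases hab : algebraMap A F u = algebraMap A F w
  · rw [hab]
  let u' : W A := ⟨u, isUnit_one_sub_of_residue h1⟩
  let w' : W A := ⟨w, isUnit_one_sub_of_residue (huw ▸ h1)⟩
  have hc : residue A (W.compl u') = residue A (W.compl w') := by
    rw [W.coe_compl, W.coe_compl, map_sub, map_sub, map_one]; exact congrArg (1 - ·) huw
  have hcF : ∀ x : W A, 1 - algebraMap A F x.1 = algebraMap A F (W.compl x) := fun x => by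
    rw [W.coe_compl, map_sub, map_one]
  have h5 := H.five (coe_unit_ne_zero u) (coe_W_ne_one u') (coe_unit_ne_zero w)
    (coe_W_ne_one w') hab
  have e1 : 1 - algebraMap A F u = algebraMap A F (W.compl u') := hcF u'
  have e2 : 1 - algebraMap A F w = algebraMap A F (W.compl w') := hcF w'
  have hz := hpos (w * W.compl u') (u * W.compl w') (by
    rw [Units.val_mul, Units.val_mul, map_mul, map_mul, hc, huw])
  rw [Units.val_mul, Units.val_mul, map_mul, map_mul, ← div_mul_div_comm] at hz
  rw [e1, e2, symbol_one H he hU hne (hpos w u huw.symm), symbol_one H he hU hne hz,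
    symbol_one H he hU hne (hpos _ _ hc)] at h5
  simpa [sub_eq_zero] using h5

end Unramified

end Valued

/-! ### Characters that are nontrivial on the units congruent to `1` -/

section Lift

open IsLocalRing

variable {A : Type u} [CommRing A] [IsDomain A] [IsDiscreteValuationRing A]
  {F : Type v} [Field F] [Algebra A F] [IsFractionRing A F]
  {π : A} {hπ : Irreducible π} {φ : Aˣ →* ℤˣ} {σ : ℤˣ}

/-- The map `ℛ𝒫(A) → ℛ𝒫(F)`, as an additive map. -/
def toRPF (A : Type u) [CommRing A] (F : Type v) [Field F] [Algebra A F] : RP A →+ RP F :=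
  (Res.mk _ (RP F)).symm.toAddMonoidHom.comp (RP.map (algebraMap A F)).toAddMonoidHom

theorem toRPF_smul (r : GR A) (y : RP A) : toRPF A F (r • y) = toFrac A F r • toRPF A F y :=
  map_smul (RP.map (algebraMap A F)) r y

theorem toRPF_sym (u : W A) : toRPF A F (sym u.1) = fsym (algebraMap A F u.1) := by
  refine (freeMap_freeSym (algebraMap A F) u.1 (W.compl u) rfl).trans ?_
  exact (fsym_coe (unitF F u.1)).symm

theorem toRPt_add {K : Type*} [Field K] (x y : RP K) : toRPt (x + y) = toRPt x + toRPt y :=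
  map_add _ _ _

theorem toRPt_smul {K : Type*} [Field K] (r : GR K) (x : RP K) : toRPt (r • x) = r • toRPt x :=
  map_smul _ _ _

theorem toRPt_sub {K : Type*} [Field K] (x y : RP K) : toRPt (x - y) = toRPt x - toRPt y :=
  map_sub _ _ _

theorem toRPt_zero {K : Type*} [Field K] : toRPt (0 : RP K) = 0 := map_zero _

/-- An irreducible element `d` with `φ(1 - d) = -1`. -/
theorem exists_irreducible_sign {w : Aˣ} (hw : residue A w = 1) (hw' : φ w = -1) :
    ∃ (d : A) (_ : Irreducible d) (u : Aˣ), (u : A) = 1 - d ∧ φ u = -1 := by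
  obtain ⟨π, hπ⟩ := IsDiscreteValuationRing.exists_irreducible A
  have hπm : π ∈ maximalIdeal A := hπ.not_isUnit
  obtain ⟨v, hv⟩ := isUnit_one_sub hπm
  rcases Int.units_eq_one_or (φ v) with h | h
  swap
  · exact ⟨π, hπ, v, hv, h⟩
  have hd : 1 - (w : A) ∈ maximalIdeal A := by
    rw [← residue_eq_zero_iff, map_sub, map_one, hw, sub_self]
  obtain ⟨z, hz⟩ : π ∣ 1 - (w : A) := by
    rwa [hπ.maximalIdeal_eq, Ideal.mem_span_singleton] at hd
  by_cases hzu : IsUnit z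
  · exact ⟨1 - w, by rw [hz]; exact (irreducible_mul_isUnit hzu).2 hπ, w, by ring, hw'⟩
  -- the quotient `w / v` is of the form `1 - d`, where `d` has valuation one
  have hz1 : IsUnit (z - 1) := by
    rw [← neg_sub]; exact (isUnit_one_sub (y := z) hzu).neg
  refine ⟨π * ((z - 1) * (v⁻¹ : Aˣ)), (irreducible_mul_isUnit (hz1.mul (Units.isUnit _))).2 hπ,
    w * v⁻¹, ?_, ?_⟩
  · have := v.mul_inv
    rw [Units.val_mul]
    linear_combination this - (v⁻¹ : Aˣ) * (hv + hz)
  · rw [map_mul, map_inv, h, hw']; rfl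

/-- There is an element `a ∈ 𝒲_A` with `φ(a) = φ(1 - a) = 1`. It is a quotient of two of the squares
`1, x ^ 2, y ^ 2`, or of two of their differences. -/
theorem exists_W_pos
    (hK : ∀ s : Finset (ResidueField A), s.card ≤ 7 → ∃ x, x ∉ s) :
    ∃ a : W A, φ a.1 = 1 ∧ φ (W.compl a) = 1 := by
  classical
  obtain ⟨x, hx⟩ := hK {0, 1, -1} (Finset.card_le_three.trans (by norm_num))
  obtain ⟨y, hy⟩ := hK {0, 1, -1, x, -x} (Finset.card_le_five.trans (by norm_num))
  simp only [Finset.mem_insert, Finset.mem_singleton, not_or] at hx hy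
  obtain ⟨hx0, hx1, hx2⟩ := hx
  obtain ⟨hy0, hy1, hy2, hyx, hyx'⟩ := hy
  obtain ⟨x, rfl⟩ := exists_residue_eq hx0
  obtain ⟨y, rfl⟩ := exists_residue_eq hy0
  have hsq : ∀ u : Aˣ, φ (u ^ 2) = 1 := fun u => by rw [map_pow, Int.units_sq]
  have hne : ∀ a b : ResidueField A, a ≠ b → a ≠ -b → a ^ 2 ≠ b ^ 2 := fun a b h h' e =>
    (sq_eq_sq_iff_eq_or_eq_neg.1 e).elim h h'
  have key : ∀ u v : Aˣ, residue A u ^ 2 ≠ residue A v ^ 2 → IsUnit ((u : A) ^ 2 - v ^ 2) := by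
    intro u v h
    refine (residue_ne_zero_iff_isUnit _).1 ?_
    rw [map_sub, map_pow, map_pow]
    exact sub_ne_zero.2 h
  obtain ⟨α, hα⟩ := key 1 x (by
    rw [Units.val_one, map_one, one_pow]
    exact fun e => (hne (residue A x) 1 hx1 hx2) (by rw [← e, one_pow]))
  obtain ⟨β, hβ⟩ := key 1 y (by
    rw [Units.val_one, map_one, one_pow]
    exact fun e => (hne (residue A y) 1 hy1 hy2) (by rw [← e, one_pow]))
  obtain ⟨γ, hγ⟩ := key y x (hne _ _ hyx hyx')
  rw [Units.val_one, one_pow] at hα hβ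
  have hW : ∀ a b : Aˣ, (b : A) = 1 - a → φ a = 1 → φ b = 1 →
      ∃ a : W A, φ a.1 = 1 ∧ φ (W.compl a) = 1 := fun a b hab ha hb =>
    ⟨⟨a, hab ▸ b.isUnit⟩, ha, by
      rwa [show W.compl (⟨a, hab ▸ b.isUnit⟩ : W A) = b from Units.ext hab.symm]⟩
  rcases Int.units_eq_one_or (φ α) with h1 | h1
  · exact hW (x ^ 2) α (by rw [hα, Units.val_pow_eq_pow_val]) (hsq x) h1
  rcases Int.units_eq_one_or (φ β) with h2 | h2
  · exact hW (y ^ 2) β (by rw [hβ, Units.val_pow_eq_pow_val]) (hsq y) h2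
  rcases Int.units_eq_one_or (φ γ) with h3 | h3
  · refine hW (x ^ 2 * (y ^ 2)⁻¹) (γ * (y ^ 2)⁻¹) ?_ ?_ ?_
    · have := (y ^ 2).mul_inv
      rw [Units.val_mul, Units.val_mul, hγ, ← this, Units.val_pow_eq_pow_val,
        Units.val_pow_eq_pow_val]
      ring
    · rw [map_mul, map_inv, hsq, hsq]; rfl
    · rw [map_mul, map_inv, hsq, h3]; rfl
  -- `φ` is `-1` at the three differences, and `γ / α + β / α = 1`
  · refine hW (γ * α⁻¹) (β * α⁻¹) ?_ ?_ ?_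
    · have := α.mul_inv
      rw [Units.val_mul, Units.val_mul, hγ, hβ]
      linear_combination this - (α⁻¹ : Aˣ) * hα
    · rw [map_mul, map_inv, h3, h1]; rfl
    · rw [map_mul, map_inv, h2, h1]; rfl

section Ramified

variable {Q Q' : Type w} [AddCommGroup Q] [AddCommGroup Q'] {g : RPt F →+ Q} {g' : RPt F →+ Q'}
  (H : IsSignSymbol (extHom F hπ φ 1) g) (H' : IsSignSymbol (extHom F hπ φ (-1)) g')
  (he : φ (-1) = 1) (hK : ∀ s : Finset (ResidueField A), s.card ≤ 7 → ∃ x, x ∉ s)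
  {u : Aˣ} (hu : (u : A) = 1 - π) (hu' : φ u = -1)

include H H' he hu hu'

/-- The relation for `a⁻¹` and `π` determines `[a]` in one of the two eigenspaces: the one for `-1`
if `φ(1 - aπ) = 1`, and the one for `1` otherwise. -/
theorem symbol_eq_zero_or {a : W A} (h : φ a.1 = 1) (h' : φ (W.compl a) = 1) :
    g (br (algebraMap A F a.1)) = 0 ∨ g' (br (algebraMap A F a.1)) = g' (tC F) := by
  have hKF := exists_notMem_fractionRing A F
  have hπm : π ∈ maximalIdeal A := hπ.not_isUnit
  have hπ0 : algebraMap A F π ≠ 0 := by simpa using hπ.ne_zero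
  have hπ1 : algebraMap A F π ≠ 1 :=
    (sub_ne_zero.1 (Pos.one_sub_ne_zero (A := A) ⟨π, hπm, rfl⟩)).symm
  have hu1 : 1 - algebraMap A F π = algebraMap A F u := by rw [hu, map_sub, map_one]
  obtain ⟨t, ht⟩ := isUnit_one_sub (Ideal.mul_mem_right (a.1 : A) _ hπm)
  have ha0 : (algebraMap A F a.1)⁻¹ ≠ 0 := inv_ne_zero (coe_unit_ne_zero a.1)
  have ha1 : (algebraMap A F a.1)⁻¹ ≠ 1 := inv_ne_one.2 (coe_W_ne_one a)
  have hab : (algebraMap A F a.1)⁻¹ - algebraMap A F π =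
      algebraMap A F t / algebraMap A F a.1 := by
    have := coe_unit_ne_zero (F := F) a.1
    rw [ht, map_sub, map_mul, map_one]; field_simp
  have hab' : (algebraMap A F a.1)⁻¹ ≠ algebraMap A F π := sub_ne_zero.1 (by
    rw [hab]; exact div_ne_zero (coe_unit_ne_zero t) (coe_unit_ne_zero a.1))
  have hX : ∀ σ, extHom F hπ φ σ (fang F (algebraMap A F a.1)⁻¹) = 1 := fun σ => by
    rw [fang_inv, extHom_unit, h]; rfl
  have hX1 : ∀ σ, extHom F hπ φ σ (fang F (1 - (algebraMap A F a.1)⁻¹)) = 1 := fun σ => by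
    rw [IsSignSymbol.sign_one_sub_inv (extHom_even he) (coe_unit_ne_zero a.1),
      extHom_one_sub, extHom_unit, h, h']; rfl
  have hX2 : ∀ σ, extHom F hπ φ σ (fang F (1 - algebraMap A F π)) = -1 := fun σ => by
    rw [hu1, extHom_unit, hu']; rfl
  have hX3 : ∀ σ, extHom F hπ φ σ (fang F ((algebraMap A F a.1)⁻¹ - algebraMap A F π)) = φ t :=
    fun σ => by rw [hab, fang_div, map_mul, extHom_unit, extHom_unit, h]; simp
  rcases Int.units_eq_one_or (φ t) with ht' | ht'
  · right
    have := H'.even_eq_neg_C hKF (extHom_even he) ha0 ha1 hπ0 hπ1 hab' (hX _) (hX1 _)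
      (by rw [extHom_unif]; rfl) (hX2 _) (by rw [hX3, ht']; rfl)
    rw [H'.even_inv (extHom_even he)] at this
    exact neg_injective this
  · left
    have := H.even_eq_zero hKF (extHom_even he) ha0 ha1 hπ0 hπ1 hab' (hX _) (hX1 _)
      (by rw [extHom_unif]; rfl) (hX2 _) (by rw [hX3, ht']; rfl)
    rw [H.even_inv (extHom_even he)] at this
    exact neg_eq_zero.1 this

include hK in
/-- Apply `symbol_eq_zero_or` to `a`, `a⁻¹`, `1 - a` and `(1 - a)⁻¹`: the resulting equations for
`[a]` and `C` force `C` to vanish in one of the two eigenspaces. -/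
theorem tC_eq_zero_or : g (tC F) = 0 ∨ g' (tC F) = 0 := by
  obtain ⟨a, ha, ha'⟩ := exists_W_pos (φ := φ) hK
  have he1 := extHom_even (F := F) (hπ := hπ) (σ := 1) he
  have he2 := extHom_even (F := F) (hπ := hπ) (σ := -1) he
  have h1 := symbol_eq_zero_or H H' he hu hu' ha ha'
  have h2 := symbol_eq_zero_or H H' he hu hu' (a := W.inv a) (by rw [W.inv, map_inv, ha]; rfl)
    (by rw [W.compl_inv, ← neg_one_mul, map_mul, map_mul, map_inv, he, ha, ha']; rfl)
  have h3 := symbol_eq_zero_or H H' he hu hu' (a := W.oneSub a) ha'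
    (by rw [← ha]; congr 1; exact Units.ext (by rw [W.coe_compl]; simp [W.oneSub, W.coe_compl]))
  have hc : ∀ b : W A, φ b.1 = 1 → φ (W.compl b) = 1 → φ (W.inv b).1 = 1 ∧
      φ (W.compl (W.inv b)) = 1 := fun b hb hb' =>
    ⟨by rw [W.inv, map_inv, hb]; rfl,
      by rw [W.compl_inv, ← neg_one_mul, map_mul, map_mul, map_inv, he, hb, hb']; rfl⟩
  have h4 := symbol_eq_zero_or H H' he hu hu' (a := W.inv (W.oneSub a))
    (hc (W.oneSub a) ha' (by
      rw [← ha]; congr 1; exact Units.ext (by rw [W.coe_compl]; simp [W.oneSub, W.coe_compl]))).1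
    (hc (W.oneSub a) ha' (by
      rw [← ha]; congr 1; exact Units.ext (by rw [W.coe_compl]; simp [W.oneSub, W.coe_compl]))).2
  have ei : ∀ b : W A, algebraMap A F (W.inv b).1 = (algebraMap A F b.1)⁻¹ := fun b =>
    algebraMap_unit_inv b.1
  have eo : algebraMap A F (W.oneSub a).1 = 1 - algebraMap A F a.1 := by
    rw [W.oneSub, W.coe_compl, map_sub, map_one]
  have ha0 := coe_unit_ne_zero (F := F) a.1
  have ha1 := coe_W_ne_one (F := F) a
  rw [ei, H.even_inv he1, H'.even_inv he2] at h2
  rw [eo, H.even_one_sub he1 ha0 ha1, H'.even_one_sub he2 ha0 ha1] at h3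
  rw [ei, H.even_inv he1, H'.even_inv he2, eo, H.even_one_sub he1 ha0 ha1,
    H'.even_one_sub he2 ha0 ha1] at h4
  have h2Q := H'.eq_zero (g' (tC F))
  generalize g (tC F) = C at *
  generalize g' (tC F) = C' at *
  generalize g (br (algebraMap A F a.1)) = f at *
  generalize g' (br (algebraMap A F a.1)) = f' at *
  rw [two_zsmul] at h2Q
  rcases h1 with h1 | h1 <;> rw [h1] at h2 h3 h4
  · rcases h3 with h3 | h3
    · exact Or.inl (by simpa using h3)
    · rcases h4 with h4 | h4
      · exact Or.inl (by simpa using h4)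
      · right
        rw [h3] at h4
        exact h2Q (by nth_rw 1 [← h4]; simp)
  · rcases h2 with h2 | h2
    · rcases h3 with h3 | h3
      · rw [neg_eq_zero.1 h2, sub_zero] at h3; exact Or.inl h3
      · exact Or.inr (by rw [← h3, sub_self])
    · exact Or.inr (h2Q (by nth_rw 1 [← h2]; simp))

include hK in
/-- If the character is nontrivial on the units congruent to `1`, then an element of `ℛ𝒫(F)` has the
same image as an element of `ℛ𝒫(A)`, for both extensions of the character simultaneously. -/
theorem exists_toRPF_of_ramified (x : RP F) :
    ∃ y : RP A, g (toRPt (toRPF A F y)) = g (toRPt x) ∧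
      g' (toRPt (toRPF A F y)) = g' (toRPt x) := by
  have hKF := exists_notMem_fractionRing A F
  have hres : residue A u = 1 := by
    rw [hu, map_sub, map_one, residue_eq_zero' hπ.not_isUnit, sub_zero]
  obtain ⟨b, hb⟩ := exists_W_neg_of_residue hK hres hu'
  let J : RP A →+ Q × Q' :=
    ((g.comp (KOne F).mkQ.toAddMonoidHom).comp (toRPF A F)).prod
      ((g'.comp (KOne F).mkQ.toAddMonoidHom).comp (toRPF A F))
  have hJ : ∀ a : W A, (g (br (algebraMap A F a.1)), g' (br (algebraMap A F a.1))) ∈ J.range :=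
    fun a => ⟨sym a.1, by
      change (g (toRPt (toRPF A F (sym a.1))), g' (toRPt (toRPF A F (sym a.1)))) = _
      rw [toRPF_sym]; rfl⟩
  have hC : (g (tC F), g' (tC F)) ∈ J.range := by
    obtain ⟨b, hb, hb'⟩ := exists_W_sign he hb 1
    have := hJ b
    rwa [H.even_neg_pos hKF (extHom_even he) (coe_unit_ne_zero b.1) (coe_W_ne_one b)
        (by rw [extHom_unit, hb]; rfl) (by rw [extHom_one_sub, hb']; rfl),
      H'.even_neg_pos hKF (extHom_even he) (coe_unit_ne_zero b.1) (coe_W_ne_one b)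
        (by rw [extHom_unit, hb]; rfl) (by rw [extHom_one_sub, hb']; rfl)] at this
  have hC0 := tC_eq_zero_or H H' he hK hu hu'
  have hC1 : (g (tC F), (0 : Q')) ∈ J.range := by
    rcases hC0 with h | h
    · rw [h]; exact zero_mem _
    · rwa [h] at hC
  have hC2 : ((0 : Q), g' (tC F)) ∈ J.range := by
    rcases hC0 with h | h
    · rwa [h] at hC
    · rw [h]; exact zero_mem _
  have hsplit : ∀ (q : Q) (q' : Q'), (q, q') ∈ J.range → (q, (0 : Q')) ∈ J.range →
      (q, (0 : Q')) ∈ J.range ∧ ((0 : Q), q') ∈ J.range := fun q q' h h' => ⟨h', by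
    have := sub_mem h h'
    rwa [Prod.mk_sub_mk, sub_self, sub_zero] at this⟩
  -- the two components of the pair given by a symbol can be separated
  have hcomp : ∀ a : W A, (g (br (algebraMap A F a.1)), (0 : Q')) ∈ J.range ∧
      ((0 : Q), g' (br (algebraMap A F a.1))) ∈ J.range := by
    intro a
    refine hsplit _ _ (hJ a) ?_
    have ha0 := coe_unit_ne_zero (F := F) a.1
    have ha1 := coe_W_ne_one (F := F) a
    rcases Int.units_eq_one_or (φ a.1) with h | h
    swap
    · rw [H.even_neg hKF (extHom_even he) ha0 ha1 (by rw [extHom_unit, h]; rfl)]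
      have := zsmul_mem hC1 (extHom F hπ φ 1 (fang F (1 - algebraMap A F a.1)))
      rwa [Prod.smul_mk, smul_zero] at this
    rcases Int.units_eq_one_or (φ (W.compl a)) with h' | h'
    swap
    · rw [H.even_pos_neg hKF (extHom_even he) ha0 ha1 (by rw [extHom_unit, h]; rfl)
        (by rw [extHom_one_sub, h']; rfl)]
      exact zero_mem _
    rcases symbol_eq_zero_or H H' he hu hu' h h' with h'' | h''
    · rw [h'']; exact zero_mem _
    · have := sub_mem (hJ a) hC2
      rwa [h'', Prod.mk_sub_mk, sub_zero, sub_self] at this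
  have h1 : ∀ q ∈ unitSpan A g, (q, (0 : Q')) ∈ J.range := fun q hq => by
    have : unitSpan A g ≤ J.range.comap (AddMonoidHom.inl Q Q') :=
      (AddSubgroup.closure_le _).2 (by rintro _ ⟨a, rfl⟩; exact (hcomp a).1)
    exact this hq
  have h2 : ∀ q ∈ unitSpan A g', ((0 : Q), q) ∈ J.range := fun q hq => by
    have : unitSpan A g' ≤ J.range.comap (AddMonoidHom.inr Q Q') :=
      (AddSubgroup.closure_le _).2 (by rintro _ ⟨a, rfl⟩; exact (hcomp a).2)
    exact this hq
  have key : (g (toRPt x), g' (toRPt x)) ∈ J.range := by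
    induction x using RP.induction with
    | h0 => rw [toRPt_zero, map_zero, map_zero]; exact zero_mem _
    | ha x y hx hy => rw [toRPt_add, map_add, map_add, ← Prod.mk_add_mk]; exact add_mem hx hy
    | h1 r a =>
      rw [← fsym_coe, toRPt_smul, H.smul, H'.smul]
      have e1 := h1 _ (zsmul_mem (mem_unitSpan H he hb a.1.ne_zero a.ne_one) (extHom F hπ φ 1 r))
      have e2 := h2 _ (zsmul_mem (mem_unitSpan H' he hb a.1.ne_zero a.ne_one)
        (extHom F hπ φ (-1) r))
      have := add_mem e1 e2
      rwa [Prod.mk_add_mk, add_zero, zero_add] at this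
  obtain ⟨y, hy⟩ := key
  exact ⟨y, congrArg Prod.fst hy, congrArg Prod.snd hy⟩

end Ramified

end Lift

/-! ### Reduction to the residue field -/

section Theta

open IsLocalRing

variable {A : Type u} [CommRing A] [IsDomain A] [IsDiscreteValuationRing A]
  {F : Type v} [Field F] [Algebra A F] [IsFractionRing A F]
  {π : A} {hπ : Irreducible π} {φ : Aˣ →* ℤˣ} {σ : ℤˣ}

theorem red_surjective : Function.Surjective (red : Aˣ → (ResidueField A)ˣ) := fun c => by
  obtain ⟨u, hu⟩ := exists_residue_eq c.ne_zero
  exact ⟨u, Units.ext hu⟩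

variable (hU : ∀ u : Aˣ, residue A u = 1 → φ u = 1)

/-- The character of `kˣ` induced by a character of `Aˣ` that is trivial on the units congruent
to `1`. -/
def resChar : (ResidueField A)ˣ →* ℤˣ :=
  MonoidHom.liftOfRightInverse red (Function.surjInv red_surjective)
    (Function.rightInverse_surjInv red_surjective)
    ⟨φ, fun u hu => hU u (congrArg Units.val hu)⟩

theorem resChar_red (u : Aˣ) : resChar hU (red u) = φ u :=
  MonoidHom.liftOfRightInverse_comp_apply _ _ _ ⟨φ, fun u hu => hU u (congrArg Units.val hu)⟩ u

/-- The ring homomorphism `ℛ_k → ℤ` given by `resChar`. -/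
def resHom : GR (ResidueField A) →+* ℤ := charHom (resChar hU)

theorem resHom_toRes (r : GR A) : resHom hU (toRes A r) = charHom φ r := by
  induction r using GR.induction with
  | h0 => simp
  | h1 u =>
    rw [charHom_ang, show toRes A (ang u) = ang (red u) from mapGR_ang _ _, resHom, charHom_ang,
      resChar_red]
  | ha x y hx hy => rw [map_add, map_add, map_add, hx, hy]
  | hn x hx => rw [map_neg, map_neg, map_neg, hx]

theorem resHom_fang (u : Aˣ) : resHom hU (fang _ (residue A u)) = φ u := by
  rw [← toRes_ang, resHom_toRes, charHom_ang]

variable {Q : Type w} [AddCommGroup Q] {g : RPt F →+ Q}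
  (H : IsSignSymbol (extHom F hπ φ σ) g) (he : φ (-1) = 1)
  (hne : (∃ u, φ u = -1) ∨ σ = -1)

open Classical in
variable (A) in
/-- The function `ū ↦ g([u])` on the residue field, formed with a chosen lift `u` of each element,
and `0` at `0`. -/
def thetaFun (g : RPt F →+ Q) (c : ResidueField A) : Q :=
  if h : ∃ u : Aˣ, residue A u = c then g (br (algebraMap A F h.choose)) else 0

include H he hU hne in
theorem thetaFun_residue (u : Aˣ) :
    thetaFun A g (residue A u) = g (br (algebraMap A F u)) := by
  have h : ∃ w : Aˣ, residue A w = residue A u := ⟨u, rfl⟩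
  rw [thetaFun, dif_pos h]
  exact symbol_congr H he hU hne h.choose_spec

include H he hne in
/-- The five term relation for the residue field, obtained by lifting the arguments to units of `A`.
-/
theorem thetaFun_five {a b : ResidueField A} (ha0 : a ≠ 0) (ha1 : a ≠ 1) (hb0 : b ≠ 0)
    (hb1 : b ≠ 1) (hab : a ≠ b) :
    thetaFun A g a - thetaFun A g b + resHom hU (fang _ a) • thetaFun A g (b / a)
      - (resHom hU (fang _ a) * resHom hU (fang _ (1 - a))) •
        thetaFun A g (b / a * ((1 - a) / (1 - b)))
      + resHom hU (fang _ (1 - a)) • thetaFun A g ((1 - a) / (1 - b)) = 0 := by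
  obtain ⟨u, rfl⟩ := exists_residue_eq ha0
  obtain ⟨w, rfl⟩ := exists_residue_eq hb0
  let u' : W A := ⟨u, isUnit_one_sub_of_residue ha1⟩
  let w' : W A := ⟨w, isUnit_one_sub_of_residue hb1⟩
  have hc : ∀ x : W A, 1 - residue A x.1 = residue A (W.compl x) := fun x => by
    rw [W.coe_compl, map_sub, map_one]
  have hcF : ∀ x : W A, 1 - algebraMap A F x.1 = algebraMap A F (W.compl x) := fun x => by
    rw [W.coe_compl, map_sub, map_one]
  have hd : ∀ x y : Aˣ, residue A x / residue A y = residue A (x / y : Aˣ) := fun x y =>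
    (Units.val_div_eq_div_val (red x) (red y)).symm.trans
      (congrArg Units.val (map_div red x y).symm)
  have hdF : ∀ x y : Aˣ, algebraMap A F (x / y : Aˣ) = algebraMap A F x / algebraMap A F y :=
    fun x y => (congrArg Units.val (map_div (unitF F) x y)).trans (Units.val_div_eq_div_val _ _)
  have hm : ∀ x y : Aˣ, residue A x * residue A y = residue A (x * y : Aˣ) := fun x y => by
    rw [Units.val_mul, map_mul]
  have hmF : ∀ x y : Aˣ, algebraMap A F (x * y : Aˣ) = algebraMap A F x * algebraMap A F y :=
    fun x y => by rw [Units.val_mul, map_mul]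
  have h5 := H.five (coe_unit_ne_zero u) (coe_W_ne_one u') (coe_unit_ne_zero w) (coe_W_ne_one w')
    fun e => hab (by rw [IsFractionRing.injective A F e])
  have e1 := hc u'
  have e2 := hc w'
  have e3 := hcF u'
  have e4 := hcF w'
  change 1 - residue A u = _ at e1
  change 1 - residue A w = _ at e2
  change 1 - algebraMap A F u = _ at e3
  change 1 - algebraMap A F w = _ at e4
  rw [e3, e4, extHom_unit, extHom_unit, ← hdF, ← hdF, ← hmF] at h5
  rw [e1, e2, resHom_fang, resHom_fang, hd, hd, hm, thetaFun_residue hU H he hne,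
    thetaFun_residue hU H he hne, thetaFun_residue hU H he hne, thetaFun_residue hU H he hne,
    thetaFun_residue hU H he hne]
  exact h5

/-- The map `ℛ𝒫(k) → Q`, `[ū] ↦ g([u])`. -/
def thetaRP : RP (ResidueField A) →ₗ[GR (ResidueField A)] Res (resHom hU) Q :=
  RP.lift (fun c => Res.mk (resHom hU) Q (thetaFun A g c)) (fun a b ha0 ha1 hb0 hb1 hab => by
    have h := congrArg (Res.mk (resHom hU) Q) (thetaFun_five hU H he hne ha0 ha1 hb0 hb1 hab)
    rw [← map_mul] at h
    exact h)

theorem thetaRP_fsym {c : ResidueField A} (h0 : c ≠ 0) (h1 : c ≠ 1) :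
    thetaRP hU H he hne (fsym c) = Res.mk (resHom hU) Q (thetaFun A g c) :=
  RP.lift_fsym _ _ h0 h1

theorem thetaRP_psiOne (a : W (ResidueField A)) : thetaRP hU H he hne (psiOne a) = 0 := by
  have h0 := a.1.ne_zero
  have h1 := a.ne_one
  rw [psiOne_eq, psi, map_add, map_smul, thetaRP_fsym hU H he hne h0 h1,
    thetaRP_fsym hU H he hne (inv_ne_zero h0) (inv_ne_one.2 h1)]
  obtain ⟨u, hu⟩ := exists_residue_eq h0
  have hi : (a.1 : ResidueField A)⁻¹ = residue A (u⁻¹ : Aˣ) := by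
    rw [← hu]
    exact (Units.val_inv_eq_inv_val (red u)).symm.trans (congrArg Units.val (map_inv red u).symm)
  have hm : resHom hU (fang (ResidueField A) (-1)) = 1 := by
    have := resHom_fang hU (-1)
    rwa [he, Units.val_one, Units.val_neg, Units.val_one, map_neg (residue A),
      map_one (residue A)] at this
  rw [hi, ← hu, thetaFun_residue hU H he hne, thetaFun_residue hU H he hne]
  change (g _ + resHom hU (fang (ResidueField A) (-1)) • g _ : Q) = 0
  rw [hm, one_smul, algebraMap_unit_inv, H.even_inv (extHom_even he), add_neg_cancel]

theorem KOne_le_ker_thetaRP : KOne _ ≤ LinearMap.ker (thetaRP hU H he hne) :=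
  Submodule.span_le.2 (by rintro _ ⟨a, rfl⟩; exact thetaRP_psiOne hU H he hne a)

/-- The map `ℛ𝒫(k) / 𝒦⁽¹⁾ → Q`, `[ū] ↦ g([u])`. -/
def theta : RPt (ResidueField A) →+ Q :=
  (Res.mk (resHom hU) Q).symm.toAddMonoidHom.comp
    ((KOne _).liftQ (thetaRP hU H he hne)
      (KOne_le_ker_thetaRP hU H he hne)).toAddMonoidHom

theorem theta_smul (r : GR (ResidueField A)) (t : RPt (ResidueField A)) :
    theta hU H he hne (r • t) = resHom hU r • theta hU H he hne t :=
  map_smul ((KOne _).liftQ (thetaRP hU H he hne)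
    (KOne_le_ker_thetaRP hU H he hne)) r t

theorem theta_br {u : Aˣ} (hu : residue A u ≠ 1) :
    theta hU H he hne (br (residue A u)) = g (br (algebraMap A F u)) :=
  (thetaRP_fsym hU H he hne (residue_ne_zero u.isUnit) hu).trans (thetaFun_residue hU H he hne u)

variable (hK : ∀ s : Finset (ResidueField A), s.card ≤ 7 → ∃ x, x ∉ s)

include hK in
theorem theta_tC : theta hU H he hne (tC _) = g (tC F) := by
  obtain ⟨c, hc0, hc1, -⟩ := exists_ne_zero_one hK 0
  obtain ⟨u, rfl⟩ := exists_residue_eq hc0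
  let u' : W A := ⟨u, isUnit_one_sub_of_residue hc1⟩
  have e1 : 1 - residue A u = residue A (W.compl u') := by rw [W.coe_compl, map_sub, map_one]
  have e2 : 1 - algebraMap A F u = algebraMap A F (W.compl u') := by
    rw [W.coe_compl, map_sub, map_one]
  have e3 : residue A (W.compl u') ≠ 1 := by
    rw [← e1]; simp
  have hm : fang (ResidueField A) (-1) = toRes A (ang (-1)) := by rw [toRes_ang]; simp
  rw [← br_add hc0 hc1, map_add, e1, hm, theta_smul, theta_br hU H he hne hc1,
    theta_br hU H he hne e3, ← H.add (coe_unit_ne_zero u) (coe_W_ne_one u'), e2, extHom_neg_one,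
    resHom_toRes, charHom_ang]

include hK in
/-- The image of a symbol of `F` is the image under `theta` of its specialization. -/
theorem exists_specFun_eq {x : F} (h0 : x ≠ 0) (h1 : x ≠ 1) :
    ∃ t, specFun A x = iota A F _ t ∧ theta hU H he hne t = g (br x) := by
  rcases pos_cases (A := A) x with h | h | h | ⟨y, hy, hy1, rfl⟩
  · exact ⟨_, specFun_pos h, (theta_tC hU H he hne hK).trans (symbol_pos H he hU hne h0 h).symm⟩
  · refine ⟨-tC _, by rw [specFun_neg h0 h, map_neg], ?_⟩
    rw [map_neg, theta_tC hU H he hne hK, ← symbol_pos H he hU hne (inv_ne_zero h0) h,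
      H.even_inv (extHom_even he), neg_neg]
  · exact ⟨0, by rw [specFun_one_sub_pos h, map_zero], by
      rw [map_zero, symbol_one H he hU hne h]⟩
  · exact ⟨_, specFun_unit hy, theta_br hU H he hne (u := hy.unit) (residue_ne_one hy1)⟩

/-- The component of the specialization map at the even powers of the uniformizer. -/
def rhoEven (hπ : Irreducible π) : RP F →+ RPt (ResidueField A) :=
  (Res.mk (toRes A) _).symm.toAddMonoidHom.comp <|
    (rho hπ _).toAddMonoidHom.comp <|
      (DistribSMul.toAddMonoidHom _ (fang F (algebraMap A F π))).comp (spec F hK).toAddMonoidHom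

/-- The component of the specialization map at the odd powers of the uniformizer. -/
def rhoOdd (hπ : Irreducible π) : RP F →+ RPt (ResidueField A) :=
  (Res.mk (toRes A) _).symm.toAddMonoidHom.comp <|
    (rho hπ _).toAddMonoidHom.comp (spec F hK).toAddMonoidHom

theorem rhoEven_apply (x : RP F) {r : GR F} {t} (h : spec F hK x = r • iota A F _ t) :
    rhoEven hK hπ x = rhoAdd hπ (fang F (algebraMap A F π) * r) • t := by
  change (Res.mk (toRes A) _).symm (rho hπ _ (fang F (algebraMap A F π) • spec F hK x)) = _
  rw [h, smul_smul, rho_smul_iota]; rfl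

theorem rhoOdd_apply (x : RP F) {r : GR F} {t} (h : spec F hK x = r • iota A F _ t) :
    rhoOdd hK hπ x = rhoAdd hπ r • t := by
  change (Res.mk (toRes A) _).symm (rho hπ _ (spec F hK x)) = _
  rw [h, rho_smul_iota]; rfl

/-- A character of `ℛ_F` is determined by the components at the even and at the odd powers of the
uniformizer. -/
theorem resHom_rhoAdd (r : GR F) :
    resHom hU (rhoAdd hπ (fang F (algebraMap A F π) * r)) + (σ : ℤ) * resHom hU (rhoAdd hπ r) =
      extHom F hπ φ σ r := by
  induction r using GR.induction with
  | h0 => simp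
  | ha x y hx hy => rw [mul_add, map_add (rhoAdd hπ), map_add (rhoAdd hπ), map_add (resHom hU),
      map_add (resHom hU), map_add (extHom F hπ φ σ), ← hx, ← hy]; ring
  | hn x hx => rw [mul_neg, map_neg (rhoAdd hπ), map_neg (rhoAdd hπ), map_neg (resHom hU),
      map_neg (resHom hU), map_neg (extHom F hπ φ σ), ← hx]; ring
  | h1 x =>
    obtain ⟨n, u, rfl⟩ := exists_unit_zpow hπ x
    have e : fang F (algebraMap A F π) * ang (unitF F u * unifF F hπ ^ n) =
        ang (unitF F u * unifF F hπ ^ (n + 1)) := by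
      rw [show fang F (algebraMap A F π) = ang (unifF F hπ) from fang_coe (unifF F hπ),
        ← map_mul, zpow_add_one]
      congr 1
      rw [mul_comm, mul_assoc]
    have eu : resHom hU (ang (red u)) = φ u := by rw [resHom, charHom_ang, resChar_red]
    rw [e, extHom_ang, rhoAdd_ang, rhoAdd_ang]
    rcases Int.even_or_odd n with hn | hn
    · rw [if_pos hn.add_one, if_neg (Int.not_odd_iff_even.2 hn), eu, map_zero, mul_zero, add_zero]
      obtain ⟨m, rfl⟩ := hn
      rw [zpow_add, Int.units_mul_self, mul_one]
    · rw [if_neg (Int.not_odd_iff_even.2 hn.add_one), if_pos hn, eu, map_zero, zero_add]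
      obtain ⟨m, rfl⟩ := hn
      rw [zpow_add, two_mul, zpow_add, Int.units_mul_self, one_mul, zpow_one, Units.val_mul,
        mul_comm]

/-- The image of an element of `ℛ𝒫(F)` is determined by its specialization. -/
theorem symbol_eq_theta (x : RP F) :
    g (toRPt x) = theta hU H he hne (rhoEven hK hπ x) +
      (σ : ℤ) • theta hU H he hne (rhoOdd hK hπ x) := by
  induction x using RP.induction with
  | h0 =>
    rw [toRPt_zero, map_zero, map_zero, map_zero, map_zero, map_zero, smul_zero, add_zero]
  | ha x y hx hy =>
    rw [toRPt_add, map_add, hx, hy, map_add, map_add, map_add, map_add, smul_add]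
    abel
  | h1 r a =>
    obtain ⟨t, ht, ht'⟩ := exists_specFun_eq hU H he hne hK a.1.ne_zero a.ne_one
    have hs : spec F hK (r • sym a.1) = r • iota A F _ t := by
      rw [map_smul, ← fsym_coe, spec_fsym hK a.1.ne_zero a.ne_one, ht]
    rw [rhoEven_apply hK _ hs, rhoOdd_apply hK _ hs, theta_smul, theta_smul, ht', smul_smul,
      ← add_smul, resHom_rhoAdd, toRPt_smul, H.smul, ← fsym_coe]
    rfl

/-- The map `ℛ𝒫(A) → ℛ𝒫(k)`, as an additive map. -/
def toRPk (A : Type u) [CommRing A] [IsLocalRing A] : RP A →+ RP (ResidueField A) :=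
  (Res.mk _ (RP (ResidueField A))).symm.toAddMonoidHom.comp (RP.map (residue A)).toAddMonoidHom

theorem toRPk_smul (r : GR A) (y : RP A) : toRPk A (r • y) = toRes A r • toRPk A y :=
  map_smul (RP.map (residue A)) r y

theorem toRPk_sym (u : W A) : toRPk A (sym u.1) = fsym (residue A u.1) := by
  refine (freeMap_freeSym (residue A) u.1 (W.compl u) rfl).trans ?_
  exact (fsym_coe (red u.1)).symm

theorem toRes_surjective : Function.Surjective (toRes A) := by
  intro r
  induction r using GR.induction with
  | h0 => exact ⟨0, map_zero _⟩
  | h1 c =>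
    obtain ⟨u, rfl⟩ := red_surjective c
    exact ⟨ang u, mapGR_ang _ _⟩
  | ha x y hx hy =>
    obtain ⟨x, rfl⟩ := hx
    obtain ⟨y, rfl⟩ := hy
    exact ⟨x + y, map_add _ _ _⟩
  | hn x hx =>
    obtain ⟨x, rfl⟩ := hx
    exact ⟨-x, map_neg _ _⟩

theorem toRPk_surjective : Function.Surjective (toRPk A) := by
  intro x
  induction x using RP.induction with
  | h0 => exact ⟨0, map_zero _⟩
  | h1 r a =>
    obtain ⟨r, rfl⟩ := toRes_surjective r
    obtain ⟨u, hu⟩ := exists_residue_eq a.1.ne_zero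
    refine ⟨r • sym u, ?_⟩
    rw [toRPk_smul, toRPk_sym (⟨u, isUnit_one_sub_of_residue (hu ▸ a.ne_one)⟩ : W A), hu, fsym_coe]
  | ha x y hx hy =>
    obtain ⟨x, rfl⟩ := hx
    obtain ⟨y, rfl⟩ := hy
    exact ⟨x + y, map_add _ _ _⟩

theorem theta_toRPk (y : RP A) :
    theta hU H he hne (toRPt (toRPk A y)) = g (toRPt (toRPF A F y)) := by
  induction y using RP.induction with
  | h0 => rw [map_zero, map_zero, toRPt_zero, toRPt_zero, map_zero, map_zero]
  | ha x y hx hy => rw [map_add, map_add, toRPt_add, toRPt_add, map_add, map_add, hx, hy]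
  | h1 r a =>
    rw [toRPk_smul, toRPF_smul, toRPt_smul, toRPt_smul, H.smul, theta_smul, resHom_toRes,
      extHom_toFrac, toRPk_sym, toRPF_sym]
    congr 1
    exact theta_br hU H he hne (residue_ne_one a.2)

end Theta

/-! ### Exactness -/

section Exactness

open IsLocalRing

variable {A : Type u} [CommRing A] [IsDomain A] [IsDiscreteValuationRing A]
  {F : Type v} [Field F] [Algebra A F] [IsFractionRing A F]
  {π : A} {hπ : Irreducible π} {φ : Aˣ →* ℤˣ}
  {p : Ideal (GR A)} [hp : p.IsPrime] (h2 : (2 : GR A) ∉ p)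
  (hφ : ∀ r : GR A, ∃ s ∉ p, s * (r - (charHom φ r : GR A)) = 0)

include h2 in
theorem four_notMem : (4 : GR A) ∉ p := fun h => by
  rw [show (4 : GR A) = 2 * 2 by norm_num] at h
  exact (hp.mem_or_mem h).elim h2 h2

include h2 in
/-- An element of `ℛ𝒫₁(F)` vanishes locally if its images in both eigenspaces vanish. -/
theorem exists_smul_eq_zero {x : RP F} (hx : lambdaOne F x = 0)
    (h : (eigenKer F p π 1).mkQ (toRPt x) = 0) (h' : (eigenKer F p π (-1)).mkQ (toRPt x) = 0) :
    ∃ s ∉ p, toFrac A F s • x = 0 := by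
  obtain ⟨s, hs, hsx⟩ := exists_toFrac_smul_eq_zero h2 h h'
  refine ⟨4 * s, fun hm => (hp.mem_or_mem hm).elim (four_notMem h2) hs, ?_⟩
  rw [← toRPt_smul] at hsx
  have := four_smul_eq_zero (exists_notMem_fractionRing A F)
    ((Submodule.Quotient.mk_eq_zero _).1 hsx) (by rw [map_smul, hx, smul_zero])
  rw [← Int.cast_smul_eq_zsmul (GR F)] at this
  rw [map_mul, mul_smul, map_ofNat]
  exact_mod_cast this

theorem charHom_sub_one (φ : Aˣ →* ℤˣ) (u : Aˣ) :
    charHom φ (dang u) = 0 ∨ charHom φ (dang u) = -2 := by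
  rw [map_sub, map_one, charHom_ang]
  rcases Int.units_eq_one_or (φ u) with h | h <;> rw [h]
  · exact Or.inl rfl
  · exact Or.inr rfl

/-- The value of `λ₁` at a symbol is a product of two elements `⟨u⟩ - 1`, at which a character is
`0` or `-2`. -/
theorem four_dvd_charHom_lambdaOne (φ : Aˣ →* ℤˣ) (y : RP A) : 4 ∣ charHom φ (lambdaOne A y) := by
  induction y using RP.induction with
  | h0 => simp
  | ha x y hx hy => rw [map_add, map_add]; exact dvd_add hx hy
  | h1 r a =>
    rw [map_smul, lambdaOne_sym a.1 (W.compl a) rfl, smul_eq_mul, map_mul, map_mul]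
    refine Dvd.dvd.mul_left ?_ _
    rcases charHom_sub_one φ a.1 with h | h <;>
      rcases charHom_sub_one φ (W.compl a) with h' | h' <;> rw [h, h'] <;> norm_num

theorem toRPt_toRPF_psiOne (b : W A) : toRPt (toRPF A F (psiOne b)) = 0 := by
  have e : toRPF A F (psiOne b) = psi (algebraMap A F b.1) := by
    have hi : algebraMap A F (W.inv b).1 = (algebraMap A F b.1)⁻¹ := algebraMap_unit_inv b.1
    have hm : toFrac A F (ang (-1)) = fang F (-1) := by rw [toFrac_ang]; simp
    rw [psiOne, map_add, toRPF_smul, toRPF_sym, toRPF_sym, hi, hm, psi]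
  rw [e, toRPt_psi]

theorem lambdaOne_toRPF (y : RP A) : lambdaOne F (toRPF A F y) = toFrac A F (lambdaOne A y) :=
  lambdaOne_map _ _

include h2 hφ in
/-- An element of `ℛ𝒫₁(F)` that has the same images in the eigenspaces as an element of `ℛ𝒫(A)`
comes locally from `ℐ_A ℛ𝒫₁(A)`. -/
theorem exists_smul_mem_of_eq (he : φ (-1) = 1) {b : W A} (hb : φ b.1 = -1) {x : RP F}
    (hx : lambdaOne F x = 0) {y : RP A}
    (h : (eigenKer F p π 1).mkQ (toRPt (toRPF A F y)) = (eigenKer F p π 1).mkQ (toRPt x))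
    (h' : (eigenKer F p π (-1)).mkQ (toRPt (toRPF A F y)) = (eigenKer F p π (-1)).mkQ (toRPt x)) :
    ∃ s ∉ p, ∃ z ∈ IRPOne A, toRPF A F z = toFrac A F s • x := by
  obtain ⟨k, hk⟩ := four_dvd_charHom_lambdaOne φ y
  have hψ : charHom φ (lambdaOne A (psiOne b)) = 4 := by
    rw [lambdaOne_psiOne, map_neg, map_mul, map_add, map_sub, map_one, charHom_ang, charHom_ang, he,
      hb]; rfl
  -- the correction by `ψ₁(b)` makes the value of `λ₁` vanish locally
  obtain ⟨y', hy'⟩ : ∃ y', y' = y - (k : GR A) • psiOne b := ⟨_, rfl⟩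
  have hlam : charHom φ (lambdaOne A y') = 0 := by
    rw [hy', map_sub, map_smul, smul_eq_mul, map_sub, map_mul, hk, hψ, map_intCast, Int.cast_id]
    ring
  obtain ⟨s, hs, hsy⟩ := hφ (lambdaOne A y')
  rw [hlam, Int.cast_zero, sub_zero] at hsy
  have hy1 : s • y' ∈ RPOne A := by
    change lambdaOne A (s • y') = 0
    rw [map_smul, smul_eq_mul, hsy]
  have hyy : toRPt (toRPF A F y') = toRPt (toRPF A F y) := by
    rw [hy', map_sub, toRPF_smul, toRPt_sub, toRPt_smul, toRPt_toRPF_psiOne, smul_zero, sub_zero]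
  have hz : ∀ σ, (eigenKer F p π σ).mkQ (toRPt (toRPF A F y)) = (eigenKer F p π σ).mkQ (toRPt x) →
      (eigenKer F p π σ).mkQ (toRPt (toFrac A F s • (x - toRPF A F y'))) = 0 := fun σ hσ => by
    rw [toRPt_smul, toRPt_sub, hyy, map_smul, map_sub, hσ, sub_self, smul_zero]
  obtain ⟨s', hs', hsx⟩ := exists_smul_eq_zero h2 (π := π) (by
    rw [map_smul, map_sub, hx, lambdaOne_toRPF, zero_sub, smul_neg, smul_eq_mul, ← map_mul, hsy,
      map_zero, neg_zero]) (hz 1 h) (hz (-1) h')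
  have hd : dang b.1 ∉ p := notMem_of_charHom h2 hφ (by
    rw [map_sub, map_one, charHom_ang, hb]; rfl)
  refine ⟨dang b.1 * (s' * s), fun hm => (hp.mem_or_mem hm).elim hd
    fun hm => (hp.mem_or_mem hm).elim hs' hs, dang b.1 • (s' • s • y'),
    Submodule.smul_mem_smul (dang_mem _) (Submodule.smul_mem _ _ hy1), ?_⟩
  rw [smul_sub, smul_sub, sub_eq_zero] at hsx
  rw [toRPF_smul, toRPF_smul, toRPF_smul, ← hsx, map_mul, map_mul, mul_smul, mul_smul]

variable (hK : ∀ s : Finset (ResidueField A), s.card ≤ 7 → ∃ x, x ∉ s)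

theorem extHom_one_eq_aug (h1 : ∀ u, φ u = 1) (r : GR F) : extHom F hπ φ 1 r = aug F r := by
  induction r using GR.induction with
  | h0 => simp
  | ha x y hx hy => rw [map_add, map_add, hx, hy]
  | hn x hx => rw [map_neg, map_neg, hx]
  | h1 x =>
    obtain ⟨n, u, rfl⟩ := exists_unit_zpow hπ x
    rw [extHom_ang, h1, one_zpow]
    exact (aug_of _).symm

/-- The sum of the components of the specialization at the even and at the odd powers of the
uniformizer corresponds to `σ = 1`, so that `ℛ_F` acts on it through that extension of the
character. If `φ` is trivial, this is the augmentation. -/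
theorem theta_even_add_odd {Q : Type w} [AddCommGroup Q] {g : RPt F →+ Q} {σ : ℤˣ}
    (H : IsSignSymbol (extHom F hπ φ σ) g) (he : φ (-1) = 1)
    (hU : ∀ u : Aˣ, residue A u = 1 → φ u = 1) (hne : (∃ u, φ u = -1) ∨ σ = -1) (r : GR F)
    (x : RP F) :
    theta hU H he hne (rhoEven hK hπ (r • x) + rhoOdd hK hπ (r • x)) =
      extHom F hπ φ 1 r • theta hU H he hne (rhoEven hK hπ x + rhoOdd hK hπ x) := by
  induction x using RP.induction with
  | h0 => simp
  | ha x y hx hy =>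
    have e : ∀ x y : RP F, rhoEven hK hπ (x + y) + rhoOdd hK hπ (x + y) =
        (rhoEven hK hπ x + rhoOdd hK hπ x) + (rhoEven hK hπ y + rhoOdd hK hπ y) := fun x y => by
      rw [map_add, map_add]; abel
    rw [smul_add, e, e, map_add (theta hU H he hne) (_ + _), hx, hy,
      map_add (theta hU H he hne) (_ + _) (_ + _), smul_add]
  | h1 s a =>
    obtain ⟨t, ht, -⟩ := exists_specFun_eq hU H he hne hK a.1.ne_zero a.ne_one
    have hs : ∀ s : GR F, spec F hK (s • sym a.1) = s • iota A F _ t := fun s => by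
      rw [map_smul, ← fsym_coe, spec_fsym hK a.1.ne_zero a.ne_one, ht]
    have key : ∀ s : GR F, theta hU H he hne (rhoEven hK hπ (s • sym a.1) +
        rhoOdd hK hπ (s • sym a.1)) = extHom F hπ φ 1 s • theta hU H he hne t := fun s => by
      have := resHom_rhoAdd (F := F) (hπ := hπ) (σ := 1) hU s
      rw [Units.val_one, one_mul] at this
      rw [rhoEven_apply hK _ (hs s), rhoOdd_apply hK _ (hs s), ← add_smul, theta_smul, map_add,
        this]
    rw [smul_smul, key, key, map_mul, mul_smul]

include h2 in
variable (hπ) in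
/-- An element of `ℐ_F ℛ𝒫₁(F)` in the kernel of `δ_π` comes locally from `ℐ_A ℛ𝒫₁(A)`. -/
theorem exists_smul_mem_of_rhoOdd_eq_zero {x : RP F} (hx : x ∈ IRPOne F)
    (hδ : rhoOdd hK hπ x = 0) : ∃ s ∉ p, ∃ z ∈ IRPOne A, toRPF A F z = toFrac A F s • x := by
  obtain ⟨φ, hφ⟩ := exists_charHom p h2
  have hx1 : lambdaOne F x = 0 := Submodule.smul_le_right (I := augIdeal F) (N := RPOne F) hx
  have hzero : (eigenKer F p π 1).mkQ (toRPt x) = 0 → (eigenKer F p π (-1)).mkQ (toRPt x) = 0 →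
      ∃ s ∉ p, ∃ z ∈ IRPOne A, toRPF A F z = toFrac A F s • x := fun h h' => by
    obtain ⟨s, hs, hsx⟩ := exists_smul_eq_zero h2 hx1 h h'
    exact ⟨s, hs, 0, zero_mem _, by rw [hsx, map_zero]⟩
  have H := fun (π : A) (hπ : Irreducible π) σ => isSignSymbol_eigenKer (F := F) hπ σ h2 hφ
  rcases Int.units_eq_one_or (φ (-1)) with he | he
  swap
  · have he' : ∀ σ, extHom F hπ φ σ (fang F (-1)) = -1 := fun σ => by
      rw [extHom_neg_one, he]; rfl
    exact hzero ((H π hπ 1).odd_toRPt (exists_notMem_fractionRing A F) (he' _) hx1)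
      ((H π hπ (-1)).odd_toRPt (exists_notMem_fractionRing A F) (he' _) hx1)
  by_cases hram : ∃ w, residue A (w : Aˣ) = 1 ∧ φ w = -1
  · obtain ⟨w, hw, hw'⟩ := hram
    obtain ⟨d, hd, u, hu, hu'⟩ := exists_irreducible_sign hw hw'
    obtain ⟨b, hb⟩ := exists_W_neg_of_residue hK hw hw'
    obtain ⟨y, hy, hy'⟩ := exists_toRPF_of_ramified (H d hd 1) (H d hd (-1)) he hK hu hu' x
    exact exists_smul_mem_of_eq h2 hφ he hb hx1 hy hy'
  have hU : ∀ u : Aˣ, residue A u = 1 → φ u = 1 := fun u hu =>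
    (Int.units_eq_one_or _).resolve_right fun h => hram ⟨u, hu, h⟩
  by_cases hex : ∃ u, φ u = -1
  · obtain ⟨t, ht⟩ := Submodule.mkQ_surjective _ (rhoEven hK hπ x)
    obtain ⟨y, rfl⟩ := toRPk_surjective t
    have key : ∀ σ, (eigenKer F p π σ).mkQ (toRPt (toRPF A F y)) =
        (eigenKer F p π σ).mkQ (toRPt x) := fun σ => by
      have h1 := symbol_eq_theta hU (H π hπ σ) he (Or.inl hex) hK x
      rw [hδ, map_zero, smul_zero, add_zero, ← ht] at h1
      exact (theta_toRPk hU (H π hπ σ) he (Or.inl hex) y).symm.trans h1.symm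
    obtain ⟨u, hu⟩ := hex
    have hu1 : residue A u ≠ 1 := fun h => by
      rw [hU u h] at hu; exact absurd hu (by decide)
    exact exists_smul_mem_of_eq h2 hφ he (b := ⟨u, isUnit_one_sub_of_residue hu1⟩) hu hx1
      (key 1) (key (-1))
  have h1 : ∀ u, φ u = 1 := fun u => (Int.units_eq_one_or _).resolve_right fun h => hex ⟨u, h⟩
  refine hzero ?_ ?_
  · refine Submodule.smul_induction_on hx (fun r hr y _ => ?_) fun y z hy hz => ?_
    · have := (H π hπ 1).smul r (toRPt y)
      rw [extHom_one_eq_aug h1, show aug F r = 0 from hr, zero_smul] at this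
      rw [toRPt_smul]; exact this
    · rw [toRPt_add, map_add, hy, hz, add_zero]
  · have hne : (∃ u, φ u = -1) ∨ (-1 : ℤˣ) = -1 := Or.inr rfl
    have h3 := symbol_eq_theta hU (H π hπ (-1)) he hne hK x
    have h4 : theta hU (H π hπ (-1)) he hne (rhoEven hK hπ x + rhoOdd hK hπ x) = 0 := by
      refine Submodule.smul_induction_on hx (fun r hr y _ => ?_) fun y z hy hz => ?_
      · rw [theta_even_add_odd, extHom_one_eq_aug h1, show aug F r = 0 from hr, zero_smul]
      · rw [map_add (rhoEven hK hπ), map_add (rhoOdd hK hπ), add_add_add_comm, map_add, hy, hz,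
          add_zero]
    rw [hδ, add_zero] at h4
    rw [hδ, map_zero, smul_zero, add_zero, h4] at h3
    exact h3

include h2 in
variable (hπ) in
/-- An element of `RPtOne k` is locally in the image of `δ_π`. -/
theorem exists_rhoOdd_eq_smul {t : RPt (ResidueField A)} (ht : t ∈ RPtOne (ResidueField A)) :
    ∃ s ∉ p, ∃ x ∈ IRPOne F, rhoOdd hK hπ x = toRes A s • t := by
  obtain ⟨φ, hφ⟩ := exists_charHom p h2
  by_cases hram : ∃ w, residue A (w : Aˣ) = 1 ∧ φ w = -1
  · obtain ⟨w, hw, hw'⟩ := hram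
    refine ⟨dang w, notMem_of_charHom h2 hφ (by rw [map_sub, map_one, charHom_ang, hw']; rfl), 0,
      zero_mem _, ?_⟩
    rw [map_sub (toRes A), map_one (toRes A), toRes_ang, hw, map_one (fang _), sub_self, zero_smul,
      map_zero]
  have hU : ∀ u : Aˣ, residue A u = 1 → φ u = 1 := fun u hu =>
    (Int.units_eq_one_or _).resolve_right fun h => hram ⟨u, hu, h⟩
  obtain ⟨⟨y, hy⟩, hyt⟩ := toTilde_surjective ⟨t, ht⟩
  have hyt' : toRPt y = t := congrArg Subtype.val hyt
  obtain ⟨x, rfl⟩ := toRPk_surjective y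
  have hx : toRes A (lambdaOne A x) = 0 := (lambdaOne_map (residue A) x).symm.trans hy
  obtain ⟨s, hs, hsx⟩ := hφ (lambdaOne A x)
  rw [← resHom_toRes hU, hx, map_zero, Int.cast_zero, sub_zero] at hsx
  have hx1 : toRPF A F (s • x) ∈ RPOne F := by
    change lambdaOne F _ = 0
    rw [lambdaOne_toRPF, map_smul, smul_eq_mul, hsx, map_zero]
  refine ⟨s, hs, dang (unifF F hπ) • toRPF A F (s • x),
    Submodule.smul_mem_smul (dang_mem _) hx1, ?_⟩
  have e : spec F hK (dang (unifF F hπ) • toRPF A F (s • x)) =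
      dang (unifF F hπ) • iota A F _ (toRPt (toRPk A (s • x))) := by
    rw [map_smul]
    exact congrArg _ (spec_map hK (s • x))
  have h1 := rhoAdd_ang (F := F) hπ 1 1
  rw [map_one, one_mul, zpow_one, if_pos odd_one, map_one, show ang (1 : (ResidueField A)ˣ) = 1 from
    map_one _] at h1
  rw [rhoOdd_apply hK _ e, map_sub, h1, rhoAdd_one, sub_zero, one_smul, toRPk_smul,
    toRPt_smul, hyt']

theorem rhoOdd_toRPF (y : RP A) : rhoOdd hK hπ (toRPF A F y) = 0 := by
  have e : spec F hK (toRPF A F y) = (1 : GR F) • iota A F _ (toRPt (toRPk A y)) := by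
    rw [one_smul]; exact spec_map hK y
  rw [rhoOdd_apply hK _ e, rhoAdd_one, zero_smul]

end Exactness

/-! ### Sufficiently large fields -/

section Large

/-- A sufficiently large field has more than seven elements, because `1 + (p - 1) d ≤ p ^ d`. -/
theorem SufficientlyLarge.exists_notMem {k : Type*} [Field k] (h : SufficientlyLarge k)
    (s : Finset k) (hs : s.card ≤ 7) : ∃ x, x ∉ s := by
  rcases h with h | ⟨p, d, hp, hk, hpd⟩
  · exact Infinite.exists_notMem_finset s
  · by_contra hcon
    push Not at hcon
    have h1 : Nat.card k ≤ s.card := by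
      rw [← Set.ncard_univ, ← Set.ncard_coe_finset]
      exact Set.ncard_le_ncard (fun x _ => hcon x) s.finite_toSet
    have h2 : 1 + (p - 1) * d ≤ p ^ d := by
      have hp1 := hp.one_le
      have := one_add_mul_le_pow (R := ℤ) (a := (p : ℤ) - 1) (by omega) d
      rw [add_sub_cancel] at this
      zify [hp1]
      linarith
    omega

end Large

end RefinedScissors

end


open RefinedScissors IsLocalRing in
theorem mainTheorem3 {A : Type*} [CommRing A] [IsDomain A] [IsDiscreteValuationRing A]
    {F : Type*} [Field F] [Algebra A F] [IsFractionRing A F]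
    (hk : SufficientlyLarge (ResidueField A)) {π : A} (hπ : Irreducible π) :
    -- the canonical map `ℛ𝒫₁(k)[1/2] → RPtOne(k)[1/2]` is an isomorphism
    Function.Bijective (half (toTilde (ResidueField A))) ∧
    -- the specialization map `S` exists
    ∃ S : RP F →ₗ[GR F] IndRes A F (RPt (ResidueField A)), IsSpecialization S ∧
    -- `ρ_π ∘ S` restricts to a map `δ₁ : ℛ𝒫₁(F) → RPtOne(k)`
    ∃ δ₁ : Res (toFrac A F) (RPOne F) →ₗ[GR A] Res (toRes A) (RPtOne (ResidueField A)),
      (∀ x : RPOne F, Res.map (toRes A) _ (RPtOne (ResidueField A)).subtype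
        (δ₁ (Res.mk (toFrac A F) _ x)) = rho hπ _ (S x)) ∧
    -- `δ` is the resulting map `ℐ_F ℛ𝒫₁(F)[1/2] → ℛ𝒫₁(k)[1/2]`
    ∃ δ : Half (Res (toFrac A F) (IRPOne F)) →ₗ[GR A]
        Half (Res (toRes A) (RPOne (ResidueField A))),
      half (Res.map (toRes A) _ (toTilde (ResidueField A))) ∘ₗ δ =
        half (δ₁ ∘ₗ Res.map (toFrac A F) _ (IRPOne.incl F)) ∧
      Function.Exact (half (IRPOne.map (algebraMap A F))) δ ∧
      Function.Surjective δ := by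
  have hK := hk.exists_notMem
  refine ⟨half_bijective _ (fun x hx => ⟨2, toTilde_eq_zero hK hx⟩) toTilde_surjective,
    spec F hK, isSpecialization_spec hK, delta F hK hπ, delta_apply hK hπ, ?_⟩
  refine half_exact _ _ _ (half_bijective _ (fun x hx => ⟨2, toTilde_eq_zero hK hx⟩)
    toTilde_surjective) (fun x => ?_) (fun y hy => ?_) fun z => ?_
  · exact Subtype.ext (rhoOdd_toRPF (hπ := hπ) hK x.1)
  · obtain ⟨n, z, hz, h⟩ := exists_two_pow_smul_mem (R := GR A) (M := Res (toFrac A F) (RP F))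
      ((IRPOne A).map (RP.map (algebraMap A F))) y.1 fun p hp h2 => by
        obtain ⟨s, hs, z, hz, h⟩ := exists_smul_mem_of_rhoOdd_eq_zero hπ h2 hK y.2
          (congrArg Subtype.val hy)
        exact ⟨s, hs, z, hz, h⟩
    exact ⟨n, ⟨z, hz⟩, Subtype.ext h.symm⟩
  · obtain ⟨n, x, h⟩ := exists_two_pow_smul_mem (R := GR A)
      (M := Res (toRes A) (RPtOne (ResidueField A)))
      (LinearMap.range (delta F hK hπ ∘ₗ Res.map (toFrac A F) _ (IRPOne.incl F))) z
      fun p hp h2 => by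
        obtain ⟨s, hs, x, hx, h⟩ := exists_rhoOdd_eq_smul (F := F) hπ h2 hK z.2
        exact ⟨s, hs, ⟨x, hx⟩, Subtype.ext h⟩
    exact ⟨n, x, h.symm⟩
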